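/- Consider the class of equations $$E_\sigma:\qquad (u_t+uu_x+u_{xx})_x+\sigma(t)\,u_{yy}=0,\qquad u=u(t,x,y),$$ where $\sigma$ is a smooth nowhere vanishing real function on a nonempty open interval $I$. A point transformation from $E_\sigma$ (over $I$) to $E_{\tilde\sigma}$ (over $\tilde I$) is a smooth diffeomorphism $\Phi:(t,x,y,u)\mapsto(\tilde t,\tilde x,\tilde y,\tilde u)$ from an open subset of $I\times\mathbb R^3$ onto an open subset of $\tilde I\times\mathbb R^3$ that maps the first equation to the second one: whenever $\Phi$ transforms the germ of a smooth function $u$ into that of a smooth function $\tilde u$, $u$ satisfies $E_\sigma$ at the given point if and only if $\tilde u$ satisfies $E_{\tilde\sigma}$ at the corresponding point. Let $\mathsf{G_E}$ consist of the diffeomorphisms between open subsets of $I\times\mathbb R^3$ and $\tilde I\times\mathbb R^3$ of the form $$\tilde t=T(t)=\frac{at+b}{ct+d},\qquad \tilde x=\frac{\varepsilon\sqrt\Delta}{ct+d}\,x-\frac{\varepsilon\sqrt\Delta}{2Y_1}\frac{\dot Y_0}{(ct+d)\sigma}\,y+\beta_0(t),\qquad \tilde y=Y_1y+Y_0(t),$$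 $$u=\frac{\varepsilon\sqrt\Delta}{ct+d}\,\tilde u+\frac{c}{ct+d}\,x+\frac1{2Y_1}\Big(\frac{\ddot Y_0}{\sigma}-\frac{c}{ct+d}\frac{\dot Y_0}{\sigma}-\frac{\dot Y_0\dot\sigma}{\sigma^2}\Big)y-\frac1{4Y_1^2}\frac{\dot Y_0^2}{\sigma}-\frac{\varepsilon}{\sqrt\Delta}(ct+d)\dot\beta_0,$$ $$\tilde\sigma(T(t))=\varepsilon\Delta^{-3/2}Y_1^2(ct+d)^3\sigma(t),$$ where $\varepsilon=\pm1$, $a,b,c,d$ are real constants with $\Delta=ad-bc>0$ and $ct+d\neq0$ for all occurring $t$, $Y_1$ is a nonzero constant, and $Y_0,\beta_0$ are arbitrary smooth functions of $t$ on the set of occurring $t$. Then: 1. For every $E_\sigma$ over $I$ and all such parameters with $ct+d\ne0$ on $I$ and $Y_0,\beta_0$ smooth on $I$, the formulas define a point transformation with domain $I\times\mathbb R^3$ and range $T(I)\times\mathbb R^3$ from $E_\sigma$ to an equation $E_{\tilde\sigma}$ of the class over $T(I)$. 2. (Maximality, normalization.) A diffeomorphism $\Phi$ between open subsets of $I\times\mathbb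 R^3$ and $\tilde I\times\mathbb R^3$ whose domain is connected and has connected intersections with the hyperplanes $t=\mathrm{const}$ is a point transformation from $E_\sigma$ to $E_{\tilde\sigma}$ if and only if it belongs to $\mathsf{G_E}$. Every point transformation from $E_\sigma$ to $E_{\tilde\sigma}$, on any domain, belongs to $\mathsf{G_E}$ near each point of its domain. 3. $\mathsf{G_E}$ is a pseudogroup of transformations between equations of the class: it contains the identity of each $E_\sigma$ and is closed under inversion and under composition of transformations $E_\sigma\to E_{\tilde\sigma}\to E_{\hat\sigma}$. It is infinite-dimensional: for every $E_\sigma$ over $I$ there is an infinite-dimensional vector space of vector fields on $I\times\mathbb R^3$, each of which generates a smooth one-parameter group of elements of $\mathsf{G_E}$ (with domain $I\times\mathbb R^3$) that map $E_\sigma$ to itself. 4. For $E_\sigma$ over $I$ the following are equivalent: (i) there is a point transformation, with domain $I\times\mathbb R^3$, from $E_\sigma$ to an equation $E_k$ with a nonzero constant $k$; (ii) for every $t_0\in I$ there is a point transformation from $E_\sigma$ to an equation with nonzero constant coefficient whose domain contains a point with $t=t_0$; (iii) there is a constant $\sigma_0\neq0$ such that either $\sigma=\sigma_0$ on $I$,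 or $\sigma(t)=\sigma_0(t+\kappa)^{-3}$ on $I$ for some constant $\kappa$. -/

import Mathlib

open Set Filter Topology
open scoped ContDiff

/-- The space of independent variables `(t, x, y)`. -/
abbrev IndepSpace : Type := ℝ × ℝ × ℝ

/-- The space of independent and dependent variables `((t, x, y), u)`. -/
abbrev VarSpace : Type := IndepSpace × ℝ

noncomputable section

/-- The partial derivative `∂f/∂t`. -/
def partialT (f : IndepSpace → ℝ) : IndepSpace → ℝ := fun p => fderiv ℝ f p (1, 0, 0)

/-- The partial derivative `∂f/∂x`. -/
def partialX (f : IndepSpace → ℝ) : IndepSpace → ℝ := fun p => fderiv ℝ f p (0, 1, 0)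

/-- The partial derivative `∂f/∂y`. -/
def partialY (f : IndepSpace → ℝ) : IndepSpace → ℝ := fun p => fderiv ℝ f p (0, 0, 1)

/-- The left-hand side `(u_t + u u_x + u_xx)_x + σ(t) u_yy` of the equation, at the point `p`. -/
def gkzk (σ : ℝ → ℝ) (u : IndepSpace → ℝ) (p : IndepSpace) : ℝ :=
  partialX (fun q => partialT u q + u q * partialX u q + partialX (partialX u) q) p
    + σ p.1 * partialY (partialY u) p

/-- `σ` is the coefficient of an equation of the class over the open time interval `I`:
a smooth function on `I` without zeros. -/
structure IsCoefficient (σ : ℝ → ℝ) (I : Set ℝ) : Prop where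
  isOpen : IsOpen I
  ordConnected : I.OrdConnected
  nonempty : I.Nonempty
  smooth : ContDiffOn ℝ ∞ σ I
  ne_zero : ∀ t ∈ I, σ t ≠ 0

/-- All points `((t, x, y), u)` with `t ∈ I`. -/
def slab (I : Set ℝ) : Set VarSpace := {P | P.1.1 ∈ I}

/-- The values taken by `t` on a set of points `((t, x, y), u)`. -/
def timeRange (D : Set VarSpace) : Set ℝ := (fun P : VarSpace => P.1.1) '' D

/-- A (local, smooth, invertible) point transformation
`((t, x, y), u) ↦ ((t', x', y'), u')`: a diffeomorphism between two open sets. -/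
def IsPointTransformation (Φ : OpenPartialHomeomorph VarSpace VarSpace) : Prop :=
  ContDiffOn ℝ ∞ Φ Φ.source ∧ ContDiffOn ℝ ∞ Φ.symm Φ.target

/-- Near the point of the graph of `u` over `p`, the transformation `Φ` maps the graph of `u`
into the graph of `v`. (As `Φ` is a diffeomorphism, it then maps a neighbourhood of that point
in the graph of `u` onto a neighbourhood of the image point in the graph of `v`.) -/
def TransformsInto (Φ : OpenPartialHomeomorph VarSpace VarSpace) (u v : IndepSpace → ℝ) (p : IndepSpace) : Prop :=
  ∀ᶠ q in 𝓝 p, (Φ (q, u q)).2 = v (Φ (q, u q)).1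

/-- `Φ` maps the equation with coefficient `σ` to the equation with coefficient `σ'`, the
equations being understood as conditions on jets: whenever `Φ` transforms (the germ of) a
function `u` into `v`, `u` satisfies the first equation at a point if and only if `v` satisfies
the second one at the corresponding point. -/
def MapsEquation (σ σ' : ℝ → ℝ) (Φ : OpenPartialHomeomorph VarSpace VarSpace) : Prop :=
  ∀ (u v : IndepSpace → ℝ) (p : IndepSpace), (p, u p) ∈ Φ.source →
    ContDiffAt ℝ ∞ u p → ContDiffAt ℝ ∞ v (Φ (p, u p)).1 →
    TransformsInto Φ u v p →
    (gkzk σ u p = 0 ↔ gkzk σ' v (Φ (p, u p)).1 = 0)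

/-- `Φ` is a point transformation between the equation with coefficient `σ` over `I` and the
equation with coefficient `σ'` over `I'`. -/
structure Admissible (σ : ℝ → ℝ) (I : Set ℝ) (σ' : ℝ → ℝ) (I' : Set ℝ)
    (Φ : OpenPartialHomeomorph VarSpace VarSpace) : Prop where
  isPointTransformation : IsPointTransformation Φ
  source_subset : Φ.source ⊆ slab I
  target_subset : Φ.target ⊆ slab I'
  mapsEquation : MapsEquation σ σ' Φ

/-- The parameters `a, b, c, d, ε, Y₁` and `Y₀(t), β₀(t)` of the transformations. -/
structure GroupParam where
  a : ℝ
  b : ℝ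
  c : ℝ
  d : ℝ
  ε : ℝ
  Y₁ : ℝ
  Y₀ : ℝ → ℝ
  β₀ : ℝ → ℝ

namespace GroupParam

/-- `Δ = ad - bc`. -/
def Δ (g : GroupParam) : ℝ := g.a * g.d - g.b * g.c

/-- The Möbius transformation `T(t) = (at + b) / (ct + d)`. -/
def T (g : GroupParam) (t : ℝ) : ℝ := (g.a * t + g.b) / (g.c * t + g.d)

/-- The restrictions on the parameters, for transformations over the set `J` of times. -/
structure Valid (g : GroupParam) (J : Set ℝ) : Prop where
  Δ_pos : 0 < g.Δ
  sign : g.ε = 1 ∨ g.ε = -1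
  Y₁_ne_zero : g.Y₁ ≠ 0
  smooth_Y₀ : ContDiffOn ℝ ∞ g.Y₀ J
  smooth_β₀ : ContDiffOn ℝ ∞ g.β₀ J
  denom_ne_zero : ∀ t ∈ J, g.c * t + g.d ≠ 0

/-- `x'` as a function of `t, x, y`. -/
def xNew (g : GroupParam) (σ : ℝ → ℝ) (t x y : ℝ) : ℝ :=
  g.ε * √g.Δ / (g.c * t + g.d) * x
    - g.ε * √g.Δ / (2 * g.Y₁) * (deriv g.Y₀ t / ((g.c * t + g.d) * σ t)) * y
    + g.β₀ t

/-- `u` as a function of `t, x, y` and of the new dependent variable `u'`. -/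
def uOld (g : GroupParam) (σ : ℝ → ℝ) (t x y u' : ℝ) : ℝ :=
  g.ε * √g.Δ / (g.c * t + g.d) * u' + g.c / (g.c * t + g.d) * x
    + 1 / (2 * g.Y₁) *
        (deriv (deriv g.Y₀) t / σ t - g.c / (g.c * t + g.d) * (deriv g.Y₀ t / σ t)
          - deriv g.Y₀ t * deriv σ t / σ t ^ 2) * y
    - 1 / (4 * g.Y₁ ^ 2) * (deriv g.Y₀ t ^ 2 / σ t)
    - g.ε / √g.Δ * (g.c * t + g.d) * deriv g.β₀ t

/-- `Φ` is, on its domain, the transformation with parameters `g` at the coefficient `σ`, and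
`σ'` is the new coefficient. -/
structure Realizes (g : GroupParam) (σ σ' : ℝ → ℝ) (Φ : OpenPartialHomeomorph VarSpace VarSpace) :
    Prop where
  valid : g.Valid (timeRange Φ.source)
  t_eq : ∀ t x y u : ℝ, ((t, x, y), u) ∈ Φ.source → (Φ ((t, x, y), u)).1.1 = g.T t
  x_eq : ∀ t x y u : ℝ, ((t, x, y), u) ∈ Φ.source →
    (Φ ((t, x, y), u)).1.2.1 = g.xNew σ t x y
  y_eq : ∀ t x y u : ℝ, ((t, x, y), u) ∈ Φ.source →
    (Φ ((t, x, y), u)).1.2.2 = g.Y₁ * y + g.Y₀ t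
  u_eq : ∀ t x y u : ℝ, ((t, x, y), u) ∈ Φ.source →
    u = g.uOld σ t x y (Φ ((t, x, y), u)).2
  coeff_eq : ∀ t ∈ timeRange Φ.source,
    σ' (g.T t) = g.ε * g.Δ ^ (-(3 / 2) : ℝ) * g.Y₁ ^ 2 * (g.c * t + g.d) ^ 3 * σ t

end GroupParam

/-- `Φ` is a transformation of the explicit family, from the equation with coefficient `σ` over
`I` to the equation with coefficient `σ'` over `I'`. -/
structure InGE (σ : ℝ → ℝ) (I : Set ℝ) (σ' : ℝ → ℝ) (I' : Set ℝ)
    (Φ : OpenPartialHomeomorph VarSpace VarSpace) : Prop where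
  isPointTransformation : IsPointTransformation Φ
  source_subset : Φ.source ⊆ slab I
  target_subset : Φ.target ⊆ slab I'
  exists_param : ∃ g : GroupParam, g.Realizes σ σ' Φ

/-- The vector field `V` over `I` generates a smooth one-parameter group of transformations of
the explicit family that map the equation with coefficient `σ` over `I` to itself. -/
def IsGenerator (σ : ℝ → ℝ) (I : Set ℝ) (V : slab I → VarSpace) : Prop :=
  ∃ Φ : ℝ → OpenPartialHomeomorph VarSpace VarSpace,
    (∀ s, (Φ s).source = slab I ∧ InGE σ I σ I (Φ s)) ∧
    ContDiffOn ℝ ∞ (fun q : ℝ × VarSpace => Φ q.1 q.2) (univ ×ˢ slab I) ∧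
    (∀ P ∈ slab I, Φ 0 P = P) ∧
    (∀ r s, ∀ P ∈ slab I, Φ (r + s) P = Φ r (Φ s P)) ∧
    ∀ P : slab I, HasDerivAt (fun s => Φ s P) (V P) 0

end

/-!
# Point transformations of generalized KZK equations with time-dependent coefficients

A smooth germ is represented by an element of the ring `SmoothGerm x`, on which the derivations `D w`
act; since they commute and pull-backs obey the chain rule, the calculations on jets are
calculations in these rings. A point transformation `Φ` acts on graphs. By the inverse function
theorem, the image of the graph of `u` is again a graph, provided that it is transversal to the
direction of the dependent variable (`Transversal.exists_transformsInto`). As the equation can be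
solved for `u_xxx`, the 2-jets of its solutions (at one point) are arbitrary, so that a point
transformation between two equations can be tested on explicit polynomials.

**Restricting the components of `Φ`.** Let `l` be a linear function of `t'` and `y'`. If the cube of
`l` is added to the image of a solution, then the target equation is not affected at the zero of
`l`, while a multiple of the cube of the derivative of `l` along `x` is added to the original one. Hence `t'`
and `y'` do not change along `x` and along `u` (`apply_fderiv_eq_zero`). With the square of `t'` in
place of `l³`, one sees that `t'` does not depend on `y` (`fderiv_fst_eY_eq_zero`). The dependence on
`u_xx` and `u_x` of the image of the jet of a solution (`exists_image_jet`) then shows that `x'` is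
independent of `u` and `u'` is affine in `u` (`MapsEquation.isAffine`).

**Determining equations.** Now `u = A v + B`, where `v` is the transformed function, and the
comparison of coefficients in the equation for `v` gives a system of differential equations
(`gkzkOp_affine`, `determining_equations`). With its differential consequences it yields
`IsNormalized`: with `t' = T(t)`, `x' = X(t, x, y)` and `y' = Y(t, y)`, one has `T_t = X_x²`,
the functions `X` and `Y` are affine in `x, y` with `Y_y` constant, `u'` is determined by `X`, and
`X_x X_xtt = 2 X_xt²` (`MapsEquation.isNormalized`). The last equation says that `1 / X_x` is an affine
function `c t + d`, whence `T` is a Möbius transformation. On a connected domain whose sections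
`t = const` are connected, functions that locally depend on `t` only do so globally
(`IsFamily.exists_eq_timeGerm`), and the system can be integrated (`IsNormalized.exists_realizes`). On
a ball this applies to every point transformation.

**The family.** Conversely, substitution shows that a transformation of the explicit family
multiplies the left-hand side of the equation by the fourth power of `X_x`
(`GroupParam.Realizes.mapsEquation`). Point transformations between equations can be inverted, and,
as they preserve the direction of the dependent variable, composed. The inverse or composition is
again normalized, so that it belongs to the family once `t'`, `x'`, `y'` have the right form
(`IsNormalized.realizes`); this leaves only the parameters to be computed. The symmetries
`x' = x + s p(t)`, `u' = u + s p'(t)` with polynomials `p` form one-parameter groups whose generators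
span an infinite-dimensional space (`boostField`).

**Constant coefficients.** If the equation can be made to have constant coefficients near every time,
then `σ (c t + d)³` is locally constant, with `c` and `d` that a priori depend on the place. Thus `σ`
is analytic, and by analytic continuation one pair `c, d` serves all times
(`exists_const_mul_cube_eq`). In the other direction, `t' = -1 / (t + κ)` makes the coefficient
`σ₀ (t + κ)⁻³` constant.
-/

noncomputable section

/-! ### Germs of smooth functions -/

section SmoothGerm

variable {E : Type*} [NormedAddCommGroup E] [NormedSpace ℝ E]

/-- The ring of germs at `x` of real functions that are smooth at `x`. -/
def smoothGerms (x : E) : Subring (Germ (𝓝 x) ℝ) where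
  carrier := {g | ∃ f : E → ℝ, ContDiffAt ℝ ∞ f x ∧ (f : Germ (𝓝 x) ℝ) = g}
  mul_mem' := by
    rintro _ _ ⟨f, hf, rfl⟩ ⟨g, hg, rfl⟩
    exact ⟨f * g, hf.mul hg, rfl⟩
  one_mem' := ⟨1, contDiffAt_const, rfl⟩
  add_mem' := by
    rintro _ _ ⟨f, hf, rfl⟩ ⟨g, hg, rfl⟩
    exact ⟨f + g, hf.add hg, rfl⟩
  zero_mem' := ⟨0, contDiffAt_const, rfl⟩
  neg_mem' := by
    rintro _ ⟨f, hf, rfl⟩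
    exact ⟨-f, hf.neg, rfl⟩

/-- The type of germs at `x` of real functions that are smooth at `x`. -/
abbrev SmoothGerm (x : E) : Type _ := smoothGerms x

namespace SmoothGerm

/-- The germ of a function that is smooth at `x`. -/
def mk (f : E → ℝ) {x : E} (hf : ContDiffAt ℝ ∞ f x) : SmoothGerm x := ⟨f, f, hf, rfl⟩

variable {x : E}

theorem exists_mk (g : SmoothGerm x) : ∃ f, ∃ hf : ContDiffAt ℝ ∞ f x, mk f hf = g := by
  obtain ⟨_, f, hf, rfl⟩ := g
  exact ⟨f, hf, rfl⟩

theorem mk_eq_mk {f g : E → ℝ} {hf : ContDiffAt ℝ ∞ f x} {hg : ContDiffAt ℝ ∞ g x} :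
    mk f hf = mk g hg ↔ f =ᶠ[𝓝 x] g :=
  Subtype.ext_iff.trans Germ.coe_eq

theorem mk_add {f g : E → ℝ} (hf : ContDiffAt ℝ ∞ f x) (hg : ContDiffAt ℝ ∞ g x) :
    mk f hf + mk g hg = mk (fun y => f y + g y) (hf.add hg) := rfl

theorem mk_mul {f g : E → ℝ} (hf : ContDiffAt ℝ ∞ f x) (hg : ContDiffAt ℝ ∞ g x) :
    mk f hf * mk g hg = mk (fun y => f y * g y) (hf.mul hg) := rfl

theorem mk_sub {f g : E → ℝ} (hf : ContDiffAt ℝ ∞ f x) (hg : ContDiffAt ℝ ∞ g x) :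
    mk f hf - mk g hg = mk (fun y => f y - g y) (hf.sub hg) := rfl

/-- The value of a germ at the point. -/
def ev : SmoothGerm x →+* ℝ := Filter.Germ.valueRingHom.comp (smoothGerms x).subtype

@[simp] theorem ev_mk {f : E → ℝ} (hf : ContDiffAt ℝ ∞ f x) : ev (mk f hf) = f x := rfl

/-- The germ of a constant function. -/
def const : ℝ →+* SmoothGerm x where
  toFun c := mk (fun _ => c) contDiffAt_const
  map_one' := rfl
  map_mul' _ _ := rfl
  map_zero' := rfl
  map_add' _ _ := rfl

@[simp] theorem ev_const (c : ℝ) : ev (const c : SmoothGerm x) = c := rfl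

theorem contDiffAt_fderiv_apply {f : E → ℝ} (hf : ContDiffAt ℝ ∞ f x) (w : E) :
    ContDiffAt ℝ ∞ (fun y => fderiv ℝ f y w) x :=
  (hf.fderiv_right (m := ∞) (by simp)).clm_apply contDiffAt_const

theorem eventually_differentiableAt {F : Type*} [NormedAddCommGroup F] [NormedSpace ℝ F]
    {f : E → F} (hf : ContDiffAt ℝ ∞ f x) :
    ∀ᶠ y in 𝓝 x, DifferentiableAt ℝ f y :=
  ((hf.of_le (by norm_num : (1 : ℕ∞ω) ≤ ∞)).eventually (by simp)).mono
    fun _ h => h.differentiableAt (by simp)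

/-- The derivative of germs in the direction `w`, as a map; it is computed with a chosen
representative. -/
def dirDeriv (w : E) (g : SmoothGerm x) : SmoothGerm x :=
  mk (fun y => fderiv ℝ (Classical.choose (exists_mk g)) y w)
    (contDiffAt_fderiv_apply (Classical.choose (Classical.choose_spec (exists_mk g))) w)

theorem dirDeriv_mk (w : E) {f : E → ℝ} (hf : ContDiffAt ℝ ∞ f x) :
    dirDeriv w (mk f hf) = mk (fun y => fderiv ℝ f y w) (contDiffAt_fderiv_apply hf w) := by
  have h := Classical.choose_spec (Classical.choose_spec (exists_mk (mk f hf)))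
  rw [mk_eq_mk] at h
  rw [dirDeriv, mk_eq_mk]
  filter_upwards [h.fderiv (𝕜 := ℝ)] with y hy
  rw [hy]

/-- The derivative of germs in the direction `w`, as a derivation of the ring of smooth germs. It is
only recorded to be `ℤ`-linear: real scalars enter through `SmoothGerm.const`. -/
def D (w : E) : Derivation ℤ (SmoothGerm x) (SmoothGerm x) :=
  Derivation.mk' (AddMonoidHom.toIntLinearMap (AddMonoidHom.mk' (dirDeriv w) (by
    intro a b
    obtain ⟨f, hf, rfl⟩ := exists_mk a
    obtain ⟨g, hg, rfl⟩ := exists_mk b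
    rw [mk_add, dirDeriv_mk, dirDeriv_mk, dirDeriv_mk, mk_add, mk_eq_mk]
    filter_upwards [eventually_differentiableAt hf, eventually_differentiableAt hg] with y h1 h2
    rw [fderiv_fun_add h1 h2, add_apply]))) (by
    intro a b
    obtain ⟨f, hf, rfl⟩ := exists_mk a
    obtain ⟨g, hg, rfl⟩ := exists_mk b
    simp only [AddMonoidHom.coe_toIntLinearMap, AddMonoidHom.mk'_apply, smul_eq_mul]
    rw [mk_mul, dirDeriv_mk, dirDeriv_mk, dirDeriv_mk, mk_mul, mk_mul, mk_add, mk_eq_mk]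
    filter_upwards [eventually_differentiableAt hf, eventually_differentiableAt hg] with y h1 h2
    rw [fderiv_fun_mul h1 h2]
    simp)

theorem D_mk (w : E) {f : E → ℝ} (hf : ContDiffAt ℝ ∞ f x) :
    D w (mk f hf) = mk (fun y => fderiv ℝ f y w) (contDiffAt_fderiv_apply hf w) :=
  dirDeriv_mk w hf

@[simp] theorem D_mul (w : E) (a b : SmoothGerm x) : D w (a * b) = a * D w b + b * D w a := by
  rw [Derivation.leibniz, smul_eq_mul, smul_eq_mul]

@[simp] theorem D_const (w : E) (c : ℝ) : D w (const c : SmoothGerm x) = 0 := by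
  change D w (mk (fun _ => c) contDiffAt_const) = mk (fun _ => 0) contDiffAt_const
  rw [D_mk, mk_eq_mk]
  exact Eventually.of_forall fun y => by simp

theorem ev_D_mk (w : E) {f : E → ℝ} (hf : ContDiffAt ℝ ∞ f x) :
    ev (D w (mk f hf)) = fderiv ℝ f x w := by
  rw [D_mk, ev_mk]

theorem D_comm (v w : E) (a : SmoothGerm x) : D v (D w a) = D w (D v a) := by
  obtain ⟨f, hf, rfl⟩ := exists_mk a
  rw [D_mk, D_mk, D_mk, D_mk, mk_eq_mk]
  have h2 : ∀ᶠ y in 𝓝 x, ContDiffAt ℝ 2 f y :=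
    (hf.of_le (by norm_cast)).eventually (by simp)
  filter_upwards [h2] with y hy
  have hs : IsSymmSndFDerivAt ℝ f y := hy.isSymmSndFDerivAt (by simp)
  have hd : DifferentiableAt ℝ (fderiv ℝ f) y :=
    (hy.fderiv_right (m := 1) (by norm_num)).differentiableAt (by simp)
  rw [fderiv_clm_apply hd (by fun_prop), fderiv_clm_apply hd (by fun_prop)]
  simpa using hs v w

/-- The germ at `x` of `g ∘ κ`, where `g` is a smooth germ at `y = κ x`. -/
def pull {F : Type*} [NormedAddCommGroup F] [NormedSpace ℝ F] (κ : E → F)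
    (hκ : ContDiffAt ℝ ∞ κ x) {y : F} (hy : κ x = y) : SmoothGerm y →+* SmoothGerm x where
  toFun g := ⟨Germ.compTendsto g.1 κ (hy ▸ hκ.continuousAt), by
    obtain ⟨_, f, hf, rfl⟩ := g
    subst hy
    exact ⟨f ∘ κ, hf.comp x hκ, rfl⟩⟩
  map_one' := rfl
  map_zero' := rfl
  map_mul' a b := by
    obtain ⟨_, f, hf, rfl⟩ := a
    obtain ⟨_, g, hg, rfl⟩ := b
    rfl
  map_add' a b := by
    obtain ⟨_, f, hf, rfl⟩ := a
    obtain ⟨_, g, hg, rfl⟩ := b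
    rfl

section pull

variable {F : Type*} [NormedAddCommGroup F] [NormedSpace ℝ F] {κ : E → F}
  {hκ : ContDiffAt ℝ ∞ κ x} {y : F} {hy : κ x = y}

theorem pull_mk {f : F → ℝ} (hf : ContDiffAt ℝ ∞ f y) :
    pull κ hκ hy (mk f hf) = mk (fun z => f (κ z)) (by subst hy; exact hf.comp x hκ) := rfl

@[simp] theorem ev_pull (g : SmoothGerm y) : ev (pull κ hκ hy g) = ev g := by
  obtain ⟨f, hf, rfl⟩ := exists_mk g
  rw [pull_mk, ev_mk, ev_mk, hy]

end pull

section chain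

/-- The chain rule for a map to the space of independent variables. -/
theorem D_pull_indep {κ : E → IndepSpace} {hκ : ContDiffAt ℝ ∞ κ x} {y : IndepSpace}
    {hy : κ x = y} (w : E) (g : SmoothGerm y) :
    D w (pull κ hκ hy g)
      = pull κ hκ hy (D (1, 0, 0) g) * D w (mk (fun z => (κ z).1) hκ.fst)
        + pull κ hκ hy (D (0, 1, 0) g) * D w (mk (fun z => (κ z).2.1) hκ.snd.fst)
        + pull κ hκ hy (D (0, 0, 1) g) * D w (mk (fun z => (κ z).2.2) hκ.snd.snd) := by
  obtain ⟨f, hf, rfl⟩ := exists_mk g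
  subst hy
  simp only [pull_mk, D_mk, mk_mul, mk_add]
  rw [mk_eq_mk]
  filter_upwards [hκ.continuousAt.eventually (eventually_differentiableAt hf),
    eventually_differentiableAt hκ] with z h1 h2
  have h3 : fderiv ℝ (fun z => f (κ z)) z = (fderiv ℝ f (κ z)).comp (fderiv ℝ κ z) :=
    fderiv_comp z h1 h2
  have e1 : fderiv ℝ (fun z => (κ z).1) z w = (fderiv ℝ κ z w).1 := by
    rw [fderiv.fst h2]; rfl
  have e2 : fderiv ℝ (fun z => (κ z).2.1) z w = (fderiv ℝ κ z w).2.1 := by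
    rw [fderiv.fst h2.snd, fderiv.snd h2]; rfl
  have e3 : fderiv ℝ (fun z => (κ z).2.2) z w = (fderiv ℝ κ z w).2.2 := by
    rw [fderiv.snd h2.snd, fderiv.snd h2]; rfl
  rw [h3, e1, e2, e3, ContinuousLinearMap.comp_apply]
  obtain ⟨a, b, c⟩ := fderiv ℝ κ z w
  have : ((a, b, c) : IndepSpace) = a • (1, 0, 0) + b • (0, 1, 0) + c • (0, 0, 1) := by simp
  rw [this, map_add, map_add, map_smul, map_smul, map_smul]
  simp [mul_comm]

end chain

end SmoothGerm

end SmoothGerm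

open SmoothGerm

section gkzk

/-- The direction of `t` in the space of independent variables. -/
abbrev eT : IndepSpace := (1, 0, 0)

/-- The direction of `x` in the space of independent variables. -/
abbrev eX : IndepSpace := (0, 1, 0)

/-- The direction of `y` in the space of independent variables. -/
abbrev eY : IndepSpace := (0, 0, 1)

namespace SmoothGerm

variable {p : IndepSpace}

theorem D_xt (a : SmoothGerm p) : D eX (D eT a) = D eT (D eX a) := D_comm _ _ _

theorem D_xy (a : SmoothGerm p) : D eX (D eY a) = D eY (D eX a) := D_comm _ _ _

/-- The left-hand side of the equation, at the base point, as a function of the germ of `u`; the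
number `s` is the value of the coefficient. -/
def gkzkOp (s : ℝ) (U : SmoothGerm p) : ℝ :=
  ev (D eT (D eX U)) + ev (D eX U) ^ 2 + ev U * ev (D eX (D eX U))
    + ev (D eX (D eX (D eX U))) + s * ev (D eY (D eY U))

end SmoothGerm

theorem gkzk_eq_gkzkOp (σ : ℝ → ℝ) {u : IndepSpace → ℝ} {p : IndepSpace}
    (hu : ContDiffAt ℝ ∞ u p) : gkzk σ u p = gkzkOp (σ p.1) (mk u hu) := by
  have h1 : partialX (fun q => partialT u q + u q * partialX u q + partialX (partialX u) q) p
      = ev (D eX (D eT (mk u hu) + mk u hu * D eX (mk u hu) + D eX (D eX (mk u hu)))) := by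
    simp only [D_mk, mk_mul, mk_add, ev_mk]
    rfl
  have h2 : partialY (partialY u) p = ev (D eY (D eY (mk u hu))) := by
    simp only [D_mk, ev_mk]
    rfl
  rw [gkzk, h1, h2, gkzkOp]
  simp only [map_add, D_mul, map_mul, ev_mk, D_xt]
  ring

end gkzk

/-! ### The action of a point transformation on graphs -/

section GraphTransform

variable {Φ : OpenPartialHomeomorph VarSpace VarSpace}

namespace IsPointTransformation

theorem symm (hΦ : IsPointTransformation Φ) : IsPointTransformation Φ.symm := ⟨hΦ.2, hΦ.1⟩

theorem contDiffAt (hΦ : IsPointTransformation Φ) {P : VarSpace} (hP : P ∈ Φ.source) :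
    ContDiffAt ℝ ∞ Φ P := hΦ.1.contDiffAt (Φ.open_source.mem_nhds hP)

theorem differentiableAt (hΦ : IsPointTransformation Φ) {P : VarSpace} (hP : P ∈ Φ.source) :
    DifferentiableAt ℝ Φ P := (hΦ.contDiffAt hP).differentiableAt (by simp)

theorem fderiv_symm_fderiv (hΦ : IsPointTransformation Φ) {P : VarSpace} (hP : P ∈ Φ.source)
    (w : VarSpace) : fderiv ℝ Φ.symm (Φ P) (fderiv ℝ Φ P w) = w := by
  have h0 : Φ.symm ∘ Φ =ᶠ[𝓝 P] id := Φ.eventually_left_inverse hP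
  have h := h0.fderiv_eq (𝕜 := ℝ)
  rw [fderiv_comp P (hΦ.symm.differentiableAt (Φ.map_source hP)) (hΦ.differentiableAt hP),
    fderiv_id] at h
  exact DFunLike.congr_fun h w

theorem fderiv_fderiv_symm (hΦ : IsPointTransformation Φ) {P : VarSpace} (hP : P ∈ Φ.source)
    (w : VarSpace) : fderiv ℝ Φ P (fderiv ℝ Φ.symm (Φ P) w) = w := by
  have h := hΦ.symm.fderiv_symm_fderiv (Φ.map_source hP) w
  rwa [Φ.symm_symm, Φ.left_inv hP] at h

end IsPointTransformation

/-- The map induced on the independent variables by the action of `Φ` on the graph of `u`. -/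
def graphMap (Φ : OpenPartialHomeomorph VarSpace VarSpace) (u : IndepSpace → ℝ) :
    IndepSpace → IndepSpace := fun q => (Φ (q, u q)).1

/-- `Φ` maps the graph of `u` over `p` to a surface that is transversal to the direction of the
dependent variable: the preimage of that direction is not tangent to the graph. -/
def Transversal (Φ : OpenPartialHomeomorph VarSpace VarSpace) (u : IndepSpace → ℝ)
    (p : IndepSpace) : Prop :=
  (fderiv ℝ Φ.symm (Φ (p, u p)) (0, 1)).2 ≠
    fderiv ℝ u p (fderiv ℝ Φ.symm (Φ (p, u p)) (0, 1)).1

variable {u v : IndepSpace → ℝ} {p : IndepSpace}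

theorem contDiffAt_graph (hu : ContDiffAt ℝ ∞ u p) :
    ContDiffAt ℝ ∞ (fun q => ((q, u q) : VarSpace)) p := contDiffAt_id.prodMk hu

theorem eventually_graph_mem (hu : ContDiffAt ℝ ∞ u p) {S : Set VarSpace} (hS : IsOpen S)
    (hp : (p, u p) ∈ S) : ∀ᶠ q in 𝓝 p, (q, u q) ∈ S :=
  (contDiffAt_graph hu).continuousAt.eventually (hS.mem_nhds hp)

theorem fderiv_graph (hu : ContDiffAt ℝ ∞ u p) (ξ : IndepSpace) :
    fderiv ℝ (fun q => ((q, u q) : VarSpace)) p ξ = (ξ, fderiv ℝ u p ξ) := by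
  rw [DifferentiableAt.fderiv_prodMk differentiableAt_fun_id (hu.differentiableAt (by simp))]
  simp

theorem fderiv_image_graph (hΦ : IsPointTransformation Φ) (hu : ContDiffAt ℝ ∞ u p)
    (hp : (p, u p) ∈ Φ.source) (ξ : IndepSpace) :
    fderiv ℝ (fun q => Φ (q, u q)) p ξ = fderiv ℝ Φ (p, u p) (ξ, fderiv ℝ u p ξ) := by
  have := fderiv_comp (𝕜 := ℝ) (g := Φ) (f := fun q => ((q, u q) : VarSpace)) p
    (hΦ.differentiableAt hp) ((contDiffAt_graph hu).differentiableAt (by simp))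
  rw [Function.comp_def] at this
  rw [this, ContinuousLinearMap.comp_apply, fderiv_graph hu]

theorem contDiffAt_image_graph (hΦ : IsPointTransformation Φ) (hu : ContDiffAt ℝ ∞ u p)
    (hp : (p, u p) ∈ Φ.source) : ContDiffAt ℝ ∞ (fun q => Φ (q, u q)) p :=
  (hΦ.contDiffAt hp).comp p (contDiffAt_graph hu)

theorem contDiffAt_graphMap (hΦ : IsPointTransformation Φ) (hu : ContDiffAt ℝ ∞ u p)
    (hp : (p, u p) ∈ Φ.source) : ContDiffAt ℝ ∞ (graphMap Φ u) p :=
  (contDiffAt_image_graph hΦ hu hp).fst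

theorem fderiv_graphMap (hΦ : IsPointTransformation Φ) (hu : ContDiffAt ℝ ∞ u p)
    (hp : (p, u p) ∈ Φ.source) (ξ : IndepSpace) :
    fderiv ℝ (graphMap Φ u) p ξ = (fderiv ℝ Φ (p, u p) (ξ, fderiv ℝ u p ξ)).1 := by
  rw [← fderiv_image_graph hΦ hu hp]
  unfold graphMap
  rw [fderiv.fst ((contDiffAt_image_graph hΦ hu hp).differentiableAt (by simp))]
  rfl

/-- A tangent vector that the induced map kills is sent by `Φ` to a multiple of the direction of the
dependent variable, so that it vanishes by transversality. -/
theorem Transversal.injective (h : Transversal Φ u p) (hΦ : IsPointTransformation Φ)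
    (hu : ContDiffAt ℝ ∞ u p) (hp : (p, u p) ∈ Φ.source) :
    Function.Injective (fderiv ℝ (graphMap Φ u) p) := by
  rw [injective_iff_map_eq_zero]
  intro ξ hξ
  rw [fderiv_graphMap hΦ hu hp] at hξ
  set c := (fderiv ℝ Φ (p, u p) (ξ, fderiv ℝ u p ξ)).2 with hc
  have h1 : fderiv ℝ Φ (p, u p) (ξ, fderiv ℝ u p ξ) = c • ((0, 1) : VarSpace) := by
    ext1
    · simpa using hξ
    · simp [hc]
  have h2 := hΦ.fderiv_symm_fderiv hp (ξ, fderiv ℝ u p ξ)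
  rw [h1, map_smul] at h2
  by_cases hc0 : c = 0
  · rw [hc0, zero_smul] at h2
    exact (Prod.ext_iff.1 h2).1.symm
  · refine absurd ?_ h
    have e1 : ξ = c • (fderiv ℝ Φ.symm (Φ (p, u p)) (0, 1)).1 := (Prod.ext_iff.1 h2).1.symm
    have e2 : fderiv ℝ u p ξ = c • (fderiv ℝ Φ.symm (Φ (p, u p)) (0, 1)).2 :=
      (Prod.ext_iff.1 h2).2.symm
    rw [e1, map_smul] at e2
    exact (smul_right_injective ℝ hc0 e2).symm

/-- The derivative at `p` of the induced map, as an isomorphism. -/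
theorem Transversal.exists_equiv (h : Transversal Φ u p) (hΦ : IsPointTransformation Φ)
    (hu : ContDiffAt ℝ ∞ u p) (hp : (p, u p) ∈ Φ.source) :
    ∃ e : IndepSpace ≃L[ℝ] IndepSpace,
      HasFDerivAt (graphMap Φ u) (e : IndepSpace →L[ℝ] IndepSpace) p := by
  have hinj := h.injective hΦ hu hp
  let e := (LinearEquiv.ofInjectiveEndo
    (fderiv ℝ (graphMap Φ u) p : IndepSpace →ₗ[ℝ] IndepSpace) hinj).toContinuousLinearEquiv
  have he : (e : IndepSpace →L[ℝ] IndepSpace) = fderiv ℝ (graphMap Φ u) p :=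
    ContinuousLinearMap.ext fun _ => rfl
  exact ⟨e, he ▸ ((contDiffAt_graphMap hΦ hu hp).differentiableAt (by simp)).hasFDerivAt⟩

theorem Transversal.map_nhds (h : Transversal Φ u p) (hΦ : IsPointTransformation Φ)
    (hu : ContDiffAt ℝ ∞ u p) (hp : (p, u p) ∈ Φ.source) :
    map (graphMap Φ u) (𝓝 p) = 𝓝 (graphMap Φ u p) := by
  obtain ⟨e, he⟩ := h.exists_equiv hΦ hu hp
  exact ((contDiffAt_graphMap hΦ hu hp).hasStrictFDerivAt' he (by simp)).map_nhds_eq_of_equiv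

/-- By the inverse function theorem, the image of the graph of `u` under `Φ` is the graph of a
smooth function, if it is transversal to the direction of the dependent variable. -/
theorem Transversal.exists_transformsInto (h : Transversal Φ u p) (hΦ : IsPointTransformation Φ)
    (hu : ContDiffAt ℝ ∞ u p) (hp : (p, u p) ∈ Φ.source) :
    ∃ v, ContDiffAt ℝ ∞ v (Φ (p, u p)).1 ∧ TransformsInto Φ u v p := by
  obtain ⟨e, he⟩ := h.exists_equiv hΦ hu hp
  have hK := contDiffAt_graphMap hΦ hu hp
  set L := hK.localInverse he (by simp) with hL
  have hLp : L (graphMap Φ u p) = p := hK.localInverse_apply_image he (by simp)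
  have hLs : ContDiffAt ℝ ∞ L (graphMap Φ u p) := hK.to_localInverse he (by simp)
  refine ⟨fun q' => (Φ (L q', u (L q'))).2, ?_, ?_⟩
  · have := contDiffAt_image_graph hΦ hu hp
    rw [← hLp] at this
    exact (this.comp _ hLs).snd
  · have : ∀ᶠ q in 𝓝 p, L (graphMap Φ u q) = q :=
      (hK.hasStrictFDerivAt' he (by simp)).eventually_left_inverse
    filter_upwards [this] with q hq
    change _ = (Φ (L (graphMap Φ u q), u (L (graphMap Φ u q)))).2
    rw [hq]

theorem TransformsInto.apply_eq (h : TransformsInto Φ u v p) :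
    Φ (p, u p) = (graphMap Φ u p, v (graphMap Φ u p)) :=
  Prod.ext rfl h.self_of_nhds

/-- If the image of the graph of `u` is the graph of a smooth function, then it is transversal to
the direction of the dependent variable. -/
theorem TransformsInto.transversal (h : TransformsInto Φ u v p) (hΦ : IsPointTransformation Φ)
    (hu : ContDiffAt ℝ ∞ u p) (hv : ContDiffAt ℝ ∞ v (graphMap Φ u p))
    (hp : (p, u p) ∈ Φ.source) : Transversal Φ u p := by
  intro hk
  set k := fderiv ℝ Φ.symm (Φ (p, u p)) (0, 1) with hkdef
  have h1 : fderiv ℝ (fun q => Φ (q, u q)) p k.1 = (0, 1) := by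
    rw [fderiv_image_graph hΦ hu hp, ← hk, Prod.mk.eta, hkdef, hΦ.fderiv_fderiv_symm hp]
  have hd := (contDiffAt_image_graph hΦ hu hp).differentiableAt (by simp)
  have h2 : fderiv ℝ (graphMap Φ u) p k.1 = 0 := by
    rw [fderiv_graphMap hΦ hu hp, ← fderiv_image_graph hΦ hu hp, h1]
  have h3 : fderiv ℝ (fun q => (Φ (q, u q)).2) p k.1 = 1 := by
    rw [fderiv.snd hd]
    simp [h1]
  have h' : (fun q => (Φ (q, u q)).2) =ᶠ[𝓝 p] v ∘ graphMap Φ u := h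
  rw [h'.fderiv_eq] at h3
  have h4 := fderiv_comp (𝕜 := ℝ) (g := v) (f := graphMap Φ u) p (hv.differentiableAt (by simp))
    ((contDiffAt_graphMap hΦ hu hp).differentiableAt (by simp))
  rw [h4, ContinuousLinearMap.comp_apply, h2, map_zero] at h3
  exact zero_ne_one h3

theorem TransformsInto.symm (h : TransformsInto Φ u v p) (hΦ : IsPointTransformation Φ)
    (hu : ContDiffAt ℝ ∞ u p) (hv : ContDiffAt ℝ ∞ v (graphMap Φ u p))
    (hp : (p, u p) ∈ Φ.source) : TransformsInto Φ.symm v u (graphMap Φ u p) := by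
  rw [TransformsInto, ← (h.transversal hΦ hu hv hp).map_nhds hΦ hu hp, eventually_map]
  filter_upwards [h, eventually_graph_mem hu Φ.open_source hp] with q hq hqs
  have : (graphMap Φ u q, v (graphMap Φ u q)) = Φ (q, u q) := Prod.ext rfl hq.symm
  rw [this, Φ.left_inv hqs]

theorem MapsEquation.symm {σ σ' : ℝ → ℝ} (h : MapsEquation σ σ' Φ)
    (hΦ : IsPointTransformation Φ) : MapsEquation σ' σ Φ.symm := by
  intro v u p' hp' hv hu hT
  have e1 : Φ.symm (p', v p') = (graphMap Φ.symm v p', u (graphMap Φ.symm v p')) := hT.apply_eq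
  have hs : Φ.symm (p', v p') ∈ Φ.source := Φ.map_target hp'
  have e2 : Φ (graphMap Φ.symm v p', u (graphMap Φ.symm v p')) = (p', v p') := by
    rw [← e1, Φ.right_inv hp']
  have hT' := hT.symm hΦ.symm hv hu hp'
  rw [Φ.symm_symm] at hT'
  have := h u v (graphMap Φ.symm v p') (by rw [← e1]; exact hs) hu (by rw [e2]; exact hv) hT'
  rw [e2] at this
  exact this.symm

theorem Admissible.symm {σ σ' : ℝ → ℝ} {I I' : Set ℝ} (h : Admissible σ I σ' I' Φ) :
    Admissible σ' I' σ I Φ.symm where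
  isPointTransformation := h.isPointTransformation.symm
  source_subset := h.target_subset
  target_subset := h.source_subset
  mapsEquation := h.mapsEquation.symm h.isPointTransformation

/-- Transformations between equations can be composed if `Φ⁻¹` preserves the direction of the
dependent variable. Then `Φ` maps every graph to a graph; in general, the intermediate image of a
graph need not be one, although its image under the composition is. -/
theorem MapsEquation.trans {σ σ' σ'' : ℝ → ℝ} {Ψ : OpenPartialHomeomorph VarSpace VarSpace}
    (h : MapsEquation σ σ' Φ) (h' : MapsEquation σ' σ'' Ψ) (hΦ : IsPointTransformation Φ)
    (hv : ∀ P ∈ Φ.source, (fderiv ℝ Φ.symm (Φ P) (0, 1)).1 = 0) :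
    MapsEquation σ σ'' (Φ.trans Ψ) := by
  intro u w p hp hu hw hT
  rw [OpenPartialHomeomorph.trans_source] at hp
  -- a vertical direction is not tangent to a graph
  have ht : Transversal Φ u p := by
    intro hk
    rw [hv _ hp.1, map_zero] at hk
    have h0 : fderiv ℝ Φ.symm (Φ (p, u p)) (0, 1) = 0 := Prod.ext (hv _ hp.1) hk
    have h1 := hΦ.fderiv_fderiv_symm hp.1 (0, 1)
    rw [h0, map_zero] at h1
    simpa using congrArg Prod.snd h1
  obtain ⟨v, hvs, hTv⟩ := ht.exists_transformsInto hΦ hu hp.1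
  have e := hTv.apply_eq
  rw [h u v p hp.1 hu hvs hTv]
  have hT' : TransformsInto Ψ v w (graphMap Φ u p) := by
    rw [TransformsInto, ← ht.map_nhds hΦ hu hp.1, eventually_map]
    filter_upwards [hTv, hT] with q hq hqT
    have : (graphMap Φ u q, v (graphMap Φ u q)) = Φ (q, u q) := Prod.ext rfl hq.symm
    rw [this]
    exact hqT
  have := h' v w (graphMap Φ u p) (by rw [← e]; exact hp.2) hvs (by rw [← e]; exact hw) hT'
  rw [← e] at this
  exact this

end GraphTransform

/-! ### Jets, and perturbations of graphs -/

section Jets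

namespace SmoothGerm

variable {p : IndepSpace}

/-- The direction of `u` in the space of all variables. -/
abbrev eU : VarSpace := (0, 1)

/-- The chain rule for the restriction of a function of all variables to a graph. -/
theorem D_pull_graph {v : IndepSpace → ℝ} (hv : ContDiffAt ℝ ∞ v p) {P : VarSpace}
    (hP : (p, v p) = P) (w : IndepSpace) (g : SmoothGerm P) :
    D w (pull (fun q => ((q, v q) : VarSpace)) (contDiffAt_graph hv) hP g)
      = pull (fun q => ((q, v q) : VarSpace)) (contDiffAt_graph hv) hP (D (w, 0) g)
        + pull (fun q => ((q, v q) : VarSpace)) (contDiffAt_graph hv) hP (D eU g)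
          * D w (mk v hv) := by
  obtain ⟨f, hf, rfl⟩ := exists_mk g
  subst hP
  simp only [pull_mk, D_mk, mk_mul, mk_add]
  rw [mk_eq_mk]
  filter_upwards [(contDiffAt_graph hv).continuousAt.eventually (eventually_differentiableAt hf),
    eventually_differentiableAt hv] with z h1 h2
  have h3 : fderiv ℝ (fun z => f (z, v z)) z
      = (fderiv ℝ f (z, v z)).comp (fderiv ℝ (fun z => ((z, v z) : VarSpace)) z) :=
    fderiv_comp (𝕜 := ℝ) (g := f) (f := fun z => ((z, v z) : VarSpace)) z h1
      (differentiableAt_id.prodMk h2)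
  rw [h3, ContinuousLinearMap.comp_apply,
    DifferentiableAt.fderiv_prodMk differentiableAt_fun_id h2]
  have : ((fderiv ℝ (fun q : IndepSpace => q) z).prod (fderiv ℝ v z)) w
      = ((w, 0) : VarSpace) + fderiv ℝ v z w • eU := by simp
  rw [this, map_add, map_smul]
  simp [mul_comm]

theorem D_mk_affine (l : IndepSpace →L[ℝ] ℝ) (w : IndepSpace)
    (h : ContDiffAt ℝ ∞ (fun q => l (q - p)) p) :
    D w (mk (fun q => l (q - p)) h) = const (l w) := by
  rw [D_mk, const]
  change _ = mk (fun _ => l w) contDiffAt_const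
  rw [mk_eq_mk]
  refine Eventually.of_forall fun q => ?_
  have : HasFDerivAt (fun q => l (q - p)) l q :=
    l.hasFDerivAt.comp q ((hasFDerivAt_id q).sub_const p)
  simp only [this.fderiv]

/-- The coordinate `t`, centered at `p`. -/
def cT (p : IndepSpace) : SmoothGerm p := mk (fun q => q.1 - p.1) (by fun_prop)

/-- The coordinate `x`, centered at `p`. -/
def cX (p : IndepSpace) : SmoothGerm p := mk (fun q => q.2.1 - p.2.1) (by fun_prop)

/-- The coordinate `y`, centered at `p`. -/
def cY (p : IndepSpace) : SmoothGerm p := mk (fun q => q.2.2 - p.2.2) (by fun_prop)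

@[simp] theorem ev_cT : ev (cT p) = 0 := sub_self _
@[simp] theorem ev_cX : ev (cX p) = 0 := sub_self _
@[simp] theorem ev_cY : ev (cY p) = 0 := sub_self _

theorem D_cT (w : IndepSpace) : D w (cT p) = const w.1 :=
  D_mk_affine (ContinuousLinearMap.fst ℝ ℝ (ℝ × ℝ)) w (by fun_prop)

theorem D_cX (w : IndepSpace) : D w (cX p) = const w.2.1 :=
  D_mk_affine ((ContinuousLinearMap.fst ℝ ℝ ℝ).comp (ContinuousLinearMap.snd ℝ ℝ (ℝ × ℝ))) w
    (by fun_prop)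

theorem D_cY (w : IndepSpace) : D w (cY p) = const w.2.2 :=
  D_mk_affine ((ContinuousLinearMap.snd ℝ ℝ ℝ).comp (ContinuousLinearMap.snd ℝ ℝ (ℝ × ℝ))) w
    (by fun_prop)

end SmoothGerm

/-- A polynomial with prescribed derivatives at `p`: `z, j₀, …, j₇` are the values of
`u, u_t, u_x, u_y, u_tx, u_xx, u_xy, u_yy, u_xxx`. -/
def jetPoly (p : IndepSpace) (z : ℝ) (j : Fin 8 → ℝ) : IndepSpace → ℝ := fun q =>
  z + j 0 * (q.1 - p.1) + j 1 * (q.2.1 - p.2.1) + j 2 * (q.2.2 - p.2.2)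
    + j 3 * ((q.1 - p.1) * (q.2.1 - p.2.1)) + j 4 / 2 * ((q.2.1 - p.2.1) * (q.2.1 - p.2.1))
    + j 5 * ((q.2.1 - p.2.1) * (q.2.2 - p.2.2)) + j 6 / 2 * ((q.2.2 - p.2.2) * (q.2.2 - p.2.2))
    + j 7 / 6 * ((q.2.1 - p.2.1) * ((q.2.1 - p.2.1) * (q.2.1 - p.2.1)))

section jetPoly

variable (p : IndepSpace) (z : ℝ) (j : Fin 8 → ℝ)

theorem contDiffAt_jetPoly : ContDiffAt ℝ ∞ (jetPoly p z j) p := by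
  unfold jetPoly
  fun_prop

@[simp] theorem jetPoly_self : jetPoly p z j p = z := by
  simp [jetPoly]

theorem mk_jetPoly : mk (jetPoly p z j) (contDiffAt_jetPoly p z j)
    = const z + const (j 0) * cT p + const (j 1) * cX p + const (j 2) * cY p
      + const (j 3) * (cT p * cX p) + const (j 4 / 2) * (cX p * cX p)
      + const (j 5) * (cX p * cY p) + const (j 6 / 2) * (cY p * cY p)
      + const (j 7 / 6) * (cX p * (cX p * cX p)) := rfl

theorem ev_D_jetPoly :
    ev (D eT (mk (jetPoly p z j) (contDiffAt_jetPoly p z j))) = j 0 ∧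
    ev (D eX (mk (jetPoly p z j) (contDiffAt_jetPoly p z j))) = j 1 ∧
    ev (D eY (mk (jetPoly p z j) (contDiffAt_jetPoly p z j))) = j 2 ∧
    ev (D eT (D eX (mk (jetPoly p z j) (contDiffAt_jetPoly p z j)))) = j 3 ∧
    ev (D eX (D eX (mk (jetPoly p z j) (contDiffAt_jetPoly p z j)))) = j 4 ∧
    ev (D eY (D eX (mk (jetPoly p z j) (contDiffAt_jetPoly p z j)))) = j 5 ∧
    ev (D eY (D eY (mk (jetPoly p z j) (contDiffAt_jetPoly p z j)))) = j 6 ∧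
    ev (D eX (D eX (D eX (mk (jetPoly p z j) (contDiffAt_jetPoly p z j))))) = j 7 := by
  rw [mk_jetPoly]
  refine ⟨?_, ?_, ?_, ?_, ?_, ?_, ?_, ?_⟩ <;>
  simp [D_cT, D_cX, D_cY] <;> ring

theorem fderiv_jetPoly (w : IndepSpace) :
    fderiv ℝ (jetPoly p z j) p w = j 0 * w.1 + j 1 * w.2.1 + j 2 * w.2.2 := by
  rw [← ev_D_mk w (contDiffAt_jetPoly p z j), mk_jetPoly]
  simp [D_cT, D_cX, D_cY]

theorem gkzk_jetPoly (σ : ℝ → ℝ) :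
    gkzk σ (jetPoly p z j) p = j 3 + j 1 ^ 2 + z * j 4 + j 7 + σ p.1 * j 6 := by
  obtain ⟨-, h1, -, h3, h4, -, h6, h7⟩ := ev_D_jetPoly p z j
  rw [gkzk_eq_gkzkOp σ (contDiffAt_jetPoly p z j), gkzkOp, h1, h3, h4, h6, h7, ev_mk,
    jetPoly_self]

end jetPoly

end Jets

section Perturbation

variable {Φ : OpenPartialHomeomorph VarSpace VarSpace} {u u₁ v v₁ : IndepSpace → ℝ}
  {p : IndepSpace}

/-- Comparison of the images `v`, `v₁` of two graphs `u`, `u₁` that meet over `p`: the low order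
derivatives of `v₁ - v` are, up to a common nonzero factor, those of `u₁ - u` pulled back to the
target along the image of the second graph. -/
theorem image_perturbation {p' : IndepSpace} (hΦ : IsPointTransformation Φ)
    (hp' : graphMap Φ u p = p') (hp : (p, u p) ∈ Φ.source)
    (hu : ContDiffAt ℝ ∞ u p) (hu₁ : ContDiffAt ℝ ∞ u₁ p) (h₁ : u₁ p = u p)
    (hv : ContDiffAt ℝ ∞ v p') (hv₁ : ContDiffAt ℝ ∞ v₁ p')
    (hT : TransformsInto Φ u v p) (hT₁ : TransformsInto Φ u₁ v₁ p)
    (M : SmoothGerm p')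
    (hM : M.1 = ((fun q => u₁ (graphMap Φ.symm v₁ q) - u (graphMap Φ.symm v₁ q) :
      IndepSpace → ℝ) : Germ (𝓝 p') ℝ))
    (hM0 : ∀ w, ev (D w M) = 0) :
    v₁ p' = v p' ∧ ∃ r : ℝ, r ≠ 0 ∧
      (∀ w, ev (D w (mk v₁ hv₁)) = ev (D w (mk v hv))) ∧
      (∀ w w', ev (D w (D w' M))
        = r * (ev (D w (D w' (mk v₁ hv₁))) - ev (D w (D w' (mk v hv))))) ∧
      (ev (D eX (D eX M)) = 0 → ev (D eX (D eX (D eX M)))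
        = r * (ev (D eX (D eX (D eX (mk v₁ hv₁)))) - ev (D eX (D eX (D eX (mk v hv)))))) := by
  subst hp'
  have e := hT.apply_eq
  have hg : graphMap Φ u₁ p = graphMap Φ u p := by simp only [graphMap, h₁]
  have e₁ : Φ (p, u p) = (graphMap Φ u p, v₁ (graphMap Φ u p)) := by
    rw [← hg, ← h₁]
    exact hT₁.apply_eq
  have hp₁ : (p, u₁ p) ∈ Φ.source := h₁ ▸ hp
  have hvv : v₁ (graphMap Φ u p) = v (graphMap Φ u p) := by
    rw [e] at e₁
    exact (Prod.ext_iff.1 e₁).2.symm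
  refine ⟨hvv, ?_⟩
  set P' := Φ (p, u p) with hP'
  have hP't : P' ∈ Φ.target := Φ.map_source hp
  have hinv : Φ.symm P' = (p, u p) := Φ.left_inv hp
  have hΨ := hΦ.symm.contDiffAt hP't
  have huΨ : ContDiffAt ℝ ∞ (fun Q => u (Φ.symm Q).1) P' := by
    refine ContDiffAt.comp (g := u) (f := fun Q => (Φ.symm Q).1) P' ?_ hΨ.fst
    simpa only [hinv] using hu
  have hR := hΨ.snd.sub huΨ
  -- `R` vanishes exactly on the graph of `v`, and equals `u₁ - u` on that of `v₁`
  set R : SmoothGerm P' := mk (fun Q => (Φ.symm Q).2 - u (Φ.symm Q).1) hR with hRdef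
  have hr : ev (D eU R) ≠ 0 := by
    have ht := hT.transversal hΦ hu hv hp
    rw [hRdef, ev_D_mk, fderiv_fun_sub (hΨ.snd.differentiableAt (by simp))
      (huΨ.differentiableAt (by simp)), fderiv.snd (hΨ.differentiableAt (by simp))]
    have hc : fderiv ℝ (fun Q => u (Φ.symm Q).1) P'
        = (fderiv ℝ u p).comp (fderiv ℝ (fun Q => (Φ.symm Q).1) P') := by
      have := fderiv_comp (𝕜 := ℝ) (g := u) (f := fun Q => (Φ.symm Q).1) P'
        (by simpa only [hinv] using hu.differentiableAt (by simp))
        (hΨ.fst.differentiableAt (by simp))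
      simp only [hinv] at this
      exact this
    rw [hc, fderiv.fst (hΨ.differentiableAt (by simp))]
    exact sub_ne_zero.2 ht
  refine ⟨ev (D eU R), hr, ?_⟩
  have hI : pull (fun q => ((q, v q) : VarSpace)) (contDiffAt_graph hv) e.symm R = 0 := by
    rw [hRdef, pull_mk]
    change _ = mk (fun _ => 0) contDiffAt_const
    rw [mk_eq_mk]
    filter_upwards [hT.symm hΦ hu hv hp] with q hq
    exact sub_eq_zero.2 hq
  have hI₁ : pull (fun q => ((q, v₁ q) : VarSpace)) (contDiffAt_graph hv₁) e₁.symm R = M := by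
    rw [hRdef, pull_mk]
    refine Subtype.ext ?_
    rw [hM]
    refine Germ.coe_eq.2 ?_
    have := hT₁.symm hΦ hu₁ (by rw [hg]; exact hv₁) hp₁
    rw [hg] at this
    filter_upwards [this] with q hq
    exact congrArg (· - u (graphMap Φ.symm v₁ q)) hq
  have hD := D_pull_graph hv e.symm
  have hD₁ := D_pull_graph hv₁ e₁.symm
  have d1 : ∀ w, ev (D w (mk v₁ hv₁)) = ev (D w (mk v hv)) := by
    intro w
    have a := congrArg (fun g => ev (D w g)) hI
    have a₁ := congrArg (fun g => ev (D w g)) hI₁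
    simp only [hD, hD₁, map_add, map_mul, ev_pull, map_zero, hM0] at a a₁
    exact mul_left_cancel₀ hr (by linear_combination a₁ - a)
  have d2 : ∀ w w', ev (D w (D w' M)) = ev (D eU R)
        * (ev (D w (D w' (mk v₁ hv₁))) - ev (D w (D w' (mk v hv)))) := by
    intro w w'
    have a := congrArg (fun g => ev (D w (D w' g))) hI
    have a₁ := congrArg (fun g => ev (D w (D w' g))) hI₁
    simp only [hD, hD₁, D_mul, map_add, map_mul, ev_pull, map_zero, d1] at a a₁
    linear_combination a - a₁
  refine ⟨d1, d2, fun h0 => ?_⟩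
  have d2x := d2 eX eX
  rw [h0, eq_comm, mul_eq_zero, or_iff_right hr, sub_eq_zero] at d2x
  have a := congrArg (fun g => ev (D eX (D eX (D eX g)))) hI
  have a₁ := congrArg (fun g => ev (D eX (D eX (D eX g)))) hI₁
  simp only [hD, hD₁, D_mul, map_add, map_mul, ev_pull, map_zero, d1, d2x] at a a₁
  linear_combination a - a₁

end Perturbation

/-! ### The new independent variables: dependence on `u`, `x` and `y` -/

section FirstDeterminingEquations

variable {Φ : OpenPartialHomeomorph VarSpace VarSpace} {σ σ' : ℝ → ℝ}

/-- The basic perturbation argument: a perturbation `m` of functions on the target that does not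
affect the target equation at a point does not affect the original equation either. -/
theorem exists_perturbed_solution (hΦ : IsPointTransformation Φ) (hm : MapsEquation σ σ' Φ)
    {u : IndepSpace → ℝ} {p : IndepSpace} (hu : ContDiffAt ℝ ∞ u p) (hp : (p, u p) ∈ Φ.source)
    (ht : Transversal Φ u p) (h0 : gkzk σ u p = 0) {m : IndepSpace → ℝ}
    (hms : ContDiffAt ℝ ∞ m (graphMap Φ u p)) (hm0 : m (graphMap Φ u p) = 0)
    (hm1 : fderiv ℝ m (graphMap Φ u p) = 0)
    (hinv : ∀ v, ContDiffAt ℝ ∞ v (graphMap Φ u p) →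
      gkzk σ' (fun q => v q + m q) (graphMap Φ u p) = gkzk σ' v (graphMap Φ u p)) :
    ∃ u₁, ContDiffAt ℝ ∞ u₁ p ∧ u₁ p = u p ∧ fderiv ℝ u₁ p = fderiv ℝ u p ∧
      ∀ hM : ContDiffAt ℝ ∞ (fun q => m (graphMap Φ u₁ q)) p,
        ev (D eX (D eX (mk _ hM))) = 0 →
        ev (D eT (D eX (mk _ hM))) + ev (D eX (D eX (D eX (mk _ hM))))
          + σ p.1 * ev (D eY (D eY (mk _ hM))) = 0 := by
  obtain ⟨v, hv, hT⟩ := ht.exists_transformsInto hΦ hu hp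
  change ContDiffAt ℝ ∞ v (graphMap Φ u p) at hv
  have hback := hT.symm hΦ hu hv hp
  have e : Φ (p, u p) = (graphMap Φ u p, v (graphMap Φ u p)) := hT.apply_eq
  have hinv' : Φ.symm (graphMap Φ u p, v (graphMap Φ u p)) = (p, u p) := by
    rw [← e, Φ.left_inv hp]
  have hpp : graphMap Φ.symm v (graphMap Φ u p) = p := congrArg Prod.fst hinv'
  have hp't : (graphMap Φ u p, v (graphMap Φ u p)) ∈ Φ.symm.source := by
    rw [← e]
    exact Φ.map_source hp
  have hv0 : gkzk σ' v (graphMap Φ u p) = 0 := (hm u v p hp hu hv hT).1 h0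
  set p' := graphMap Φ u p with hp'
  set v₁ : IndepSpace → ℝ := fun q => v q + m q with hv₁
  have hv₁s : ContDiffAt ℝ ∞ v₁ p' := hv.add hms
  have hv₁p : v₁ p' = v p' := by simp [hv₁, hm0]
  have hp't₁ : (p', v₁ p') ∈ Φ.symm.source := by rwa [hv₁p]
  have hv₁d : fderiv ℝ v₁ p' = fderiv ℝ v p' := by
    rw [hv₁, fderiv_fun_add (hv.differentiableAt (by simp)) (hms.differentiableAt (by simp)),
      hm1, add_zero]
  have ht' : Transversal Φ.symm v p' :=
    hback.transversal hΦ.symm hv (by rwa [hpp]) hp't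
  have ht₁ : Transversal Φ.symm v₁ p' := by
    unfold Transversal at ht' ⊢
    rwa [hv₁p, hv₁d]
  obtain ⟨u₁, hu₁, hT₁⟩ := ht₁.exists_transformsInto hΦ.symm hv₁s hp't₁
  rw [hv₁p, hinv'] at hu₁
  change ContDiffAt ℝ ∞ u₁ p at hu₁
  have h0₁ : gkzk σ u₁ p = 0 := by
    have := hm.symm hΦ v₁ u₁ p' hp't₁ hv₁s (by rw [hv₁p, hinv']; exact hu₁) hT₁
    rw [hv₁p, hinv', hinv v hv] at this
    exact this.1 hv0
  have hval : u₁ p = u p := by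
    have := hT₁.apply_eq
    have hg : graphMap Φ.symm v₁ p' = p := by
      unfold graphMap
      rw [hv₁p, hinv']
    rw [hv₁p, hinv', hg] at this
    exact (Prod.ext_iff.1 this).2.symm
  have hM : ContDiffAt ℝ ∞ (fun q => m (graphMap Φ u₁ q)) p := by
    have hk := contDiffAt_graphMap hΦ hu₁ (by rwa [hval])
    have hg : graphMap Φ u₁ p = p' := by simp only [graphMap, hval, hp']
    exact ContDiffAt.comp (g := m) (f := graphMap Φ u₁) p (by rwa [hg]) hk
  have hM0 : ∀ w, ev (D w (mk _ hM)) = 0 := by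
    intro w
    have hk := contDiffAt_graphMap hΦ hu₁ (by rwa [hval])
    have hg : graphMap Φ u₁ p = p' := by simp only [graphMap, hval, hp']
    rw [ev_D_mk]
    have := fderiv_comp (𝕜 := ℝ) (g := m) (f := graphMap Φ u₁) p
      (by rw [hg]; exact hms.differentiableAt (by simp)) (hk.differentiableAt (by simp))
    rw [hg, hm1] at this
    change fderiv ℝ (m ∘ graphMap Φ u₁) p w = 0
    rw [this]
    simp
  obtain ⟨-, r, hr, d1, d2, d3⟩ := image_perturbation hΦ.symm hpp hp't hv hv₁s hv₁p hu hu₁ hback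
    hT₁ (mk _ hM) (by
      change ((fun q => m (graphMap Φ u₁ q) : IndepSpace → ℝ) : Germ (𝓝 p) ℝ) = _
      congr 1
      funext q
      simp [hv₁]) hM0
  refine ⟨u₁, hu₁, hval, ?_, ?_⟩
  · refine ContinuousLinearMap.ext fun w => ?_
    have := d1 w
    rwa [ev_D_mk, ev_D_mk] at this
  · intro _ hxx
    have d3 := d3 hxx
    rw [gkzk_eq_gkzkOp σ hu₁, gkzkOp] at h0₁
    rw [gkzk_eq_gkzkOp σ hu, gkzkOp] at h0
    rw [d2] at hxx
    have hxx' := (mul_eq_zero.1 hxx).resolve_left hr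
    simp only [d1, ev_mk, hval] at h0 h0₁
    rw [d3, d2, d2]
    linear_combination r * (h0₁ - h0) - r * u p * hxx'

/-- Among the graphs through a point there are two, with different slopes `b ≠ b'` in the direction
of `x` and the same slopes in the other directions, that are transversal to a given vector `k`. -/
theorem exists_slopes {k : VarSpace} (hk : k ≠ 0) : ∃ a b b' c : ℝ, b ≠ b' ∧
    k.2 ≠ a * k.1.1 + b * k.1.2.1 + c * k.1.2.2 ∧
    k.2 ≠ a * k.1.1 + b' * k.1.2.1 + c * k.1.2.2 := by
  obtain ⟨⟨k0, k1, k2⟩, k3⟩ := k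
  simp only
  by_cases h1 : k1 = 0
  · obtain ⟨a, c, h⟩ : ∃ a c : ℝ, k3 ≠ a * k0 + c * k2 := by
      by_contra! h
      have e0 := h 0 0
      have e1 := h 1 0
      have e2 := h 0 1
      refine hk ?_
      simp_all
    exact ⟨a, 0, 1, c, zero_ne_one, by simpa [h1] using h, by simpa [h1] using h⟩
  · refine ⟨0, k3 / k1 + 1, k3 / k1 + 2, 0, by norm_num, ?_, ?_⟩ <;>
    · intro h
      field_simp at h
      apply h1
      linarith

theorem IsPointTransformation.fderiv_symm_vertical_ne_zero (hΦ : IsPointTransformation Φ)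
    {P : VarSpace} (hP : P ∈ Φ.source) : fderiv ℝ Φ.symm (Φ P) (0, 1) ≠ 0 := by
  intro h
  have := hΦ.fderiv_fderiv_symm hP (0, 1)
  rw [h, map_zero] at this
  simpa using congrArg Prod.snd this

theorem fderiv_comp_graphMap {u : IndepSpace → ℝ} {p : IndepSpace}
    (hΦ : IsPointTransformation Φ) (hu : ContDiffAt ℝ ∞ u p) (hp : (p, u p) ∈ Φ.source)
    (l : IndepSpace →L[ℝ] ℝ) (p' w : IndepSpace) :
    fderiv ℝ (fun q => l (graphMap Φ u q - p')) p w
      = l (fderiv ℝ Φ (p, u p) (w, fderiv ℝ u p w)).1 := by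
  have hk := (contDiffAt_graphMap hΦ hu hp).differentiableAt (by simp)
  have := (l.hasFDerivAt.comp p (hk.hasFDerivAt.sub_const p')).fderiv
  change fderiv ℝ (l ∘ fun q => graphMap Φ u q - p') p w = _
  rw [this, ContinuousLinearMap.comp_apply, fderiv_graphMap hΦ hu hp]

/-- The derivatives of `t'` and `y'` along `x` and along `u` vanish: otherwise the original
equation, written in the new variables, would contain third derivatives with respect to `t'` and `y'`. -/
theorem apply_fderiv_eq_zero (hΦ : IsPointTransformation Φ) (hm : MapsEquation σ σ' Φ)
    {P : VarSpace} (hP : P ∈ Φ.source) (l : IndepSpace →L[ℝ] ℝ) (hl : l eX = 0) :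
    l (fderiv ℝ Φ P (eX, 0)).1 = 0 ∧ l (fderiv ℝ Φ P eU).1 = 0 := by
  obtain ⟨a, b, b', c, hbb, hb, hb'⟩ := exists_slopes (hΦ.fderiv_symm_vertical_ne_zero hP)
  -- along a solution with `u_x = b`, the perturbation `l³` of the image does not affect the target
  -- equation, since `l` does not depend on `x'`; in the original equation, it contributes `6 l_x³`
  have key : ∀ b : ℝ, (fderiv ℝ Φ.symm (Φ P) (0, 1)).2 ≠
      a * (fderiv ℝ Φ.symm (Φ P) (0, 1)).1.1 + b * (fderiv ℝ Φ.symm (Φ P) (0, 1)).1.2.1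
        + c * (fderiv ℝ Φ.symm (Φ P) (0, 1)).1.2.2 → l (fderiv ℝ Φ P (eX, b)).1 = 0 := by
    intro b hb
    obtain ⟨p, z⟩ := P
    set u := jetPoly p z ![a, b, c, 0, 0, 0, 0, -b ^ 2] with hudef
    have hu : ContDiffAt ℝ ∞ u p := contDiffAt_jetPoly _ _ _
    have hup : u p = z := jetPoly_self _ _ _
    have hp : (p, u p) ∈ Φ.source := by rwa [hup]
    have hd : ∀ w, fderiv ℝ u p w = a * w.1 + b * w.2.1 + c * w.2.2 := fderiv_jetPoly _ _ _
    have ht : Transversal Φ u p := by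
      unfold Transversal
      rw [hd, hup]
      exact hb
    have h0 : gkzk σ u p = 0 := by
      rw [hudef, gkzk_jetPoly]
      simp
    set p' := graphMap Φ u p with hp'
    have hL : ContDiffAt ℝ ∞ (fun q => l (q - p')) p' := by fun_prop
    have hLev : ev (mk _ hL) = 0 := by simp
    have hLD : ∀ w, D w (mk _ hL) = const (l w) := fun w => D_mk_affine l w hL
    have hms : ContDiffAt ℝ ∞ (fun q => l (q - p') * (l (q - p') * l (q - p'))) p' :=
      hL.mul (hL.mul hL)
    have hmk : mk _ hms = mk _ hL * (mk _ hL * mk _ hL) := rfl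
    obtain ⟨u₁, hu₁, hval, hd₁, H⟩ := exists_perturbed_solution hΦ hm hu hp ht h0 hms
      (by simp [hp']) (by
        refine ContinuousLinearMap.ext fun w => ?_
        change fderiv ℝ _ p' w = 0
        rw [← ev_D_mk w hms, hmk]
        simp) (by
        intro v hv
        change ContDiffAt ℝ ∞ v p' at hv
        change gkzk σ' _ p' = gkzk σ' v p'
        rw [gkzk_eq_gkzkOp σ' (hv.add hms), gkzk_eq_gkzkOp σ' hv]
        have : mk _ (hv.add hms) = mk v hv + mk _ hL * (mk _ hL * mk _ hL) := rfl
        rw [this]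
        simp [gkzkOp, hLD, hl, -map_sub])
    have hp₁ : (p, u₁ p) ∈ Φ.source := by rwa [hval]
    have hN : ContDiffAt ℝ ∞ (fun q => l (graphMap Φ u₁ q - p')) p :=
      l.contDiff.contDiffAt.comp p ((contDiffAt_graphMap hΦ hu₁ hp₁).sub contDiffAt_const)
    have hNev : ev (mk _ hN) = 0 := by
      rw [ev_mk]
      simp only [graphMap, hval, hp', sub_self, map_zero]
    have H := H (hN.mul (hN.mul hN))
    have hmk' : mk _ (hN.mul (hN.mul hN)) = mk _ hN * (mk _ hN * mk _ hN) := rfl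
    rw [hmk'] at H
    simp only [D_mul, map_add, map_mul, hNev] at H
    have H' : (ev (D eX (mk _ hN))) ^ 3 = 0 := by
      have := H (by ring)
      linear_combination this / 6
    have H'' := pow_eq_zero_iff (by norm_num) |>.1 H'
    rw [ev_D_mk, fderiv_comp_graphMap hΦ hu₁ hp₁, hval, hup, hd₁, hd] at H''
    simpa using H''
  have e1 := key b hb
  have e2 := key b' hb'
  have s : ∀ b : ℝ, l (fderiv ℝ Φ P (eX, b)).1
      = l (fderiv ℝ Φ P (eX, 0)).1 + b * l (fderiv ℝ Φ P eU).1 := by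
    intro b
    have : ((eX, b) : VarSpace) = (eX, 0) + b • eU := by simp
    rw [this, map_add, map_smul]
    simp
  rw [s] at e1 e2
  have h2 : l (fderiv ℝ Φ P eU).1 = 0 :=
    (mul_eq_zero.1 (by linear_combination e1 - e2 :
      (b - b') * l (fderiv ℝ Φ P eU).1 = 0)).resolve_left (sub_ne_zero.2 hbb)
  rw [h2] at e1
  exact ⟨by simpa using e1, h2⟩

/-- The derivative of `t'` along `y` vanishes: otherwise the original equation, written in the new
variables, would contain a second derivative with respect to `t'`. The perturbation of the image is
the square of `t'`; it contributes `2 σ (∂t'/∂y)²` to the original equation. -/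
theorem fderiv_fst_eY_eq_zero (hΦ : IsPointTransformation Φ) (hm : MapsEquation σ σ' Φ)
    {P : VarSpace} (hP : P ∈ Φ.source) (hσ : σ P.1.1 ≠ 0) :
    (fderiv ℝ Φ P (eY, 0)).1.1 = 0 := by
  set l := ContinuousLinearMap.fst ℝ ℝ (ℝ × ℝ) with hl
  have hlv : ∀ w, l w = w.1 := fun _ => rfl
  have hlx : l eX = 0 := rfl
  have hly : l eY = 0 := rfl
  obtain ⟨a, b, -, c, -, hb, -⟩ := exists_slopes (hΦ.fderiv_symm_vertical_ne_zero hP)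
  obtain ⟨p, z⟩ := P
  set u := jetPoly p z ![a, b, c, 0, 0, 0, 0, -b ^ 2] with hudef
  have hu : ContDiffAt ℝ ∞ u p := contDiffAt_jetPoly _ _ _
  have hup : u p = z := jetPoly_self _ _ _
  have hp : (p, u p) ∈ Φ.source := by rwa [hup]
  have hd : ∀ w, fderiv ℝ u p w = a * w.1 + b * w.2.1 + c * w.2.2 := fderiv_jetPoly _ _ _
  have ht : Transversal Φ u p := by
    unfold Transversal
    rw [hd, hup]
    exact hb
  have h0 : gkzk σ u p = 0 := by
    rw [hudef, gkzk_jetPoly]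
    simp
  set p' := graphMap Φ u p with hp'
  have hL : ContDiffAt ℝ ∞ (fun q => l (q - p')) p' := by fun_prop
  have hLev : ev (mk _ hL) = 0 := by simp
  have hLD : ∀ w, D w (mk _ hL) = const (l w) := fun w => D_mk_affine l w hL
  have hms : ContDiffAt ℝ ∞ (fun q => l (q - p') * l (q - p')) p' := hL.mul hL
  have hmk : mk _ hms = mk _ hL * mk _ hL := rfl
  obtain ⟨u₁, hu₁, hval, hd₁, H⟩ := exists_perturbed_solution hΦ hm hu hp ht h0 hms (by simp [hp'])
    (by
      refine ContinuousLinearMap.ext fun w => ?_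
      change fderiv ℝ _ p' w = 0
      rw [← ev_D_mk w hms, hmk]
      simp) (by
      intro v hv
      change ContDiffAt ℝ ∞ v p' at hv
      change gkzk σ' _ p' = gkzk σ' v p'
      rw [gkzk_eq_gkzkOp σ' (hv.add hms), gkzk_eq_gkzkOp σ' hv]
      have : mk _ (hv.add hms) = mk v hv + mk _ hL * mk _ hL := rfl
      rw [this]
      simp [gkzkOp, hLD, hlx, hly, -map_sub])
  have hp₁ : (p, u₁ p) ∈ Φ.source := by rwa [hval]
  have hN : ContDiffAt ℝ ∞ (fun q => l (graphMap Φ u₁ q - p')) p :=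
    l.contDiff.contDiffAt.comp p ((contDiffAt_graphMap hΦ hu₁ hp₁).sub contDiffAt_const)
  have hNev : ev (mk _ hN) = 0 := by
    rw [ev_mk]
    simp only [graphMap, hval, hp', sub_self, map_zero]
  have split : ∀ (Q : VarSpace) (w : IndepSpace) (b : ℝ), l (fderiv ℝ Φ Q (w, b)).1
      = l (fderiv ℝ Φ Q (w, 0)).1 + b * l (fderiv ℝ Φ Q eU).1 := by
    intro Q w b
    have : ((w, b) : VarSpace) = (w, 0) + b • eU := by simp
    rw [this, map_add, map_smul]
    simp
  have hNx : D eX (mk _ hN) = 0 := by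
    rw [D_mk]
    change _ = mk (fun _ => 0) contDiffAt_const
    rw [mk_eq_mk]
    have hev2 : ∀ᶠ q in 𝓝 p, DifferentiableAt ℝ u₁ q := eventually_differentiableAt hu₁
    filter_upwards [eventually_graph_mem hu₁ Φ.open_source hp₁, hev2] with q hq hq2
    have hcomp : HasFDerivAt (fun q => l (graphMap Φ u₁ q - p'))
        (l.comp ((ContinuousLinearMap.fst ℝ IndepSpace ℝ).comp ((fderiv ℝ Φ (q, u₁ q)).comp
          ((ContinuousLinearMap.id ℝ IndepSpace).prod (fderiv ℝ u₁ q))))) q := by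
      refine l.hasFDerivAt.comp q (HasFDerivAt.sub_const p' ?_)
      exact hasFDerivAt_fst.comp q ((hΦ.differentiableAt hq).hasFDerivAt.comp q
        ((hasFDerivAt_id q).prodMk hq2.hasFDerivAt))
    rw [hcomp.fderiv]
    have := apply_fderiv_eq_zero hΦ hm hq l hlx
    change l (fderiv ℝ Φ (q, u₁ q) (eX, fderiv ℝ u₁ q eX)).1 = 0
    rw [split, this.1, this.2]
    simp
  have H := H (hN.mul hN)
  have hmk' : mk _ (hN.mul hN) = mk _ hN * mk _ hN := rfl
  rw [hmk'] at H
  simp only [D_mul, map_add, map_mul, hNev, hNx, map_zero] at H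
  have H' : (ev (D eY (mk _ hN))) ^ 2 = 0 := by
    have := H (by ring)
    have h2 : σ p.1 * (ev (D eY (mk _ hN))) ^ 2 = 0 := by linear_combination this / 2
    exact (mul_eq_zero.1 h2).resolve_left hσ
  have H'' := pow_eq_zero_iff (by norm_num) |>.1 H'
  rw [ev_D_mk, fderiv_comp_graphMap hΦ hu₁ hp₁, hval, hup, split,
    (apply_fderiv_eq_zero hΦ hm hP l hlx).2, mul_zero, add_zero] at H''
  exact H''

end FirstDeterminingEquations

/-! ### The components of a point transformation -/

section Components

variable {Φ : OpenPartialHomeomorph VarSpace VarSpace} {P : VarSpace}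

namespace IsPointTransformation

/-- The germ of `t'`. -/
def gT (hΦ : IsPointTransformation Φ) (hP : P ∈ Φ.source) : SmoothGerm P :=
  mk (fun Q => (Φ Q).1.1) (hΦ.contDiffAt hP).fst.fst

/-- The germ of `x'`. -/
def gX (hΦ : IsPointTransformation Φ) (hP : P ∈ Φ.source) : SmoothGerm P :=
  mk (fun Q => (Φ Q).1.2.1) (hΦ.contDiffAt hP).fst.snd.fst

/-- The germ of `y'`. -/
def gY (hΦ : IsPointTransformation Φ) (hP : P ∈ Φ.source) : SmoothGerm P :=
  mk (fun Q => (Φ Q).1.2.2) (hΦ.contDiffAt hP).fst.snd.snd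

/-- The germ of `u'`. -/
def gU (hΦ : IsPointTransformation Φ) (hP : P ∈ Φ.source) : SmoothGerm P :=
  mk (fun Q => (Φ Q).2) (hΦ.contDiffAt hP).snd

theorem ev_D_gT (hΦ : IsPointTransformation Φ) (hP : P ∈ Φ.source) (w : VarSpace) :
    ev (D w (hΦ.gT hP)) = (fderiv ℝ Φ P w).1.1 := by
  have h2 := hΦ.differentiableAt hP
  rw [gT, ev_D_mk, fderiv.fst h2.fst, fderiv.fst h2]; rfl

theorem ev_D_gX (hΦ : IsPointTransformation Φ) (hP : P ∈ Φ.source) (w : VarSpace) :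
    ev (D w (hΦ.gX hP)) = (fderiv ℝ Φ P w).1.2.1 := by
  have h2 := hΦ.differentiableAt hP
  rw [gX, ev_D_mk, fderiv.fst h2.fst.snd, fderiv.snd h2.fst, fderiv.fst h2]; rfl

theorem ev_D_gY (hΦ : IsPointTransformation Φ) (hP : P ∈ Φ.source) (w : VarSpace) :
    ev (D w (hΦ.gY hP)) = (fderiv ℝ Φ P w).1.2.2 := by
  have h2 := hΦ.differentiableAt hP
  rw [gY, ev_D_mk, fderiv.snd h2.fst.snd, fderiv.snd h2.fst, fderiv.fst h2]; rfl

theorem ev_D_gU (hΦ : IsPointTransformation Φ) (hP : P ∈ Φ.source) (w : VarSpace) :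
    ev (D w (hΦ.gU hP)) = (fderiv ℝ Φ P w).2 := by
  have h2 := hΦ.differentiableAt hP
  rw [gU, ev_D_mk, fderiv.snd h2]; rfl

end IsPointTransformation

theorem SmoothGerm.mk_eq_zero_of_forall {E : Type*} [NormedAddCommGroup E] [NormedSpace ℝ E]
    {S : Set E} (hS : IsOpen S) {x : E} (hx : x ∈ S) {f : E → ℝ} (hf : ContDiffAt ℝ ∞ f x)
    (h : ∀ y ∈ S, f y = 0) : mk f hf = 0 := by
  change _ = mk (fun _ => 0) contDiffAt_const
  rw [mk_eq_mk]
  filter_upwards [hS.mem_nhds hx] with y hy using h y hy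

/-- The direction of `t` in the space of all variables. -/
abbrev vT : VarSpace := (eT, 0)

/-- The direction of `x` in the space of all variables. -/
abbrev vX : VarSpace := (eX, 0)

/-- The direction of `y` in the space of all variables. -/
abbrev vY : VarSpace := (eY, 0)

/-- A derivative whose values vanish on an open set vanishes as a germ at each of its points. -/
theorem D_eq_zero_of_forall {S : Set VarSpace} (hS : IsOpen S) {f : VarSpace → ℝ}
    (hf : ∀ Q ∈ S, ContDiffAt ℝ ∞ f Q) {w : VarSpace}
    (h : ∀ Q, ∀ hQ : Q ∈ S, ev (D w (mk f (hf Q hQ))) = 0) (hP : P ∈ S) :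
    D w (mk f (hf P hP)) = 0 := by
  rw [D_mk]
  refine mk_eq_zero_of_forall hS hP _ fun Q hQ => ?_
  rw [← ev_D_mk w (hf Q hQ), h Q hQ]

/-- The component `t'` depends on `t` only, and `y'` on `t` and `y` only. -/
structure IsFibered (hΦ : IsPointTransformation Φ) : Prop where
  T_x : ∀ P, ∀ hP : P ∈ Φ.source, D vX (hΦ.gT hP) = 0
  T_y : ∀ P, ∀ hP : P ∈ Φ.source, D vY (hΦ.gT hP) = 0
  T_u : ∀ P, ∀ hP : P ∈ Φ.source, D eU (hΦ.gT hP) = 0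
  Y_x : ∀ P, ∀ hP : P ∈ Φ.source, D vX (hΦ.gY hP) = 0
  Y_u : ∀ P, ∀ hP : P ∈ Φ.source, D eU (hΦ.gY hP) = 0

/-- The functionals `t'` and `y'` of the target variables vanish in the direction of `x'`, so that
the perturbation arguments apply to both of them. -/
theorem MapsEquation.isFibered {σ σ' : ℝ → ℝ} (hm : MapsEquation σ σ' Φ)
    (hΦ : IsPointTransformation Φ) (hσ : ∀ P ∈ Φ.source, σ P.1.1 ≠ 0) : IsFibered hΦ := by
  have hT := fun P (hP : P ∈ Φ.source) =>
    apply_fderiv_eq_zero hΦ hm hP (ContinuousLinearMap.fst ℝ ℝ (ℝ × ℝ)) rfl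
  have hY := fun P (hP : P ∈ Φ.source) => apply_fderiv_eq_zero hΦ hm hP
    ((ContinuousLinearMap.snd ℝ ℝ ℝ).comp (ContinuousLinearMap.snd ℝ ℝ (ℝ × ℝ))) rfl
  have sT := fun Q hQ => (hΦ.contDiffAt (P := Q) hQ).fst.fst
  have sY := fun Q hQ => (hΦ.contDiffAt (P := Q) hQ).fst.snd.snd
  refine ⟨fun P hP => ?_, fun P hP => ?_, fun P hP => ?_, fun P hP => ?_, fun P hP => ?_⟩
  · exact D_eq_zero_of_forall Φ.open_source sT
      (fun Q hQ => (hΦ.ev_D_gT hQ _).trans (hT Q hQ).1) hP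
  · exact D_eq_zero_of_forall Φ.open_source sT
      (fun Q hQ => (hΦ.ev_D_gT hQ _).trans (fderiv_fst_eY_eq_zero hΦ hm hQ (hσ Q hQ))) hP
  · exact D_eq_zero_of_forall Φ.open_source sT
      (fun Q hQ => (hΦ.ev_D_gT hQ _).trans (hT Q hQ).2) hP
  · exact D_eq_zero_of_forall Φ.open_source sY
      (fun Q hQ => (hΦ.ev_D_gY hQ _).trans (hY Q hQ).1) hP
  · exact D_eq_zero_of_forall Φ.open_source sY
      (fun Q hQ => (hΦ.ev_D_gY hQ _).trans (hY Q hQ).2) hP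

theorem fderiv_eq_sum (A : VarSpace →L[ℝ] VarSpace) (w : VarSpace) :
    A w = w.1.1 • A vT + w.1.2.1 • A vX + w.1.2.2 • A vY + w.2 • A eU := by
  rw [← map_smul, ← map_smul, ← map_smul, ← map_smul, ← map_add, ← map_add, ← map_add]
  congr 1
  simp

/-- The Jacobian determinant of a fibered transformation is the product of three nonzero factors.
Moreover, the preimage of the direction of the dependent variable has no components along `t` and
`y`, and it is not tangent to graphs with `u_x = r` if `∂x'/∂x + r ∂x'/∂u ≠ 0`. -/
theorem IsFibered.nondegenerate {hΦ : IsPointTransformation Φ} (h : IsFibered hΦ)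
    (hP : P ∈ Φ.source) : ev (D vT (hΦ.gT hP)) ≠ 0 ∧ ev (D vY (hΦ.gY hP)) ≠ 0 ∧
      ev (D vX (hΦ.gX hP)) * ev (D eU (hΦ.gU hP)) - ev (D eU (hΦ.gX hP)) * ev (D vX (hΦ.gU hP))
        ≠ 0 ∧
      ∀ r : ℝ, ev (D vX (hΦ.gX hP)) + r * ev (D eU (hΦ.gX hP)) ≠ 0 →
        (fderiv ℝ Φ.symm (Φ P) (0, 1)).2 ≠ r * (fderiv ℝ Φ.symm (Φ P) (0, 1)).1.2.1 ∧
        (fderiv ℝ Φ.symm (Φ P) (0, 1)).1.1 = 0 ∧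
        (fderiv ℝ Φ.symm (Φ P) (0, 1)).1.2.2 = 0 := by
  have hTx := congrArg ev (h.T_x P hP)
  have hTy := congrArg ev (h.T_y P hP)
  have hTu := congrArg ev (h.T_u P hP)
  have hYx := congrArg ev (h.Y_x P hP)
  have hYu := congrArg ev (h.Y_u P hP)
  rw [hΦ.ev_D_gT, map_zero] at hTx hTy hTu
  rw [hΦ.ev_D_gY, map_zero] at hYx hYu
  simp only [hΦ.ev_D_gT, hΦ.ev_D_gX, hΦ.ev_D_gY, hΦ.ev_D_gU]
  -- the columns of the inverse Jacobian matrix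
  have key : ∀ w : VarSpace,
      w = (fderiv ℝ Φ.symm (Φ P) w).1.1 • fderiv ℝ Φ P vT
        + (fderiv ℝ Φ.symm (Φ P) w).1.2.1 • fderiv ℝ Φ P vX
        + (fderiv ℝ Φ.symm (Φ P) w).1.2.2 • fderiv ℝ Φ P vY
        + (fderiv ℝ Φ.symm (Φ P) w).2 • fderiv ℝ Φ P eU := fun w => by
    rw [← fderiv_eq_sum, hΦ.fderiv_fderiv_symm hP]
  have kT := fun w => congrArg (fun Q : VarSpace => Q.1.1) (key w)
  have kX := fun w => congrArg (fun Q : VarSpace => Q.1.2.1) (key w)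
  have kY := fun w => congrArg (fun Q : VarSpace => Q.1.2.2) (key w)
  have kU := fun w => congrArg (fun Q : VarSpace => Q.2) (key w)
  simp only [Prod.fst_add, Prod.snd_add, Prod.smul_fst, Prod.smul_snd, smul_eq_mul, hTx, hTy,
    hTu, hYx, hYu, mul_zero, add_zero] at kT kX kY kU
  have h1 : (fderiv ℝ Φ P vT).1.1 ≠ 0 := by
    intro h0
    have := kT vT
    rw [h0] at this
    simp at this
  have zT : ∀ w : VarSpace, w.1.1 = 0 → (fderiv ℝ Φ.symm (Φ P) w).1.1 = 0 := by
    intro w hw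
    have := kT w
    rw [hw] at this
    exact (mul_eq_zero.1 this.symm).resolve_right h1
  have h2 : (fderiv ℝ Φ P vY).1.2.2 ≠ 0 := by
    intro h0
    have := kY vY
    rw [h0] at this
    simp [zT vY rfl] at this
  have zY : ∀ w : VarSpace, w.1.1 = 0 → w.1.2.2 = 0 →
      (fderiv ℝ Φ.symm (Φ P) w).1.2.2 = 0 := by
    intro w hw hw2
    have := kY w
    rw [hw2, zT w hw, zero_mul, zero_add] at this
    exact (mul_eq_zero.1 this.symm).resolve_right h2
  have a1 := kX (0, 1)
  have a2 := kU (0, 1)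
  have b1 := kX vX
  have zero1 : ((0 : IndepSpace), (1 : ℝ)).1.1 = 0 := rfl
  rw [zT (0, 1) rfl, zY (0, 1) rfl rfl] at a1 a2
  rw [zT vX rfl, zY vX rfl rfl] at b1
  simp only [zero_mul, add_zero, zero_add, Prod.fst_zero, Prod.snd_zero] at a1 a2 b1
  refine ⟨h1, h2, fun hJ => ?_, fun r hr => ⟨fun hk => ?_, zT _ rfl, zY _ rfl rfl⟩⟩
  · have e1 : (fderiv ℝ Φ P eU).1.2.1 = 0 := by
      linear_combination (fderiv ℝ Φ P eU).1.2.1 * a2 - (fderiv ℝ Φ P eU).2 * a1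
        - (fderiv ℝ Φ.symm (Φ P) (0, 1)).1.2.1 * hJ
    have e2 : (fderiv ℝ Φ P vX).1.2.1 = 0 := by
      linear_combination (fderiv ℝ Φ P vX).1.2.1 * a2 - (fderiv ℝ Φ P vX).2 * a1
        + (fderiv ℝ Φ.symm (Φ P) (0, 1)).2 * hJ
    rw [e1, e2] at b1
    simp at b1
  · rw [hk] at a1 a2
    have e1 : (fderiv ℝ Φ.symm (Φ P) (0, 1)).1.2.1 = 0 :=
      (mul_eq_zero.1 (by linear_combination -a1 :
        (fderiv ℝ Φ.symm (Φ P) (0, 1)).1.2.1 *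
          ((fderiv ℝ Φ P vX).1.2.1 + r * (fderiv ℝ Φ P eU).1.2.1) = 0)).resolve_right hr
    rw [e1] at a2
    simp at a2

end Components

/-! ### The transformation is affine in `u` -/

section Projectability

variable {Φ : OpenPartialHomeomorph VarSpace VarSpace} {P : VarSpace} {σ σ' : ℝ → ℝ}

/-- The relations between the derivatives of a function on the target and those of its pull-back
under a map `(τ(t), χ(t, x, y), η(t, y))`. -/
theorem chain_rules {p p' : IndepSpace} {φ : SmoothGerm p' →+* SmoothGerm p}
    {τ χ η : SmoothGerm p}
    (hφ : ∀ w g, D w (φ g) = φ (D eT g) * D w τ + φ (D eX g) * D w χ + φ (D eY g) * D w η)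
    (hev : ∀ g, ev (φ g) = ev g) (hτx : D eX τ = 0) (hτy : D eY τ = 0) (hηx : D eX η = 0)
    (V : SmoothGerm p') :
    ev (D eX (φ V)) = ev (D eX V) * ev (D eX χ) ∧
    ev (D eX (D eX (φ V)))
      = ev (D eX (D eX V)) * ev (D eX χ) ^ 2 + ev (D eX V) * ev (D eX (D eX χ)) ∧
    ev (D eX (D eX (D eX (φ V)))) = ev (D eX (D eX (D eX V))) * ev (D eX χ) ^ 3
      + 3 * ev (D eX (D eX V)) * ev (D eX χ) * ev (D eX (D eX χ))
      + ev (D eX V) * ev (D eX (D eX (D eX χ))) ∧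
    ev (D eY (φ V)) = ev (D eX V) * ev (D eY χ) + ev (D eY V) * ev (D eY η) ∧
    ev (D eY (D eX (φ V))) = (ev (D eX (D eX V)) * ev (D eY χ)
      + ev (D eY (D eX V)) * ev (D eY η)) * ev (D eX χ) + ev (D eX V) * ev (D eY (D eX χ)) ∧
    ev (D eY (D eY (φ V))) = ev (D eX (D eX V)) * ev (D eY χ) ^ 2
      + 2 * ev (D eY (D eX V)) * ev (D eY χ) * ev (D eY η) + ev (D eY (D eY V)) * ev (D eY η) ^ 2
      + ev (D eX V) * ev (D eY (D eY χ)) + ev (D eY V) * ev (D eY (D eY η)) ∧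
    ev (D eT (D eX (φ V))) = (ev (D eT (D eX V)) * ev (D eT τ) + ev (D eX (D eX V)) * ev (D eT χ)
      + ev (D eY (D eX V)) * ev (D eT η)) * ev (D eX χ) + ev (D eX V) * ev (D eT (D eX χ)) := by
  refine ⟨?_, ?_, ?_, ?_, ?_, ?_, ?_⟩ <;>
  · simp only [map_add, D_mul, hφ, hτx, hτy, hηx, D_xy, mul_zero, add_zero,
      zero_add, map_mul, hev]
    try ring

/-- The derivatives of the restriction `(ι g)(q) = g(q, u(q))` of a function to a graph whose
derivatives at the point are known. Only `u_x`, `u_xx`, `u_xxx` are different from zero. -/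
theorem graph_rules {p : IndepSpace} {ι : SmoothGerm P →+* SmoothGerm p} {V : SmoothGerm p}
    (hι : ∀ w g, D w (ι g) = ι (D (w, 0) g) + ι (D eU g) * D w V)
    (hev : ∀ g, ev (ι g) = ev g) {r s c : ℝ} (h0 : ev (D eT V) = 0) (h1 : ev (D eX V) = r)
    (h2 : ev (D eY V) = 0) (h3 : ev (D eT (D eX V)) = 0) (h4 : ev (D eX (D eX V)) = s)
    (h5 : ev (D eY (D eX V)) = 0) (h6 : ev (D eY (D eY V)) = 0)
    (h7 : ev (D eX (D eX (D eX V))) = c) (g : SmoothGerm P) :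
    ev (D eX (ι g)) = ev (D vX g) + r * ev (D eU g) ∧
    ev (D eX (D eX (ι g))) = ev (D vX (D vX g)) + 2 * r * ev (D vX (D eU g))
      + r ^ 2 * ev (D eU (D eU g)) + s * ev (D eU g) ∧
    ev (D eX (D eX (D eX (ι g)))) = ev (D vX (D vX (D vX g))) + 3 * r * ev (D vX (D vX (D eU g)))
      + 3 * r ^ 2 * ev (D vX (D eU (D eU g))) + r ^ 3 * ev (D eU (D eU (D eU g)))
      + 3 * s * ev (D vX (D eU g)) + 3 * r * s * ev (D eU (D eU g)) + c * ev (D eU g) ∧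
    ev (D eY (ι g)) = ev (D vY g) ∧
    ev (D eY (D eX (ι g))) = ev (D vY (D vX g)) + r * ev (D vY (D eU g)) ∧
    ev (D eY (D eY (ι g))) = ev (D vY (D vY g)) ∧
    ev (D eT (ι g)) = ev (D vT g) ∧
    ev (D eT (D eX (ι g))) = ev (D vT (D vX g)) + r * ev (D vT (D eU g)) := by
  have hc : ∀ g : SmoothGerm P, D eU (D vX g) = D vX (D eU g) := fun g => D_comm _ _ _
  have hcy : ∀ g : SmoothGerm P, D eU (D vY g) = D vY (D eU g) := fun g => D_comm _ _ _
  refine ⟨?_, ?_, ?_, ?_, ?_, ?_, ?_, ?_⟩ <;>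
  · simp only [map_add, D_mul, hι, map_mul, hev, h0, h1, h2, h3, h4, h5, h6, h7, hc]
    ring

/-- What the transformation does to the germ of a function with derivatives `u_x = r`,
`u_xx = s` and all other derivatives zero, except for `u_xxx`, which is determined by the equation.
The derivatives `V₁ = v_x`, `V₂ = v_xx`, `V₃ = v_xxx`, … of the image are characterized by linear
equations, and they satisfy the new equation. -/
theorem exists_image_jet (hΦ : IsPointTransformation Φ) (hm : MapsEquation σ σ' Φ)
    (hF : IsFibered hΦ) (hP : P ∈ Φ.source) (r s : ℝ)
    (hr : ev (D vX (hΦ.gX hP)) + r * ev (D eU (hΦ.gX hP)) ≠ 0) :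
    ∃ V₁ V₂ V₃ Vy Vxy Vyy Vtx : ℝ,
      ev (D vX (hΦ.gU hP)) + r * ev (D eU (hΦ.gU hP))
        = V₁ * (ev (D vX (hΦ.gX hP)) + r * ev (D eU (hΦ.gX hP))) ∧
      ev (D vX (D vX (hΦ.gU hP))) + 2 * r * ev (D vX (D eU (hΦ.gU hP)))
          + r ^ 2 * ev (D eU (D eU (hΦ.gU hP))) + s * ev (D eU (hΦ.gU hP))
        = V₂ * (ev (D vX (hΦ.gX hP)) + r * ev (D eU (hΦ.gX hP))) ^ 2
          + V₁ * (ev (D vX (D vX (hΦ.gX hP))) + 2 * r * ev (D vX (D eU (hΦ.gX hP)))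
            + r ^ 2 * ev (D eU (D eU (hΦ.gX hP))) + s * ev (D eU (hΦ.gX hP))) ∧
      ev (D vX (D vX (D vX (hΦ.gU hP)))) + 3 * r * ev (D vX (D vX (D eU (hΦ.gU hP))))
          + 3 * r ^ 2 * ev (D vX (D eU (D eU (hΦ.gU hP))))
          + r ^ 3 * ev (D eU (D eU (D eU (hΦ.gU hP)))) + 3 * s * ev (D vX (D eU (hΦ.gU hP)))
          + 3 * r * s * ev (D eU (D eU (hΦ.gU hP))) - (P.2 * s + r ^ 2) * ev (D eU (hΦ.gU hP))
        = V₃ * (ev (D vX (hΦ.gX hP)) + r * ev (D eU (hΦ.gX hP))) ^ 3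
          + 3 * V₂ * (ev (D vX (hΦ.gX hP)) + r * ev (D eU (hΦ.gX hP)))
            * (ev (D vX (D vX (hΦ.gX hP))) + 2 * r * ev (D vX (D eU (hΦ.gX hP)))
              + r ^ 2 * ev (D eU (D eU (hΦ.gX hP))) + s * ev (D eU (hΦ.gX hP)))
          + V₁ * (ev (D vX (D vX (D vX (hΦ.gX hP)))) + 3 * r * ev (D vX (D vX (D eU (hΦ.gX hP))))
            + 3 * r ^ 2 * ev (D vX (D eU (D eU (hΦ.gX hP))))
            + r ^ 3 * ev (D eU (D eU (D eU (hΦ.gX hP)))) + 3 * s * ev (D vX (D eU (hΦ.gX hP)))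
            + 3 * r * s * ev (D eU (D eU (hΦ.gX hP)))
            - (P.2 * s + r ^ 2) * ev (D eU (hΦ.gX hP))) ∧
      ev (D vY (hΦ.gU hP)) = V₁ * ev (D vY (hΦ.gX hP)) + Vy * ev (D vY (hΦ.gY hP)) ∧
      ev (D vY (D vX (hΦ.gU hP))) + r * ev (D vY (D eU (hΦ.gU hP)))
        = (V₂ * ev (D vY (hΦ.gX hP)) + Vxy * ev (D vY (hΦ.gY hP)))
            * (ev (D vX (hΦ.gX hP)) + r * ev (D eU (hΦ.gX hP)))
          + V₁ * (ev (D vY (D vX (hΦ.gX hP))) + r * ev (D vY (D eU (hΦ.gX hP)))) ∧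
      ev (D vY (D vY (hΦ.gU hP))) = V₂ * ev (D vY (hΦ.gX hP)) ^ 2
          + 2 * Vxy * ev (D vY (hΦ.gX hP)) * ev (D vY (hΦ.gY hP))
          + Vyy * ev (D vY (hΦ.gY hP)) ^ 2 + V₁ * ev (D vY (D vY (hΦ.gX hP)))
          + Vy * ev (D vY (D vY (hΦ.gY hP))) ∧
      ev (D vT (D vX (hΦ.gU hP))) + r * ev (D vT (D eU (hΦ.gU hP)))
        = (Vtx * ev (D vT (hΦ.gT hP)) + V₂ * ev (D vT (hΦ.gX hP)) + Vxy * ev (D vT (hΦ.gY hP)))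
            * (ev (D vX (hΦ.gX hP)) + r * ev (D eU (hΦ.gX hP)))
          + V₁ * (ev (D vT (D vX (hΦ.gX hP))) + r * ev (D vT (D eU (hΦ.gX hP)))) ∧
      Vtx + V₁ ^ 2 + ev (hΦ.gU hP) * V₂ + V₃ + σ' (Φ P).1.1 * Vyy = 0 := by
  obtain ⟨p, z⟩ := P
  set u := jetPoly p z ![0, r, 0, 0, s, 0, 0, -(z * s + r ^ 2)] with hudef
  have hu : ContDiffAt ℝ ∞ u p := contDiffAt_jetPoly _ _ _
  have hup : u p = z := jetPoly_self _ _ _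
  have hp : (p, u p) ∈ Φ.source := by rwa [hup]
  have h0 : gkzk σ u p = 0 := by
    rw [hudef, gkzk_jetPoly]
    simp
    ring
  obtain ⟨n1, n2, n3⟩ := (hF.nondegenerate hP).2.2.2 r hr
  have ht : Transversal Φ u p := by
    unfold Transversal
    rw [fderiv_jetPoly, hup, n2, n3]
    simpa using n1
  obtain ⟨v, hv, hT⟩ := ht.exists_transformsInto hΦ hu hp
  have hv0 := (hm u v p hp hu hv hT).1 h0
  change ContDiffAt ℝ ∞ v (graphMap Φ u p) at hv
  change gkzk σ' v (graphMap Φ u p) = 0 at hv0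
  have hP' : (p, u p) = (p, z) := by rw [hup]
  obtain ⟨j0, j1, j2, j3, j4, j5, j6, j7⟩ :=
    ev_D_jetPoly p z ![0, r, 0, 0, s, 0, 0, -(z * s + r ^ 2)]
  set ι := pull _ (contDiffAt_graph hu) hP' with hι
  set φ := pull (graphMap Φ u) (contDiffAt_graphMap hΦ hu hp) rfl with hφ
  have gr := graph_rules (ι := ι) (D_pull_graph hu hP') ev_pull j0 j1 j2 j3 j4 j5 j6 j7
  have Dι : ∀ w g, D w (ι g) = ι (D (w, 0) g) + ι (D eU g) * D w (mk u hu) :=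
    D_pull_graph hu hP'
  have Dφ : ∀ w g, D w (φ g) = φ (D eT g) * D w (ι (hΦ.gT hP)) + φ (D eX g) * D w (ι (hΦ.gX hP))
        + φ (D eY g) * D w (ι (hΦ.gY hP)) :=
    D_pull_indep (hκ := contDiffAt_graphMap hΦ hu hp) (hy := rfl)
  have hφV : φ (mk v hv) = ι (hΦ.gU hP) := by
    rw [hφ, hι, pull_mk, IsPointTransformation.gU, pull_mk, mk_eq_mk]
    filter_upwards [hT] with q hq using hq.symm
  have ch := chain_rules Dφ ev_pull
    (by rw [Dι, hF.T_x, hF.T_u]; simp) (by rw [Dι, hF.T_y, hF.T_u]; simp)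
    (by rw [Dι, hF.Y_x, hF.Y_u]; simp) (mk v hv)
  rw [hφV] at ch
  obtain ⟨u1, u2, u3, uy, uxy, uyy, -, utx⟩ := gr (hΦ.gU hP)
  obtain ⟨x1, x2, x3, xy, xxy, xyy, xt, xtx⟩ := gr (hΦ.gX hP)
  obtain ⟨-, -, -, yy, -, yyy, yt, -⟩ := gr (hΦ.gY hP)
  obtain ⟨-, -, -, -, -, -, tt, -⟩ := gr (hΦ.gT hP)
  simp only [u1, u2, u3, uy, uxy, uyy, utx, x1, x2, x3, xy, xxy, xyy, xt, xtx, yy, yyy, yt, tt]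
    at ch
  obtain ⟨c1, c2, c3, c4, c5, c6, c7⟩ := ch
  rw [gkzk_eq_gkzkOp σ' hv, gkzkOp] at hv0
  refine ⟨_, _, ev (D eX (D eX (D eX (mk v hv)))), _, _, _, _, c1, c2, ?_, c4, c5, c6, c7, ?_⟩
  · simp only [Matrix.cons_val] at c3
    linear_combination c3
  · have e : ev (mk v hv) = ev (hΦ.gU hP) := by
      have := congrArg ev hφV
      rwa [hφ, hι, ev_pull, ev_pull] at this
    have hσ : σ' (graphMap Φ u p).1 = σ' (Φ (p, z)).1.1 := by rw [graphMap, hup]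
    rw [e, hσ] at hv0
    linear_combination hv0

/-- `x'` does not depend on `u`: otherwise the new equation, solved for `u_xxx` in the old
variables, would contain `u_xx²`. -/
theorem MapsEquation.ev_D_gX_eU (hm : MapsEquation σ σ' Φ) (hΦ : IsPointTransformation Φ)
    (hF : IsFibered hΦ) (hP : P ∈ Φ.source) : ev (D eU (hΦ.gX hP)) = 0 := by
  obtain ⟨nT, nY, nJ, -⟩ := hF.nondegenerate hP
  by_contra hXu
  obtain ⟨r, hr⟩ : ∃ r : ℝ, ev (D vX (hΦ.gX hP)) + r * ev (D eU (hΦ.gX hP)) ≠ 0 := by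
    by_cases h : ev (D vX (hΦ.gX hP)) = 0
    · exact ⟨1, by simpa [h] using hXu⟩
    · exact ⟨0, by simpa using h⟩
  obtain ⟨a₁, a₂, a₃, ay, axy, ayy, atx, ha1, ha2, ha3, ha4, ha5, ha6, ha7, ha8⟩ :=
    exists_image_jet hΦ hm hF hP r 0 hr
  obtain ⟨b₁, b₂, b₃, byy, bxy, byy', btx, hb1, hb2, hb3, hb4, hb5, hb6, hb7, hb8⟩ :=
    exists_image_jet hΦ hm hF hP r 1 hr
  obtain ⟨c₁, c₂, c₃, cy, cxy, cyy, ctx, hc1, hc2, hc3, hc4, hc5, hc6, hc7, hc8⟩ :=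
    exists_image_jet hΦ hm hF hP r (-1) hr
  set δ := ev (D vX (hΦ.gX hP)) + r * ev (D eU (hΦ.gX hP)) with hδ
  obtain rfl : b₁ = a₁ := mul_right_cancel₀ hr (by rw [← ha1, ← hb1])
  obtain rfl : c₁ = b₁ := mul_right_cancel₀ hr (by rw [← hc1, ← hb1])
  obtain rfl : byy = ay := mul_right_cancel₀ nY (by linear_combination ha4 - hb4)
  obtain rfl : cy = byy := mul_right_cancel₀ nY (by linear_combination hb4 - hc4)
  -- second differences with respect to `u_xx`
  have d2 : b₂ + c₂ - 2 * a₂ = 0 := by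
    refine (mul_eq_zero.1 (?_ : _ * δ ^ 2 = 0)).resolve_right (pow_ne_zero 2 hr)
    linear_combination 2 * ha2 - hb2 - hc2
  have dxy : bxy + cxy - 2 * axy = 0 := by
    refine (mul_eq_zero.1 (?_ : _ * (ev (D vY (hΦ.gY hP)) * δ) = 0)).resolve_right
      (mul_ne_zero nY hr)
    linear_combination 2 * ha5 - hb5 - hc5 - ev (D vY (hΦ.gX hP)) * δ * d2
  have dyy : byy' + cyy - 2 * ayy = 0 := by
    refine (mul_eq_zero.1 (?_ : _ * ev (D vY (hΦ.gY hP)) ^ 2 = 0)).resolve_right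
      (pow_ne_zero 2 nY)
    linear_combination 2 * ha6 - hb6 - hc6 - ev (D vY (hΦ.gX hP)) ^ 2 * d2
      - 2 * ev (D vY (hΦ.gX hP)) * ev (D vY (hΦ.gY hP)) * dxy
  have dtx : btx + ctx - 2 * atx = 0 := by
    refine (mul_eq_zero.1 (?_ : _ * (ev (D vT (hΦ.gT hP)) * δ) = 0)).resolve_right
      (mul_ne_zero nT hr)
    linear_combination 2 * ha7 - hb7 - hc7 - ev (D vT (hΦ.gX hP)) * δ * d2
      - ev (D vT (hΦ.gY hP)) * δ * dxy
  have d3 : b₃ + c₃ - 2 * a₃ = 0 := by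
    linear_combination hb8 + hc8 - 2 * ha8 - dtx - ev (hΦ.gU hP) * d2 - σ' (Φ P).1.1 * dyy
  have d2' : b₂ - c₂ = 0 := by
    refine (mul_eq_zero.1 (?_ : _ * (3 * δ * ev (D eU (hΦ.gX hP))) = 0)).resolve_right
      (mul_ne_zero (mul_ne_zero three_ne_zero hr) hXu)
    linear_combination 2 * ha3 - hb3 - hc3 - δ ^ 3 * d3
      - 3 * δ * (ev (D vX (D vX (hΦ.gX hP))) + 2 * r * ev (D vX (D eU (hΦ.gX hP)))
              + r ^ 2 * ev (D eU (D eU (hΦ.gX hP)))) * d2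
  have d2u : ev (D eU (hΦ.gU hP)) = c₁ * ev (D eU (hΦ.gX hP)) := by
    linear_combination (hb2 - hc2 + δ ^ 2 * d2') / 2
  refine nJ ?_
  linear_combination δ * d2u - ev (D eU (hΦ.gX hP)) * ha1

/-- `u'` is an affine function of `u`: otherwise the new equation, solved for `u_xxx` in
the old variables, would contain `u_x u_xx`. -/
theorem MapsEquation.ev_D_D_gU_eU (hm : MapsEquation σ σ' Φ) (hΦ : IsPointTransformation Φ)
    (hF : IsFibered hΦ) (hP : P ∈ Φ.source) (hX : D eU (hΦ.gX hP) = 0) :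
    ev (D eU (D eU (hΦ.gU hP))) = 0 := by
  obtain ⟨nT, nY, nJ, -⟩ := hF.nondegenerate hP
  have hr : ∀ r : ℝ, ev (D vX (hΦ.gX hP)) + r * ev (D eU (hΦ.gX hP)) ≠ 0 := by
    intro r
    rw [hX, map_zero, zero_mul, sub_zero] at nJ
    rw [hX, map_zero, mul_zero, add_zero]
    exact left_ne_zero_of_mul nJ
  obtain ⟨a₁, a₂, a₃, ay, axy, ayy, atx, ha1, ha2, ha3, ha4, ha5, ha6, ha7, ha8⟩ :=
    exists_image_jet hΦ hm hF hP 0 0 (hr 0)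
  obtain ⟨b₁, b₂, b₃, by', bxy, byy, btx, hb1, hb2, hb3, hb4, hb5, hb6, hb7, hb8⟩ :=
    exists_image_jet hΦ hm hF hP 0 1 (hr 0)
  obtain ⟨c₁, c₂, c₃, cy, cxy, cyy, ctx, hc1, hc2, hc3, hc4, hc5, hc6, hc7, hc8⟩ :=
    exists_image_jet hΦ hm hF hP 1 0 (hr 1)
  obtain ⟨d₁, d₂, d₃, dy, dxy, dyy, dtx, hd1, hd2, hd3, hd4, hd5, hd6, hd7, hd8⟩ :=
    exists_image_jet hΦ hm hF hP 1 1 (hr 1)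
  have hδ := hr 0
  simp only [hX, map_zero, mul_zero, add_zero, zero_mul, sub_zero] at *
  set δ := ev (D vX (hΦ.gX hP))
  obtain rfl : b₁ = a₁ := mul_right_cancel₀ hδ (by linear_combination ha1 - hb1)
  obtain rfl : d₁ = c₁ := mul_right_cancel₀ hδ (by linear_combination hc1 - hd1)
  obtain rfl : by' = ay := mul_right_cancel₀ nY (by linear_combination ha4 - hb4)
  obtain rfl : dy = cy := mul_right_cancel₀ nY (by linear_combination hc4 - hd4)
  -- mixed second differences with respect to `u_x` and `u_xx`
  have w2 : d₂ - c₂ - b₂ + a₂ = 0 := by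
    refine (mul_eq_zero.1 (?_ : _ * δ ^ 2 = 0)).resolve_right (pow_ne_zero 2 hδ)
    linear_combination hc2 + hb2 - hd2 - ha2
  have wxy : dxy - cxy - bxy + axy = 0 := by
    refine (mul_eq_zero.1 (?_ : _ * (ev (D vY (hΦ.gY hP)) * δ) = 0)).resolve_right
      (mul_ne_zero nY hδ)
    linear_combination hc5 + hb5 - hd5 - ha5 - ev (D vY (hΦ.gX hP)) * δ * w2
  have wyy : dyy - cyy - byy + ayy = 0 := by
    refine (mul_eq_zero.1 (?_ : _ * ev (D vY (hΦ.gY hP)) ^ 2 = 0)).resolve_right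
      (pow_ne_zero 2 nY)
    linear_combination hc6 + hb6 - hd6 - ha6 - ev (D vY (hΦ.gX hP)) ^ 2 * w2
      - 2 * ev (D vY (hΦ.gX hP)) * ev (D vY (hΦ.gY hP)) * wxy
  have wtx : dtx - ctx - btx + atx = 0 := by
    refine (mul_eq_zero.1 (?_ : _ * (ev (D vT (hΦ.gT hP)) * δ) = 0)).resolve_right
      (mul_ne_zero nT hδ)
    linear_combination hc7 + hb7 - hd7 - ha7 - ev (D vT (hΦ.gX hP)) * δ * w2
      - ev (D vT (hΦ.gY hP)) * δ * wxy
  have w3 : d₃ - c₃ - b₃ + a₃ = 0 := by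
    linear_combination hd8 - hc8 - hb8 + ha8 - wtx - ev (hΦ.gU hP) * w2 - σ' (Φ P).1.1 * wyy
  linear_combination (hd3 - hc3 - hb3 + ha3 + δ ^ 3 * w3
    + 3 * δ * ev (D vX (D vX (hΦ.gX hP))) * w2) / 3

end Projectability

/-! ### The equation for an affine function of a solution -/

section AffineFormula

variable {p p' : IndepSpace} {φ : SmoothGerm p' →+* SmoothGerm p} {τ χ η : SmoothGerm p}

/-- The equation for `u = A v + B`, expressed in terms of `v`. -/
theorem gkzkOp_affine
    (hφ : ∀ w g, D w (φ g) = φ (D eT g) * D w τ + φ (D eX g) * D w χ + φ (D eY g) * D w η)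
    (hev : ∀ g, ev (φ g) = ev g) (hτx : D eX τ = 0) (hτy : D eY τ = 0) (hηx : D eX η = 0)
    (s : ℝ) (A B : SmoothGerm p) (V : SmoothGerm p') :
    gkzkOp s (A * φ V + B) =
      (ev (D eT (D eX A)) * ev V
        + ev (D eX A) * (ev (D eT V) * ev (D eT τ) + ev (D eX V) * ev (D eT χ)
          + ev (D eY V) * ev (D eT η))
        + ev (D eT A) * (ev (D eX V) * ev (D eX χ))
        + ev A * ((ev (D eT (D eX V)) * ev (D eT τ) + ev (D eX (D eX V)) * ev (D eT χ)
          + ev (D eY (D eX V)) * ev (D eT η)) * ev (D eX χ) + ev (D eX V) * ev (D eT (D eX χ)))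
        + ev (D eT (D eX B)))
      + (ev (D eX A) * ev V + ev A * ev (D eX V) * ev (D eX χ) + ev (D eX B)) ^ 2
      + (ev A * ev V + ev B) * (ev (D eX (D eX A)) * ev V
        + 2 * ev (D eX A) * ev (D eX V) * ev (D eX χ)
        + ev A * (ev (D eX (D eX V)) * ev (D eX χ) ^ 2 + ev (D eX V) * ev (D eX (D eX χ)))
        + ev (D eX (D eX B)))
      + (ev (D eX (D eX (D eX A))) * ev V + 3 * ev (D eX (D eX A)) * ev (D eX V) * ev (D eX χ)
        + 3 * ev (D eX A) * (ev (D eX (D eX V)) * ev (D eX χ) ^ 2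
          + ev (D eX V) * ev (D eX (D eX χ)))
        + ev A * (ev (D eX (D eX (D eX V))) * ev (D eX χ) ^ 3
          + 3 * ev (D eX (D eX V)) * ev (D eX χ) * ev (D eX (D eX χ))
          + ev (D eX V) * ev (D eX (D eX (D eX χ))))
        + ev (D eX (D eX (D eX B))))
      + s * (ev (D eY (D eY A)) * ev V
        + 2 * ev (D eY A) * (ev (D eX V) * ev (D eY χ) + ev (D eY V) * ev (D eY η))
        + ev A * (ev (D eX (D eX V)) * ev (D eY χ) ^ 2
          + 2 * ev (D eY (D eX V)) * ev (D eY χ) * ev (D eY η)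
          + ev (D eY (D eY V)) * ev (D eY η) ^ 2
          + ev (D eX V) * ev (D eY (D eY χ)) + ev (D eY V) * ev (D eY (D eY η)))
        + ev (D eY (D eY B))) := by
  unfold gkzkOp
  simp only [map_add, D_mul, hφ, hτx, hτy, hηx, D_xy, mul_zero, add_zero, zero_add, map_mul, hev]
  ring

/-- Comparison of coefficients: the conditions for `u = A v + B` to map solutions, at the level of
jets, of the equation for `v` to those of the equation for `u`. -/
theorem determining_equations
    (hφ : ∀ w g, D w (φ g) = φ (D eT g) * D w τ + φ (D eX g) * D w χ + φ (D eY g) * D w η)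
    (hev : ∀ g, ev (φ g) = ev g) (hτx : D eX τ = 0) (hτy : D eY τ = 0) (hηx : D eX η = 0)
    (s s' z' : ℝ) (A B : SmoothGerm p) (hA : ev A ≠ 0)
    (H : ∀ j : Fin 8 → ℝ, j 3 + j 1 ^ 2 + z' * j 4 + j 7 + s' * j 6 = 0 →
      gkzkOp s (A * φ (mk (jetPoly p' z' j) (contDiffAt_jetPoly p' z' j)) + B) = 0) :
    ev (D eX χ) * ev (D eT τ) = ev (D eX χ) ^ 3 ∧
    s * ev (D eY η) ^ 2 = s' * ev (D eX χ) ^ 3 ∧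
    ev (D eX χ) * ev (D eT η) + 2 * s * ev (D eY χ) * ev (D eY η) = 0 ∧
    ev A * ev (D eX χ) ^ 2 = ev (D eX χ) ^ 3 ∧
    3 * ev (D eX A) * ev (D eX χ) ^ 2 + ev A * (3 * ev (D eX χ) * ev (D eX (D eX χ))
      + ev (D eX χ) * ev (D eT χ) + s * ev (D eY χ) ^ 2 - z' * ev (D eX χ) ^ 3
      + (ev A * z' + ev B) * ev (D eX χ) ^ 2) = 0 ∧
    ev (D eX A) * ev (D eT χ) + ev (D eT A) * ev (D eX χ) + ev A * ev (D eT (D eX χ))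
      + 2 * (ev (D eX A) * z' + ev (D eX B)) * ev A * ev (D eX χ)
      + (ev A * z' + ev B) * (2 * ev (D eX A) * ev (D eX χ) + ev A * ev (D eX (D eX χ)))
      + 3 * ev (D eX (D eX A)) * ev (D eX χ) + 3 * ev (D eX A) * ev (D eX (D eX χ))
      + ev A * ev (D eX (D eX (D eX χ)))
      + s * (2 * ev (D eY A) * ev (D eY χ) + ev A * ev (D eY (D eY χ))) = 0 ∧
    ev (D eT (D eX A)) * z' + ev (D eT (D eX B)) + (ev (D eX A) * z' + ev (D eX B)) ^ 2
      + (ev A * z' + ev B) * (ev (D eX (D eX A)) * z' + ev (D eX (D eX B)))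
      + ev (D eX (D eX (D eX A))) * z' + ev (D eX (D eX (D eX B)))
      + s * (ev (D eY (D eY A)) * z' + ev (D eY (D eY B))) = 0 ∧
    ev (D eX A) * ev (D eT η) + s * (2 * ev (D eY A) * ev (D eY η)
      + ev A * ev (D eY (D eY η))) = 0 := by
  have F := fun j hj => (gkzkOp_affine hφ hev hτx hτy hηx s A B
    (mk (jetPoly p' z' j) (contDiffAt_jetPoly p' z' j))).symm.trans (H j hj)
  have G : ∀ j0 j1 j2 j3 j4 j5 j6 j7 : ℝ, j3 + j1 ^ 2 + z' * j4 + j7 + s' * j6 = 0 → _ :=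
    fun j0 j1 j2 j3 j4 j5 j6 j7 h => by
      have := F ![j0, j1, j2, j3, j4, j5, j6, j7] h
      obtain ⟨c0, c1, c2, c3, c4, c5, c6, c7⟩ :=
        ev_D_jetPoly p' z' ![j0, j1, j2, j3, j4, j5, j6, j7]
      rw [c0, c1, c2, c3, c4, c5, c6, c7, ev_mk, jetPoly_self] at this
      simp only [Matrix.cons_val] at this
      exact this
  -- values of the jet that satisfy the equation; their differences isolate the coefficients of
  -- `v_tx`, `v_yy`, `v_xy`, `v_x²`, `v_xx`, `v_x`, `1` and `v_y`, with `v_xxx` eliminated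
  have f0 := G 0 0 0 0 0 0 0 0 (by ring)
  have ftx := G 0 0 0 1 0 0 0 (-1) (by ring)
  have fyy := G 0 0 0 0 0 0 1 (-s') (by ring)
  have fxy := G 0 0 0 0 0 1 0 0 (by ring)
  have fxx := G 0 0 0 0 1 0 0 (-z') (by ring)
  have fx := G 0 1 0 0 0 0 0 (-1) (by ring)
  have fx' := G 0 (-1) 0 0 0 0 0 (-1) (by ring)
  have fy := G 0 0 1 0 0 0 0 0 (by ring)
  clear G F H
  refine ⟨mul_left_cancel₀ hA ?_, mul_left_cancel₀ hA ?_, mul_left_cancel₀ hA ?_,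
    mul_left_cancel₀ hA ?_, ?_, ?_, ?_, ?_⟩
  · linear_combination ftx - f0
  · linear_combination fyy - f0
  · linear_combination fxy - f0
  · linear_combination (fx + fx' - 2 * f0) / 2
  · linear_combination fxx - f0
  · linear_combination (fx - fx') / 2
  · linear_combination f0
  · linear_combination fy - f0

end AffineFormula

section Restriction

variable {Φ : OpenPartialHomeomorph VarSpace VarSpace} {P : VarSpace} {σ σ' : ℝ → ℝ}

/-- A function whose derivative along `u` vanishes does not depend on `u`, on a ball. -/
theorem eq_of_fderiv_eU_eq_zero {ε : ℝ} {f : VarSpace → ℝ}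
    (hf : ∀ Q ∈ Metric.ball P ε, DifferentiableAt ℝ f Q)
    (h : ∀ Q ∈ Metric.ball P ε, fderiv ℝ f Q eU = 0) {q : IndepSpace} {z z' : ℝ}
    (hz : (q, z) ∈ Metric.ball P ε) (hz' : (q, z') ∈ Metric.ball P ε) : f (q, z) = f (q, z') := by
  have hl : ∀ s : ℝ, HasFDerivAt (fun s : ℝ => ((q, s) : VarSpace))
      (ContinuousLinearMap.inr ℝ IndepSpace ℝ) s := fun s => hasFDerivAt_prodMk_right q s
  have hd : ∀ s : ℝ, (q, s) ∈ Metric.ball P ε → HasDerivAt (fun s : ℝ => f (q, s)) 0 s := by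
    intro s hs
    have := ((hf _ hs).hasFDerivAt.comp s (hl s)).hasDerivAt
    rw [ContinuousLinearMap.comp_apply] at this
    change HasDerivAt _ (fderiv ℝ f (q, s) eU) s at this
    rwa [h _ hs] at this
  have hopen : IsOpen {s : ℝ | (q, s) ∈ Metric.ball P ε} :=
    Metric.isOpen_ball.preimage (Continuous.prodMk_right q)
  have hconv : Convex ℝ {s : ℝ | (q, s) ∈ Metric.ball P ε} := by
    intro a ha b hb m n hm hn hmn
    have := convex_ball P ε ha hb hm hn hmn
    have e : m • ((q, a) : VarSpace) + n • ((q, b) : VarSpace) = (q, m • a + n • b) := by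
      ext1
      · simp [← add_smul, hmn]
      · rfl
    rwa [e] at this
  exact hopen.is_const_of_deriv_eq_zero hconv.isPreconnected
    (fun s hs => (hd s hs).differentiableAt.differentiableWithinAt)
    (fun s hs => (hd s hs).deriv) hz hz'

/-- The restriction of germs to the hyperplane `u = const`. -/
def restr (P : VarSpace) : SmoothGerm P →+* SmoothGerm P.1 :=
  pull (fun q => ((q, P.2) : VarSpace)) (contDiffAt_graph contDiffAt_const) rfl

@[simp] theorem ev_restr (g : SmoothGerm P) : ev (restr P g) = ev g := ev_pull g

theorem D_restr (w : IndepSpace) (g : SmoothGerm P) :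
    D w (restr P g) = restr P (D (w, 0) g) := by
  have := D_pull_graph (v := fun _ => P.2) (p := P.1) contDiffAt_const rfl w g
  have h0 : D w (mk (fun _ => P.2) contDiffAt_const : SmoothGerm P.1) = 0 := D_const w P.2
  rw [h0, mul_zero, add_zero] at this
  exact this

end Restriction

/-! ### The determining equations -/

section DeterminingEquations

variable {Φ : OpenPartialHomeomorph VarSpace VarSpace} {P : VarSpace} {σ σ' : ℝ → ℝ}

/-- The components `t'`, `x'`, `y'` depend on `t, x, y` only, and `u'` is affine in `u`. -/
structure IsAffine (hΦ : IsPointTransformation Φ) : Prop extends IsFibered hΦ where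
  X_u : ∀ P, ∀ hP : P ∈ Φ.source, D eU (hΦ.gX hP) = 0
  U_uu : ∀ P, ∀ hP : P ∈ Φ.source, D eU (D eU (hΦ.gU hP)) = 0

theorem MapsEquation.isAffine (hm : MapsEquation σ σ' Φ)
    (hΦ : IsPointTransformation Φ) (hσ : ∀ P ∈ Φ.source, σ P.1.1 ≠ 0) : IsAffine hΦ := by
  have hF := hm.isFibered hΦ hσ
  have hX : ∀ P, ∀ hP : P ∈ Φ.source, D eU (hΦ.gX hP) = 0 := fun P hP =>
    D_eq_zero_of_forall Φ.open_source (fun Q hQ => (hΦ.contDiffAt (P := Q) hQ).fst.snd.fst)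
      (fun Q hQ => hm.ev_D_gX_eU hΦ hF hQ) hP
  refine ⟨hF, hX, fun P hP => ?_⟩
  have e : ∀ Q, ∀ hQ : Q ∈ Φ.source, D eU (hΦ.gU hQ) = mk
      (fun Q => fderiv ℝ (fun Q => (Φ Q).2) Q eU) (contDiffAt_fderiv_apply
        (hΦ.contDiffAt (P := Q) hQ).snd eU) := fun Q hQ => D_mk _ _
  rw [e]
  refine D_eq_zero_of_forall (f := fun Q => fderiv ℝ (fun Q => (Φ Q).2) Q eU) Φ.open_source
    (fun Q hQ => contDiffAt_fderiv_apply (hΦ.contDiffAt (P := Q) hQ).snd eU)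
    (fun Q hQ => ?_) hP
  rw [← e Q hQ]
  exact hm.ev_D_D_gU_eU hΦ hF hQ (hX Q hQ)

namespace IsAffine

variable {hΦ : IsPointTransformation Φ}

theorem X_x_mul_U_u_ne_zero (h : IsAffine hΦ) (hP : P ∈ Φ.source) :
    ev (D vX (hΦ.gX hP)) * ev (D eU (hΦ.gU hP)) ≠ 0 := by
  have := (h.toIsFibered.nondegenerate hP).2.2.1
  rwa [h.X_u, map_zero, zero_mul, sub_zero] at this

theorem X_x_ne_zero (h : IsAffine hΦ) (hP : P ∈ Φ.source) : ev (D vX (hΦ.gX hP)) ≠ 0 :=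
  left_ne_zero_of_mul (h.X_x_mul_U_u_ne_zero hP)

theorem U_u_ne_zero (h : IsAffine hΦ) (hP : P ∈ Φ.source) : ev (D eU (hΦ.gU hP)) ≠ 0 :=
  right_ne_zero_of_mul (h.X_x_mul_U_u_ne_zero hP)

/-- The local normal form of a transformation that is affine in `u`: on a ball, the derivatives
along `u` can be integrated. -/
theorem exists_ball (h : IsAffine hΦ) (hP : P ∈ Φ.source) : ∃ ε > 0,
    ∀ q z, (q, z) ∈ Metric.ball P ε → (q, P.2) ∈ Metric.ball P ε →
      (Φ (q, z)).1 = (Φ (q, P.2)).1 ∧ (Φ (q, z)).2 = (Φ (q, P.2)).2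
        + fderiv ℝ (fun Q => (Φ Q).2) (q, P.2) eU * (z - P.2) := by
  obtain ⟨ε, hε, hball⟩ := Metric.isOpen_iff.1 Φ.open_source P hP
  refine ⟨ε, hε, fun q z hz hz' => ?_⟩
  have hd := fun Q (hQ : Q ∈ Metric.ball P ε) => hΦ.differentiableAt (hball hQ)
  have eT : (Φ (q, z)).1.1 = (Φ (q, P.2)).1.1 :=
    eq_of_fderiv_eU_eq_zero (f := fun Q => (Φ Q).1.1) (fun Q hQ => (hd Q hQ).fst.fst)
      (fun Q hQ => by
        have := congrArg ev (h.T_u Q (hball hQ))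
        rwa [IsPointTransformation.gT, ev_D_mk, map_zero] at this) hz hz'
  have eX : (Φ (q, z)).1.2.1 = (Φ (q, P.2)).1.2.1 :=
    eq_of_fderiv_eU_eq_zero (f := fun Q => (Φ Q).1.2.1) (fun Q hQ => (hd Q hQ).fst.snd.fst)
      (fun Q hQ => by
        have := congrArg ev (h.X_u Q (hball hQ))
        rwa [IsPointTransformation.gX, ev_D_mk, map_zero] at this) hz hz'
  have eY : (Φ (q, z)).1.2.2 = (Φ (q, P.2)).1.2.2 :=
    eq_of_fderiv_eU_eq_zero (f := fun Q => (Φ Q).1.2.2) (fun Q hQ => (hd Q hQ).fst.snd.snd)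
      (fun Q hQ => by
        have := congrArg ev (h.Y_u Q (hball hQ))
        rwa [IsPointTransformation.gY, ev_D_mk, map_zero] at this) hz hz'
  set a : VarSpace → ℝ := fun Q => fderiv ℝ (fun Q => (Φ Q).2) Q eU with ha
  have had : ∀ Q ∈ Metric.ball P ε, ContDiffAt ℝ ∞ a Q := fun Q hQ =>
    contDiffAt_fderiv_apply (hΦ.contDiffAt (hball hQ)).snd eU
  have had1 := fun Q hQ => (had Q hQ).differentiableAt (by simp)
  have ha0 : ∀ Q ∈ Metric.ball P ε, fderiv ℝ a Q eU = 0 := fun Q hQ => by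
    have := congrArg ev (h.U_uu Q (hball hQ))
    rwa [IsPointTransformation.gU, D_mk, ev_D_mk, map_zero] at this
  have ea : a (q, z) = a (q, P.2) := eq_of_fderiv_eU_eq_zero had1 ha0 hz hz'
  have eU : (Φ (q, z)).2 - a (q, z) * z = (Φ (q, P.2)).2 - a (q, P.2) * P.2 := by
    refine eq_of_fderiv_eU_eq_zero (f := fun Q => (Φ Q).2 - a Q * Q.2)
      (fun Q hQ => (hd Q hQ).snd.sub ((had1 Q hQ).fun_mul differentiableAt_snd)) (fun Q hQ => ?_)
      hz hz'
    rw [fderiv_fun_sub (hd Q hQ).snd ((had1 Q hQ).fun_mul differentiableAt_snd),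
      fderiv_fun_mul (had1 Q hQ) differentiableAt_snd, fderiv_snd]
    simp [ha0 Q hQ]
    exact sub_self _
  refine ⟨Prod.ext eT (Prod.ext eX eY), ?_⟩
  rw [ea] at eU
  linear_combination eU

/-- The function that is mapped to `v` is `u = A v + B`, where `u' = (u - B) / A`. If the jet of `v`
satisfies the new equation, then the jet of `u` satisfies the old one. -/
theorem gkzkOp_preimage_eq_zero (h : IsAffine hΦ) (hm : MapsEquation σ σ' Φ) (hP : P ∈ Φ.source)
    (A B : SmoothGerm P.1) (hA : A * restr P (D eU (hΦ.gU hP)) = 1)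
    (hB : B = const P.2 - A * restr P (hΦ.gU hP)) : ∀ j : Fin 8 → ℝ,
      j 3 + j 1 ^ 2 + (Φ P).2 * j 4 + j 7 + σ' (Φ P).1.1 * j 6 = 0 →
      gkzkOp (σ P.1.1) (A * pull (fun q => (Φ (q, P.2)).1)
        (contDiffAt_image_graph (u := fun _ => P.2) hΦ contDiffAt_const hP).fst rfl
        (SmoothGerm.mk (jetPoly (Φ P).1 (Φ P).2 j) (contDiffAt_jetPoly (Φ P).1 (Φ P).2 j)) + B)
      = 0 := by
  intro j hj
  set a : IndepSpace → ℝ := fun q => fderiv ℝ (fun Q => (Φ Q).2) (q, P.2) eU with ha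
  have hrestr : ContDiffAt ℝ ∞ (fun q => ((q, P.2) : VarSpace)) P.1 :=
    contDiffAt_graph contDiffAt_const
  have has : ContDiffAt ℝ ∞ a P.1 :=
    ContDiffAt.comp (g := fun Q => fderiv ℝ (fun Q => (Φ Q).2) Q eU) P.1
      (contDiffAt_fderiv_apply (hΦ.contDiffAt hP).snd eU) hrestr
  have ha' : SmoothGerm.mk a has = restr P (D eU (hΦ.gU hP)) := by
    rw [IsPointTransformation.gU, D_mk, restr, pull_mk]
  have ha0 : a P.1 ≠ 0 := by
    have := h.U_u_ne_zero hP
    rwa [← ev_restr, ← ha', ev_mk] at this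
  have hai : ContDiffAt ℝ ∞ (fun q => (a q)⁻¹) P.1 := has.inv ha0
  have hane : ∀ᶠ q in 𝓝 P.1, a q ≠ 0 := has.continuousAt.eventually_ne ha0
  have hAi : A = SmoothGerm.mk _ hai := by
    have e : SmoothGerm.mk _ hai * SmoothGerm.mk a has = 1 := by
      change SmoothGerm.mk (fun q => (a q)⁻¹ * a q) (hai.mul has)
        = SmoothGerm.mk (fun _ => 1) contDiffAt_const
      rw [mk_eq_mk]
      filter_upwards [hane] with q hq using inv_mul_cancel₀ hq
    calc A = A * (SmoothGerm.mk _ hai * SmoothGerm.mk a has) := by rw [e, mul_one]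
      _ = SmoothGerm.mk _ hai * (A * restr P (D eU (hΦ.gU hP))) := by rw [ha']; ring
      _ = SmoothGerm.mk _ hai := by rw [hA, mul_one]
  have hI := contDiffAt_image_graph (u := fun _ => P.2) hΦ contDiffAt_const hP
  set v := jetPoly (Φ P).1 (Φ P).2 j with hv
  have hvs : ContDiffAt ℝ ∞ v (Φ P).1 := contDiffAt_jetPoly _ _ _
  have hv0 : gkzk σ' v (Φ P).1 = 0 := by
    rw [hv, gkzk_jetPoly, hj]
  set u : IndepSpace → ℝ := fun q =>
    (a q)⁻¹ * v (Φ (q, P.2)).1 + (P.2 - (a q)⁻¹ * (Φ (q, P.2)).2) with hu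
  have hvK : ContDiffAt ℝ ∞ (fun q => v (Φ (q, P.2)).1) P.1 :=
    ContDiffAt.comp (g := v) (f := fun q => (Φ (q, P.2)).1) P.1 hvs hI.fst
  have hus : ContDiffAt ℝ ∞ u P.1 := (hai.mul hvK).add (contDiffAt_const.sub (hai.mul hI.snd))
  have hup : u P.1 = P.2 := by
    have : v (Φ (P.1, P.2)).1 = (Φ (P.1, P.2)).2 := jetPoly_self _ _ _
    rw [hu]
    simp only [this]
    ring
  have hp : (P.1, u P.1) ∈ Φ.source := by rwa [hup]
  have hT : TransformsInto Φ u v P.1 := by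
    obtain ⟨ε, hε, hloc⟩ := h.exists_ball hP
    have b1 : ∀ᶠ q in 𝓝 P.1, (q, u q) ∈ Metric.ball P ε :=
      eventually_graph_mem hus Metric.isOpen_ball (by rw [hup]; exact Metric.mem_ball_self hε)
    have b2 : ∀ᶠ q in 𝓝 P.1, (q, P.2) ∈ Metric.ball P ε :=
      eventually_graph_mem (u := fun _ => P.2) contDiffAt_const Metric.isOpen_ball
        (Metric.mem_ball_self hε)
    filter_upwards [b1, b2, hane] with q h1 h2 h3
    obtain ⟨e1, e2⟩ := hloc q (u q) h1 h2
    rw [e1, e2]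
    change (Φ (q, P.2)).2 + a q * (u q - P.2) = _
    rw [hu]
    field_simp
    ring
  have hmk : A * pull (fun q => (Φ (q, P.2)).1) hI.fst rfl (SmoothGerm.mk v hvs) + B
      = SmoothGerm.mk u hus := by
    rw [hB, hAi]
    rfl
  have key := (hm u v P.1 hp hus (by rw [hup]; exact hvs) hT).2 (by rw [hup]; exact hv0)
  rw [gkzk_eq_gkzkOp σ hus, ← hmk] at key
  exact key

end IsAffine

end DeterminingEquations

/-! ### Families of germs -/

section Identities

variable {Φ : OpenPartialHomeomorph VarSpace VarSpace} {P : VarSpace} {σ σ' : ℝ → ℝ}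

theorem SmoothGerm.exists_inv {E : Type*} [NormedAddCommGroup E] [NormedSpace ℝ E] {x : E}
    {g : SmoothGerm x} (hg : ev g ≠ 0) : ∃ A, A * g = 1 := by
  obtain ⟨f, hf, rfl⟩ := exists_mk g
  refine ⟨SmoothGerm.mk (fun y => (f y)⁻¹) (hf.inv hg), ?_⟩
  rw [mk_mul]
  change _ = SmoothGerm.mk (fun _ => 1) contDiffAt_const
  rw [mk_eq_mk]
  filter_upwards [hf.continuousAt.eventually_ne hg] with y hy using inv_mul_cancel₀ hy

theorem SmoothGerm.eq_zero_of_mul_eq_zero {E : Type*} [NormedAddCommGroup E] [NormedSpace ℝ E]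
    {x : E} {a b : SmoothGerm x} (ha : ev a ≠ 0) (h : a * b = 0) : b = 0 := by
  obtain ⟨c, hc⟩ := exists_inv ha
  calc b = c * a * b := by rw [hc, one_mul]
    _ = 0 := by rw [mul_assoc, h, mul_zero]

/-- The germ of a function of `t`, as a function of all variables. -/
def timeGerm (hσ : ContDiffAt ℝ ∞ σ P.1.1) : SmoothGerm P :=
  SmoothGerm.mk (fun Q : VarSpace => σ Q.1.1)
    (ContDiffAt.comp (g := σ) (f := fun Q : VarSpace => Q.1.1) P hσ contDiffAt_fst.fst)

theorem D_timeGerm_of_eq_zero (hσ : ContDiffAt ℝ ∞ σ P.1.1) {w : VarSpace} (hw : w.1.1 = 0) :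
    D w (timeGerm hσ) = 0 := by
  rw [timeGerm, D_mk]
  change _ = SmoothGerm.mk (fun _ => 0) contDiffAt_const
  rw [mk_eq_mk]
  have h1 : Tendsto (fun Q : VarSpace => Q.1.1) (𝓝 P) (𝓝 P.1.1) := by
    exact (continuous_fst.comp continuous_fst).tendsto P
  filter_upwards [h1.eventually (eventually_differentiableAt hσ)] with Q hQ
  have h2 : HasFDerivAt (fun Q : VarSpace => Q.1.1)
      ((ContinuousLinearMap.fst ℝ ℝ (ℝ × ℝ)).comp (ContinuousLinearMap.fst ℝ IndepSpace ℝ)) Q :=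
    hasFDerivAt_fst.fst
  have := (hQ.hasFDerivAt.comp Q h2).fderiv
  change fderiv ℝ (σ ∘ fun Q : VarSpace => Q.1.1) Q w = 0
  rw [this]
  change fderiv ℝ σ Q.1.1 w.1.1 = 0
  rw [hw, map_zero]

/-- The differential equations that characterize the point transformations between equations of
the class, for `t' = T(t)`, `x' = X(t, x, y)`, `y' = Y(t, y)` and `u' = U(t, x, y, u)`. Those that
are differentiated later on are stated for germs, the other ones for values. -/
structure IsNormalized (hΦ : IsPointTransformation Φ) (σ σ' : ℝ → ℝ) : Prop
    extends IsAffine hΦ where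
  X_xx : ∀ P, ∀ hP : P ∈ Φ.source, D vX (D vX (hΦ.gX hP)) = 0
  X_xy : ∀ P, ∀ hP : P ∈ Φ.source, D vY (D vX (hΦ.gX hP)) = 0
  X_yy : ∀ P, ∀ hP : P ∈ Φ.source, D vY (D vY (hΦ.gX hP)) = 0
  Y_yy : ∀ P, ∀ hP : P ∈ Φ.source, D vY (D vY (hΦ.gY hP)) = 0
  Y_ty : ∀ P, ∀ hP : P ∈ Φ.source, D vT (D vY (hΦ.gY hP)) = 0
  T_t : ∀ P, ∀ hP : P ∈ Φ.source, D vT (hΦ.gT hP) = D vX (hΦ.gX hP) * D vX (hΦ.gX hP)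
  coeff : ∀ P, ∀ hP : P ∈ Φ.source, σ P.1.1 * ev (D vY (hΦ.gY hP)) ^ 2
    = σ' (Φ P).1.1 * ev (D vX (hΦ.gX hP)) ^ 3
  X_y : ∀ P, ∀ hP : P ∈ Φ.source, ev (D vX (hΦ.gX hP)) * ev (D vT (hΦ.gY hP))
    + 2 * σ P.1.1 * ev (D vY (hΦ.gX hP)) * ev (D vY (hΦ.gY hP)) = 0
  U_eq : ∀ P, ∀ hP : P ∈ Φ.source, ev (hΦ.gU hP) * ev (D vX (hΦ.gX hP)) ^ 3
    = ev (D vX (hΦ.gX hP)) * ev (D vT (hΦ.gX hP)) + σ P.1.1 * ev (D vY (hΦ.gX hP)) ^ 2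
      + P.2 * ev (D vX (hΦ.gX hP)) ^ 2
  X_xtt : ∀ P, ∀ hP : P ∈ Φ.source,
    ev (D vX (hΦ.gX hP)) * ev (D vT (D vT (D vX (hΦ.gX hP)))) = 2 * ev (D vT (D vX (hΦ.gX hP))) ^ 2

theorem germ_eq_of_forall {S : Set VarSpace} (hS : IsOpen S) {f g : VarSpace → ℝ}
    (hf : ContDiffAt ℝ ∞ f P) (hg : ContDiffAt ℝ ∞ g P) (hP : P ∈ S)
    (h : ∀ Q ∈ S, f Q = g Q) : SmoothGerm.mk f hf = SmoothGerm.mk g hg := by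
  rw [mk_eq_mk]
  filter_upwards [hS.mem_nhds hP] with Q hQ using h Q hQ

/-- A smooth germ at every point of an open set, coming from a single function. -/
def IsFamily (S : Set VarSpace) (g : ∀ P, P ∈ S → SmoothGerm P) : Prop :=
  ∃ f : VarSpace → ℝ, ∀ P, ∀ hP : P ∈ S, ∃ hf : ContDiffAt ℝ ∞ f P, g P hP = SmoothGerm.mk f hf

namespace IsFamily

variable {S : Set VarSpace} {g g' : ∀ P, P ∈ S → SmoothGerm P}

theorem D (hg : IsFamily S g) (w : VarSpace) : IsFamily S (fun P hP => D w (g P hP)) := by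
  obtain ⟨f, hf⟩ := hg
  refine ⟨fun Q => fderiv ℝ f Q w, fun P hP => ?_⟩
  obtain ⟨h1, h2⟩ := hf P hP
  refine ⟨contDiffAt_fderiv_apply h1 w, ?_⟩
  simp only [h2]
  exact D_mk w h1

theorem mul (hg : IsFamily S g) (hg' : IsFamily S g') :
    IsFamily S (fun P hP => g P hP * g' P hP) := by
  obtain ⟨f, hf⟩ := hg
  obtain ⟨f', hf'⟩ := hg'
  refine ⟨fun Q => f Q * f' Q, fun P hP => ?_⟩
  obtain ⟨h1, h2⟩ := hf P hP
  obtain ⟨h1', h2'⟩ := hf' P hP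
  exact ⟨h1.mul h1', by simp only [h2, h2', mk_mul]⟩

theorem add (hg : IsFamily S g) (hg' : IsFamily S g') :
    IsFamily S (fun P hP => g P hP + g' P hP) := by
  obtain ⟨f, hf⟩ := hg
  obtain ⟨f', hf'⟩ := hg'
  refine ⟨fun Q => f Q + f' Q, fun P hP => ?_⟩
  obtain ⟨h1, h2⟩ := hf P hP
  obtain ⟨h1', h2'⟩ := hf' P hP
  exact ⟨h1.add h1', by simp only [h2, h2', mk_add]⟩

/-- An identity between the values of two families is an identity of germs. -/
theorem eq_of_ev_eq (hS : IsOpen S) (hg : IsFamily S g) (hg' : IsFamily S g')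
    (h : ∀ P, ∀ hP : P ∈ S, ev (g P hP) = ev (g' P hP)) {P : VarSpace} (hP : P ∈ S) :
    g P hP = g' P hP := by
  obtain ⟨f, hf⟩ := hg
  obtain ⟨f', hf'⟩ := hg'
  obtain ⟨h1, h2⟩ := hf P hP
  obtain ⟨h1', h2'⟩ := hf' P hP
  rw [h2, h2']
  refine germ_eq_of_forall hS h1 h1' hP fun Q hQ => ?_
  have := h Q hQ
  obtain ⟨k1, k2⟩ := hf Q hQ
  obtain ⟨k1', k2'⟩ := hf' Q hQ
  rwa [k2, k2'] at this

theorem const (c : ℝ) : IsFamily S (fun _ _ => SmoothGerm.const c) :=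
  ⟨fun _ => c, fun _ _ => ⟨contDiffAt_const, rfl⟩⟩

end IsFamily

section families

variable (hΦ : IsPointTransformation Φ)

theorem isFamily_gT : IsFamily Φ.source (fun _ hP => hΦ.gT hP) := ⟨_, fun _ _ => ⟨_, rfl⟩⟩
theorem isFamily_gX : IsFamily Φ.source (fun _ hP => hΦ.gX hP) := ⟨_, fun _ _ => ⟨_, rfl⟩⟩
theorem isFamily_gY : IsFamily Φ.source (fun _ hP => hΦ.gY hP) := ⟨_, fun _ _ => ⟨_, rfl⟩⟩
theorem isFamily_gU : IsFamily Φ.source (fun _ hP => hΦ.gU hP) := ⟨_, fun _ _ => ⟨_, rfl⟩⟩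

theorem SmoothGerm.D_mk_continuousLinearMap {E : Type*} [NormedAddCommGroup E] [NormedSpace ℝ E]
    {x : E} (l : E →L[ℝ] ℝ) (w : E) (h : ContDiffAt ℝ ∞ l x) :
    D w (SmoothGerm.mk l h) = const (l w) := by
  rw [D_mk]
  change _ = SmoothGerm.mk (fun _ => l w) contDiffAt_const
  rw [mk_eq_mk]
  exact Eventually.of_forall fun q => by simp

theorem contDiffAt_time {f : ℝ → ℝ} (hf : ContDiffAt ℝ ∞ f P.1.1) :
    ContDiffAt ℝ ∞ (fun Q : VarSpace => f Q.1.1) P :=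
  ContDiffAt.comp (g := f) (f := fun Q : VarSpace => Q.1.1) P hf contDiffAt_fst.fst

/-- The germ of the variable `x`. -/
def coordX (P : VarSpace) : SmoothGerm P :=
  SmoothGerm.mk (fun Q : VarSpace => Q.1.2.1) contDiffAt_fst.snd.fst

/-- The germ of the variable `y`. -/
def coordY (P : VarSpace) : SmoothGerm P :=
  SmoothGerm.mk (fun Q : VarSpace => Q.1.2.2) contDiffAt_fst.snd.snd

theorem isFamily_coordX {S : Set VarSpace} : IsFamily S (fun P _ => coordX P) :=
  ⟨_, fun _ _ => ⟨_, rfl⟩⟩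

theorem isFamily_coordY {S : Set VarSpace} : IsFamily S (fun P _ => coordY P) :=
  ⟨_, fun _ _ => ⟨_, rfl⟩⟩

theorem ev_coordX (P : VarSpace) : ev (coordX P) = P.1.2.1 := rfl

theorem ev_coordY (P : VarSpace) : ev (coordY P) = P.1.2.2 := rfl

theorem D_coordX (P w : VarSpace) : D w (coordX P) = const w.1.2.1 :=
  SmoothGerm.D_mk_continuousLinearMap
    ((ContinuousLinearMap.fst ℝ ℝ ℝ).comp ((ContinuousLinearMap.snd ℝ ℝ (ℝ × ℝ)).comp
      (ContinuousLinearMap.fst ℝ IndepSpace ℝ))) w contDiffAt_fst.snd.fst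

theorem D_coordY (P w : VarSpace) : D w (coordY P) = const w.1.2.2 :=
  SmoothGerm.D_mk_continuousLinearMap
    ((ContinuousLinearMap.snd ℝ ℝ ℝ).comp ((ContinuousLinearMap.snd ℝ ℝ (ℝ × ℝ)).comp
      (ContinuousLinearMap.fst ℝ IndepSpace ℝ))) w contDiffAt_fst.snd.snd

/-- The germ of the dependent variable `u`. -/
def coordU (P : VarSpace) : SmoothGerm P := SmoothGerm.mk (fun Q => Q.2) contDiffAt_snd

theorem isFamily_coordU {S : Set VarSpace} : IsFamily S (fun P _ => coordU P) :=
  ⟨_, fun _ _ => ⟨_, rfl⟩⟩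

theorem D_coordU (P w : VarSpace) : D w (coordU P) = const w.2 :=
  SmoothGerm.D_mk_continuousLinearMap (ContinuousLinearMap.snd ℝ IndepSpace ℝ) w contDiffAt_snd

theorem isFamily_timeGerm {S : Set VarSpace}
    (hσ : ∀ P ∈ S, ContDiffAt ℝ ∞ σ P.1.1) :
    IsFamily S (fun P hP => timeGerm (hσ P hP)) := ⟨_, fun _ _ => ⟨_, rfl⟩⟩

end families

end Identities

/-! ### Consequences of the determining equations -/

section Identities

variable {Φ : OpenPartialHomeomorph VarSpace VarSpace} {P : VarSpace} {σ σ' : ℝ → ℝ}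

/-- Apart from the comparison of coefficients, this uses differential consequences: `T_t = X_x²`
with `T = T(t)` gives `X_xx = X_xy = 0`, and the formula for `U` determines the derivatives of `U`. -/
theorem MapsEquation.isNormalized (hm : MapsEquation σ σ' Φ) (hΦ : IsPointTransformation Φ)
    (hσ : ∀ P ∈ Φ.source, σ P.1.1 ≠ 0) (hσs : ∀ P ∈ Φ.source, ContDiffAt ℝ ∞ σ P.1.1) :
    IsNormalized hΦ σ σ' := by
  have hA := hm.isAffine hΦ hσ
  have hS := Φ.open_source
  -- the coefficients, for an arbitrary inverse of `U_u`
  have sys := fun P (hP : P ∈ Φ.source) (A B : SmoothGerm P.1)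
      (hAA : A * restr P (D eU (hΦ.gU hP)) = 1) (hBB : B = const P.2 - A * restr P (hΦ.gU hP)) =>
    determining_equations (φ := pull (fun q => (Φ (q, P.2)).1)
      (contDiffAt_image_graph (u := fun _ => P.2) hΦ contDiffAt_const hP).fst rfl)
      (τ := restr P (hΦ.gT hP)) (χ := restr P (hΦ.gX hP)) (η := restr P (hΦ.gY hP))
      (fun w g => D_pull_indep w g) ev_pull
      (by rw [D_restr, hA.T_x, map_zero]) (by rw [D_restr, hA.T_y, map_zero])
      (by rw [D_restr, hA.Y_x, map_zero]) (σ P.1.1) (σ' (Φ P).1.1) (Φ P).2 A B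
      (by
        intro h0
        have := congrArg ev hAA
        rw [map_mul, h0, zero_mul, map_one] at this
        exact zero_ne_one this)
      (hA.gkzkOp_preimage_eq_zero hm hP A B hAA hBB)
  have nX := fun P (hP : P ∈ Φ.source) => hA.X_x_ne_zero hP
  have nU := fun P (hP : P ∈ Φ.source) => hA.U_u_ne_zero hP
  have fX := isFamily_gX hΦ
  have fT := isFamily_gT hΦ
  have fY := isFamily_gY hΦ
  have fU := isFamily_gU hΦ
  have fS := isFamily_timeGerm hσs
  have vT_eq : ∀ P, ∀ hP : P ∈ Φ.source, ev (D vT (hΦ.gT hP)) = ev (D vX (hΦ.gX hP)) ^ 2 := by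
    intro P hP
    obtain ⟨A, hAA⟩ := exists_inv (g := restr P (D eU (hΦ.gU hP))) (by simpa using nU P hP)
    have := (sys P hP A _ hAA rfl).1
    simp only [D_restr, ev_restr] at this
    exact mul_left_cancel₀ (nX P hP) (by linear_combination this)
  have vU_eq : ∀ P, ∀ hP : P ∈ Φ.source, ev (D eU (hΦ.gU hP)) * ev (D vX (hΦ.gX hP)) = 1 := by
    intro P hP
    obtain ⟨A, hAA⟩ := exists_inv (g := restr P (D eU (hΦ.gU hP))) (by simpa using nU P hP)
    have := (sys P hP A _ hAA rfl).2.2.2.1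
    simp only [D_restr, ev_restr] at this
    have h1 := congrArg ev hAA
    simp only [map_mul, ev_restr, map_one] at h1
    have h2 : ev A = ev (D vX (hΦ.gX hP)) :=
      mul_right_cancel₀ (pow_ne_zero 2 (nX P hP)) (by linear_combination this)
    rw [← h2, mul_comm]
    exact h1
  have gT : ∀ P, ∀ hP : P ∈ Φ.source,
      D vT (hΦ.gT hP) = D vX (hΦ.gX hP) * D vX (hΦ.gX hP) := fun P hP =>
    (fT.D vT).eq_of_ev_eq hS ((fX.D vX).mul (fX.D vX))
      (fun P hP => by rw [vT_eq P hP, map_mul]; ring) hP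
  have gU : ∀ P, ∀ hP : P ∈ Φ.source,
      D vX (hΦ.gX hP) * D eU (hΦ.gU hP) = 1 := fun P hP => by
    have := ((fX.D vX).mul (fU.D eU)).eq_of_ev_eq hS (IsFamily.const 1)
      (fun P hP => by rw [map_mul, mul_comm, vU_eq P hP]; rfl) hP
    rw [this, map_one]
  -- differentiate `T_t = X_x²` in a direction in which `T` is constant
  have gXw : ∀ P, ∀ hP : P ∈ Φ.source, ∀ w, D w (hΦ.gT hP) = 0 → D w (D vX (hΦ.gX hP)) = 0 := by
    intro P hP w hw
    have h1 := congrArg (D w) (gT P hP)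
    rw [D_comm, hw, map_zero, D_mul] at h1
    refine eq_zero_of_mul_eq_zero (nX P hP) (eq_zero_of_mul_eq_zero (a := const 2) ?_ ?_)
    · rw [ev_const]
      norm_num
    · rw [map_ofNat, two_mul]
      exact h1.symm
  have gXx := fun P hP => gXw P hP vX (hA.T_x P hP)
  have gXy := fun P hP => gXw P hP vY (hA.T_y P hP)
  -- the remaining equations, with `A = X_x`
  have sysX : ∀ P, ∀ hP : P ∈ Φ.source, _ := fun P hP => sys P hP (restr P (D vX (hΦ.gX hP)))
    (const P.2 - restr P (D vX (hΦ.gX hP)) * restr P (hΦ.gU hP))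
    (by rw [← map_mul, gU P hP, map_one]) rfl
  have hvT : ((_root_.eT, 0) : VarSpace) = vT := rfl
  have hvX : ((_root_.eX, 0) : VarSpace) = vX := rfl
  have hvY : ((_root_.eY, 0) : VarSpace) = vY := rfl
  simp only [D_restr, hvT, hvX, hvY, ev_restr, map_sub, map_neg, map_add, map_mul, ev_const,
    D_mul, D_const, gXx, gXy, map_zero, mul_zero, zero_mul, add_zero, zero_add, zero_sub] at sysX
  have nσ := hσ
  -- the coefficient of `v_y`
  have vYyy : ∀ P, ∀ hP : P ∈ Φ.source, D vY (D vY (hΦ.gY hP)) = 0 := fun P hP => by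
    have := ((fY.D vY).D vY).eq_of_ev_eq hS (IsFamily.const 0) (fun P hP => by
      obtain ⟨-, -, -, -, -, -, -, h⟩ := sysX P hP
      simpa [nσ P hP, nX P hP] using h) hP
    rw [this, map_zero]
  -- the coefficient of `v_xy`
  have gY : ∀ P, ∀ hP : P ∈ Φ.source, D vX (hΦ.gX hP) * D vT (hΦ.gY hP)
      + const 2 * timeGerm (hσs P hP) * D vY (hΦ.gX hP) * D vY (hΦ.gY hP) = 0 := fun P hP => by
    have := (((fX.D vX).mul (fY.D vT)).add ((((IsFamily.const 2).mul fS).mul (fX.D vY)).mul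
      (fY.D vY))).eq_of_ev_eq hS (IsFamily.const 0) (fun P hP => by
      obtain ⟨-, -, h, -⟩ := sysX P hP
      simpa [timeGerm] using h) hP
    rw [this, map_zero]
  -- the coefficient of `v_xx`
  have vU : ∀ P, ∀ hP : P ∈ Φ.source, ev (hΦ.gU hP) * ev (D vX (hΦ.gX hP)) ^ 3
    = ev (D vX (hΦ.gX hP)) * ev (D vT (hΦ.gX hP)) + σ P.1.1 * ev (D vY (hΦ.gX hP)) ^ 2
      + P.2 * ev (D vX (hΦ.gX hP)) ^ 2 := fun P hP => by
    obtain ⟨-, -, -, -, h, -⟩ := sysX P hP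
    have e : ev (hΦ.gU hP) = (Φ P).2 := rfl
    rw [← e] at h
    exact mul_left_cancel₀ (nX P hP) (by linear_combination -h)
  have gUeq : ∀ P, ∀ hP : P ∈ Φ.source,
      hΦ.gU hP * D vX (hΦ.gX hP) * D vX (hΦ.gX hP) * D vX (hΦ.gX hP)
      = D vX (hΦ.gX hP) * D vT (hΦ.gX hP)
        + timeGerm (hσs P hP) * D vY (hΦ.gX hP) * D vY (hΦ.gX hP)
        + coordU P * D vX (hΦ.gX hP) * D vX (hΦ.gX hP) := fun P hP => by
    refine (((fU.mul (fX.D vX)).mul (fX.D vX)).mul (fX.D vX)).eq_of_ev_eq hS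
      ((((fX.D vX).mul (fX.D vT)).add ((fS.mul (fX.D vY)).mul (fX.D vY))).add
        ((isFamily_coordU.mul (fX.D vX)).mul (fX.D vX))) (fun P hP => ?_) hP
    simp only [map_mul, map_add, timeGerm, coordU, ev_mk]
    linear_combination vU P hP
  have cXt : ∀ P, ∀ hP : P ∈ Φ.source, D vX (D vT (hΦ.gX hP)) = D vT (D vX (hΦ.gX hP)) :=
    fun P hP => D_comm _ _ _
  have cXy : ∀ P, ∀ hP : P ∈ Φ.source, D vX (D vY (hΦ.gX hP)) = 0 :=
    fun P hP => (D_comm _ _ _).trans (gXy P hP)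
  have sx : ∀ (P : VarSpace) (h : ContDiffAt ℝ ∞ σ P.1.1), D vX (timeGerm h) = 0 :=
    fun P h => D_timeGerm_of_eq_zero h rfl
  have sy : ∀ (P : VarSpace) (h : ContDiffAt ℝ ∞ σ P.1.1), D vY (timeGerm h) = 0 :=
    fun P h => D_timeGerm_of_eq_zero h rfl
  have ux : ∀ P : VarSpace, D vX (coordU P) = 0 :=
    fun P => (D_coordU P vX).trans (map_zero _)
  have uy : ∀ P : VarSpace, D vY (coordU P) = 0 :=
    fun P => (D_coordU P vY).trans (map_zero _)
  -- differentiate the formula for `U` along `x`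
  have gUx : ∀ P, ∀ hP : P ∈ Φ.source,
      D vX (hΦ.gU hP) * D vX (hΦ.gX hP) * D vX (hΦ.gX hP) = D vT (D vX (hΦ.gX hP)) :=
    fun P hP => by
    have h := congrArg (D vX) (gUeq P hP)
    simp only [map_add, D_mul, gXx, cXt, cXy, sx, ux, mul_zero, add_zero, zero_add] at h
    exact sub_eq_zero.1 (eq_zero_of_mul_eq_zero (nX P hP) (by linear_combination h))
  -- the coefficient of `v_x`
  have vXyy : ∀ P, ∀ hP : P ∈ Φ.source, D vY (D vY (hΦ.gX hP)) = 0 := fun P hP => by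
    have := ((fX.D vY).D vY).eq_of_ev_eq hS (IsFamily.const 0) (fun P hP => by
      obtain ⟨-, -, -, -, -, h, -⟩ := sysX P hP
      have h1 := congrArg ev (gUx P hP)
      simp only [map_mul] at h1
      rw [map_zero, map_zero]
      refine (mul_eq_zero.1 ?_).resolve_left (mul_ne_zero (nσ P hP) (nX P hP))
      linear_combination h + 2 * ev (D vX (hΦ.gX hP)) * h1) hP
    rw [this, map_zero]
  -- differentiate the coefficient of `v_xy` along `y`
  have vYty : ∀ P, ∀ hP : P ∈ Φ.source, D vT (D vY (hΦ.gY hP)) = 0 := fun P hP => by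
    have h := congrArg (D vY) (gY P hP)
    simp only [map_add, D_mul, D_const, map_zero, gXy, vXyy, vYyy, sy, mul_zero,
      add_zero] at h
    rw [D_comm]
    exact eq_zero_of_mul_eq_zero (nX P hP) h
  have gUxx : ∀ P, ∀ hP : P ∈ Φ.source, D vX (D vX (hΦ.gU hP)) = 0 := fun P hP => by
    have h := congrArg (D vX) (gUx P hP)
    rw [D_comm vX vT] at h
    simp only [D_mul, gXx, map_zero, mul_zero, zero_add] at h
    exact eq_zero_of_mul_eq_zero (nX P hP) (eq_zero_of_mul_eq_zero (nX P hP)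
      (by linear_combination h))
  have gUyy : ∀ P, ∀ hP : P ∈ Φ.source, D vY (D vY (hΦ.gU hP)) = 0 := fun P hP => by
    have h := congrArg (fun g => D vY (D vY g)) (gUeq P hP)
    have c : D vY (D vT (hΦ.gX hP)) = D vT (D vY (hΦ.gX hP)) := D_comm _ _ _
    have c' : D vY (D vT (D vY (hΦ.gX hP))) = 0 := by rw [D_comm, vXyy, map_zero]
    simp only [map_add, D_mul, gXy, vXyy, sy, uy, c, c', mul_zero, add_zero,
      zero_add] at h
    exact eq_zero_of_mul_eq_zero (nX P hP) (eq_zero_of_mul_eq_zero (nX P hP)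
      (eq_zero_of_mul_eq_zero (nX P hP) (by linear_combination h)))
  -- the coefficient of `1`, the only remaining one, reduces to the equation for `X_xtt`
  refine ⟨hA, gXx, gXy, vXyy, vYyy, vYty, gT, fun P hP => (sysX P hP).2.1,
    fun P hP => (sysX P hP).2.2.1, vU, fun P hP => ?_⟩
  obtain ⟨-, -, -, -, -, -, h, -⟩ := sysX P hP
  have h1 := congrArg ev (gUx P hP)
  have h2 := congrArg (fun g => ev (D vT g)) (gUx P hP)
  simp only [map_mul, map_add, D_mul] at h1 h2
  simp only [gUxx, gUyy, map_zero, mul_zero, add_zero, neg_zero] at h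
  rw [← h2, ← h1]
  rw [← h1] at h
  linear_combination -(ev (D vX (hΦ.gX hP)) ^ 2) * h

end Identities

/-! ### The explicit family -/

namespace GroupParam

variable {g : GroupParam} {σ : ℝ → ℝ} {t : ℝ} {J : Set ℝ}

/-- `∂x'/∂x` for the transformation with parameters `g`. -/
def scale (g : GroupParam) (t : ℝ) : ℝ := g.ε * √g.Δ / (g.c * t + g.d)

/-- `∂x'/∂y` for the transformation with parameters `g`. -/
def shear (g : GroupParam) (σ : ℝ → ℝ) (t : ℝ) : ℝ :=
  -(g.scale t * deriv g.Y₀ t) / (2 * g.Y₁ * σ t)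

theorem xNew_eq (x y : ℝ) : g.xNew σ t x y = g.scale t * x + g.shear σ t * y + g.β₀ t := by
  rw [xNew, shear, scale, ← div_div (deriv g.Y₀ t)]
  ring

theorem Valid.sq_ε (h : g.Valid J) : g.ε ^ 2 = 1 := by
  rcases h.sign with h | h <;> rw [h] <;> norm_num

theorem Valid.sqrt_ne_zero (h : g.Valid J) : √g.Δ ≠ 0 := (Real.sqrt_pos.2 h.Δ_pos).ne'

theorem Valid.ε_ne_zero (h : g.Valid J) : g.ε ≠ 0 := fun h0 => by
  have := h.sq_ε
  rw [h0] at this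
  norm_num at this

theorem Valid.scale_ne_zero (h : g.Valid J) (ht : t ∈ J) : g.scale t ≠ 0 :=
  div_ne_zero (mul_ne_zero h.ε_ne_zero h.sqrt_ne_zero) (h.denom_ne_zero t ht)

theorem Valid.scale_sq (h : g.Valid J) (t : ℝ) : g.scale t ^ 2 = g.Δ / (g.c * t + g.d) ^ 2 := by
  rw [scale, div_pow, mul_pow, h.sq_ε, one_mul, Real.sq_sqrt h.Δ_pos.le]

theorem Valid.hasDerivAt_T (h : g.Valid J) (ht : t ∈ J) : HasDerivAt g.T (g.scale t ^ 2) t := by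
  have h0 := h.denom_ne_zero t ht
  have h1 : HasDerivAt (fun t => g.a * t + g.b) g.a t := by
    simpa using ((hasDerivAt_id t).const_mul g.a).add_const g.b
  have h2 : HasDerivAt (fun t => g.c * t + g.d) g.c t := by
    simpa using ((hasDerivAt_id t).const_mul g.c).add_const g.d
  refine (h1.div h2 h0).congr_deriv ?_
  rw [h.scale_sq, Δ]
  field_simp
  ring

theorem Valid.hasDerivAt_scale (h : g.Valid J) (ht : t ∈ J) :
    HasDerivAt g.scale (-(g.c / (g.c * t + g.d)) * g.scale t) t := by
  have h0 := h.denom_ne_zero t ht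
  have h2 : HasDerivAt (fun t => g.c * t + g.d) g.c t := by
    simpa using ((hasDerivAt_id t).const_mul g.c).add_const g.d
  refine ((hasDerivAt_const t (g.ε * √g.Δ)).div h2 h0).congr_deriv ?_
  rw [scale]
  field_simp
  ring

theorem Valid.contDiffAt_T (h : g.Valid J) (ht : t ∈ J) : ContDiffAt ℝ ∞ g.T t :=
  ((contDiffAt_const.mul contDiffAt_id).add contDiffAt_const).div
    ((contDiffAt_const.mul contDiffAt_id).add contDiffAt_const) (h.denom_ne_zero t ht)

theorem Valid.contDiffAt_scale (h : g.Valid J) (ht : t ∈ J) : ContDiffAt ℝ ∞ g.scale t :=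
  contDiffAt_const.div
    ((contDiffAt_const.mul contDiffAt_id).add contDiffAt_const) (h.denom_ne_zero t ht)

theorem _root_.contDiffAt_deriv {f : ℝ → ℝ} (hf : ContDiffAt ℝ ∞ f t) :
    ContDiffAt ℝ ∞ (deriv f) t := by
  have := contDiffAt_fderiv_apply hf 1
  exact this

theorem Valid.contDiffAt_Y₀ (h : g.Valid J) (hJ : IsOpen J) (ht : t ∈ J) :
    ContDiffAt ℝ ∞ g.Y₀ t := h.smooth_Y₀.contDiffAt (hJ.mem_nhds ht)

theorem Valid.contDiffAt_β₀ (h : g.Valid J) (hJ : IsOpen J) (ht : t ∈ J) :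
    ContDiffAt ℝ ∞ g.β₀ t := h.smooth_β₀.contDiffAt (hJ.mem_nhds ht)

theorem Valid.contDiffAt_shear (h : g.Valid J) (hJ : IsOpen J) (ht : t ∈ J)
    (hσ : ContDiffAt ℝ ∞ σ t) (h0 : σ t ≠ 0) : ContDiffAt ℝ ∞ (g.shear σ) t :=
  ((h.contDiffAt_scale ht).mul (contDiffAt_deriv (h.contDiffAt_Y₀ hJ ht))).neg.div
    (contDiffAt_const.mul hσ) (mul_ne_zero (mul_ne_zero two_ne_zero h.Y₁_ne_zero) h0)

theorem Valid.deriv_shear (h : g.Valid J) (hJ : IsOpen J) (ht : t ∈ J)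
    (hσ : ContDiffAt ℝ ∞ σ t) (h0 : σ t ≠ 0) : deriv (g.shear σ) t = -g.scale t *
      (1 / (2 * g.Y₁) * (deriv (deriv g.Y₀) t / σ t - g.c / (g.c * t + g.d) * (deriv g.Y₀ t / σ t)
          - deriv g.Y₀ t * deriv σ t / σ t ^ 2)) := by
  have h1 := (contDiffAt_deriv (h.contDiffAt_Y₀ hJ ht)).differentiableAt (by simp)
  have h2 := hσ.differentiableAt (by simp)
  have h3 := h.Y₁_ne_zero
  have h4 := h.denom_ne_zero t ht
  have := (((h.hasDerivAt_scale ht).mul h1.hasDerivAt).neg.div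
    (h2.hasDerivAt.const_mul (2 * g.Y₁)) (mul_ne_zero (mul_ne_zero two_ne_zero h3) h0)).deriv
  refine Eq.trans this ?_
  simp only [Pi.mul_apply, Pi.neg_apply]
  field_simp
  ring

/-- The formula for `u` in terms of the coefficients of `x'`: the coefficient of `y` is
`-(∂/∂t shear) / scale`. -/
theorem Valid.uOld_eq (h : g.Valid J) (hJ : IsOpen J) (ht : t ∈ J)
    (hσ : ContDiffAt ℝ ∞ σ t) (h0 : σ t ≠ 0) (x y u : ℝ) :
    g.uOld σ t x y u = g.scale t * u + (g.c / (g.c * t + g.d) * x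
      - deriv (g.shear σ) t / g.scale t * y
      - σ t * g.shear σ t ^ 2 / g.scale t ^ 2 - deriv g.β₀ t / g.scale t) := by
  have h1 := h.scale_ne_zero ht
  have h2 := h.Y₁_ne_zero
  have h3 : deriv (g.shear σ) t / g.scale t = -(1 / (2 * g.Y₁) * (deriv (deriv g.Y₀) t / σ t
      - g.c / (g.c * t + g.d) * (deriv g.Y₀ t / σ t) - deriv g.Y₀ t * deriv σ t / σ t ^ 2)) := by
    rw [h.deriv_shear hJ ht hσ h0]
    field_simp
  have h4 : σ t * g.shear σ t ^ 2 / g.scale t ^ 2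
      = 1 / (4 * g.Y₁ ^ 2) * (deriv g.Y₀ t ^ 2 / σ t) := by
    rw [shear]
    field_simp
    ring
  have h5 : deriv g.β₀ t / g.scale t = g.ε / √g.Δ * (g.c * t + g.d) * deriv g.β₀ t := by
    have h6 := h.sqrt_ne_zero
    have h7 := h.denom_ne_zero t ht
    have h8 := h.ε_ne_zero
    have h9 := h.sq_ε
    rw [scale]
    field_simp
    rw [h9, mul_one]
  rw [h3, h4, h5, uOld, scale]
  ring

/-- The transformation of the coefficient, without fractional powers. -/
theorem Valid.coeff_iff (h : g.Valid J) (ht : t ∈ J) (s s' : ℝ) :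
    s' = g.ε * g.Δ ^ (-(3 / 2) : ℝ) * g.Y₁ ^ 2 * (g.c * t + g.d) ^ 3 * s ↔
      s * g.Y₁ ^ 2 = s' * g.scale t ^ 3 := by
  have h0 : g.Δ ^ (-(3 / 2) : ℝ) = (√g.Δ ^ 3)⁻¹ := by
    rw [Real.rpow_neg h.Δ_pos.le, Real.sqrt_eq_rpow, ← Real.rpow_natCast,
      ← Real.rpow_mul h.Δ_pos.le]
    norm_num
  have h6 := h.sqrt_ne_zero
  have h7 := h.denom_ne_zero t ht
  have h8 := h.ε_ne_zero
  have h9 := h.sq_ε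
  rw [h0, scale, div_pow, mul_pow]
  field_simp
  constructor
  · intro e
    linear_combination (-g.ε ^ 3) * e - s * g.Y₁ ^ 2 * (g.c * t + g.d) ^ 3 * (g.ε ^ 2 + 1) * h9
  · intro e
    linear_combination (-g.ε) * e - s' * √g.Δ ^ 3 * (g.ε ^ 2 + 1) * h9

end GroupParam

section TimeGerms

variable {P : VarSpace} {f : ℝ → ℝ}

theorem D_timeGerm_vT (hf : ContDiffAt ℝ ∞ f P.1.1) :
    D vT (timeGerm hf) = timeGerm (contDiffAt_deriv hf) := by
  rw [timeGerm, D_mk, timeGerm, mk_eq_mk]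
  have h1 : Tendsto (fun Q : VarSpace => Q.1.1) (𝓝 P) (𝓝 P.1.1) :=
    (continuous_fst.comp continuous_fst).tendsto P
  filter_upwards [h1.eventually (eventually_differentiableAt hf)] with Q hQ
  have h2 : HasFDerivAt (fun Q : VarSpace => Q.1.1)
      ((ContinuousLinearMap.fst ℝ ℝ (ℝ × ℝ)).comp (ContinuousLinearMap.fst ℝ IndepSpace ℝ)) Q :=
    hasFDerivAt_fst.fst
  have := (hQ.hasFDerivAt.comp Q h2).fderiv
  change fderiv ℝ (f ∘ fun Q : VarSpace => Q.1.1) Q vT = _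
  rw [this]
  rfl

theorem ev_timeGerm (hf : ContDiffAt ℝ ∞ f P.1.1) : ev (timeGerm hf) = f P.1.1 := rfl

end TimeGerms

/-! ### The transformations of the family preserve the class -/

section Converse

variable {Φ : OpenPartialHomeomorph VarSpace VarSpace} {σ σ' : ℝ → ℝ} {g : GroupParam}

theorem isOpen_timeRange {D : Set VarSpace} (hD : IsOpen D) : IsOpen (timeRange D) :=
  (isOpenMap_fst.comp isOpenMap_fst) D hD

theorem D_restr_timeGerm {P : VarSpace} {f : ℝ → ℝ} (hf : ContDiffAt ℝ ∞ f P.1.1) :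
    D _root_.eT (restr P (timeGerm hf)) = restr P (timeGerm (contDiffAt_deriv hf)) ∧
    D _root_.eX (restr P (timeGerm hf)) = 0 ∧ D _root_.eY (restr P (timeGerm hf)) = 0 := by
  refine ⟨?_, ?_, ?_⟩
  · rw [D_restr]
    exact congrArg _ (D_timeGerm_vT hf)
  · rw [D_restr, D_timeGerm_of_eq_zero hf rfl, map_zero]
  · rw [D_restr, D_timeGerm_of_eq_zero hf rfl, map_zero]

/-- The transformations of the explicit family map equations of the class to each other: they
multiply the left-hand side of the equation by the fourth power of `∂x'/∂x`. -/
theorem GroupParam.Realizes.mapsEquation (h : g.Realizes σ σ' Φ) (hΦ : IsPointTransformation Φ)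
    (hσ : ∀ P ∈ Φ.source, σ P.1.1 ≠ 0) (hσs : ∀ P ∈ Φ.source, ContDiffAt ℝ ∞ σ P.1.1) :
    MapsEquation σ σ' Φ := by
  intro u v p hp hu hv hT
  -- near `p`, `u = A v + B`, with explicit germs `A`, `B` and new independent variables `τ`, `χ`, `η`
  have hJ := isOpen_timeRange Φ.open_source
  have hV := h.valid
  have hmem : ∀ Q ∈ Φ.source, Q.1.1 ∈ timeRange Φ.source := fun Q hQ => ⟨Q, hQ, rfl⟩
  set P : VarSpace := (p, u p) with hPdef
  have ht := hmem P hp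
  have s1 : ContDiffAt ℝ ∞ g.T P.1.1 := hV.contDiffAt_T ht
  have s2 : ContDiffAt ℝ ∞ g.scale P.1.1 := hV.contDiffAt_scale ht
  have s3 : ContDiffAt ℝ ∞ (g.shear σ) P.1.1 := hV.contDiffAt_shear hJ ht (hσs P hp) (hσ P hp)
  have s4 : ContDiffAt ℝ ∞ g.Y₀ P.1.1 := hV.contDiffAt_Y₀ hJ ht
  have s5 : ContDiffAt ℝ ∞ g.β₀ P.1.1 := hV.contDiffAt_β₀ hJ ht
  have n1 := hV.scale_ne_zero ht
  have n2 := hV.denom_ne_zero _ ht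
  have s6 : ContDiffAt ℝ ∞ (fun t => g.c / (g.c * t + g.d)) P.1.1 :=
    contDiffAt_const.div ((contDiffAt_const.mul contDiffAt_id).add contDiffAt_const) n2
  have s7 : ContDiffAt ℝ ∞ (fun t => -(deriv (g.shear σ) t / g.scale t)) P.1.1 :=
    ((contDiffAt_deriv s3).div s2 n1).neg
  have s8 : ContDiffAt ℝ ∞ (fun t => -(σ t * g.shear σ t ^ 2 / g.scale t ^ 2)
      - deriv g.β₀ t / g.scale t) P.1.1 :=
    (((hσs P hp).mul (s3.pow 2)).div (s2.pow 2) (pow_ne_zero 2 n1)).neg.sub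
      ((contDiffAt_deriv s5).div s2 n1)
  have e1 : deriv g.T P.1.1 = g.scale P.1.1 ^ 2 := (hV.hasDerivAt_T ht).deriv
  have e2 : deriv g.scale P.1.1 = -(g.c / (g.c * P.1.1 + g.d)) * g.scale P.1.1 :=
    (hV.hasDerivAt_scale ht).deriv
  have e6 : deriv (fun t => g.c / (g.c * t + g.d)) P.1.1 = -(g.c / (g.c * P.1.1 + g.d)) ^ 2 := by
    have h2 : HasDerivAt (fun t => g.c * t + g.d) g.c P.1.1 := by
      simpa using ((hasDerivAt_id P.1.1).const_mul g.c).add_const g.d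
    refine ((hasDerivAt_const P.1.1 g.c).div h2 n2).deriv.trans ?_
    field_simp
    ring
  have hmemn : ∀ᶠ q in 𝓝 p, (q, u q) ∈ Φ.source := eventually_graph_mem hu Φ.open_source hp
  have hK := (contDiffAt_image_graph hΦ hu hp).fst
  set φ := pull (fun q => (Φ (q, u q)).1) hK rfl with hφ
  set V := SmoothGerm.mk v hv with hVdef
  set X : SmoothGerm p := const p.2.1 + cX p with hX
  set Y : SmoothGerm p := const p.2.2 + cY p with hY
  set τ := restr P (timeGerm s1) with hτ
  set χ := restr P (timeGerm s2) * X + restr P (timeGerm s3) * Y + restr P (timeGerm s5) with hχ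
  set η := const g.Y₁ * Y + restr P (timeGerm s4) with hη
  set A := restr P (timeGerm s2) with hA
  set B := restr P (timeGerm s6) * X + restr P (timeGerm s7) * Y + restr P (timeGerm s8) with hB
  have c : ∀ {f : ℝ → ℝ}, ContDiffAt ℝ ∞ f P.1.1 → ContDiffAt ℝ ∞ (fun q : IndepSpace => f q.1) p :=
    fun {f} hf => ContDiffAt.comp (g := f) p hf contDiffAt_fst
  have cx : ContDiffAt ℝ ∞ (fun q : IndepSpace => p.2.1 + (q.2.1 - p.2.1)) p := by fun_prop
  have cy : ContDiffAt ℝ ∞ (fun q : IndepSpace => p.2.2 + (q.2.2 - p.2.2)) p := by fun_prop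
  have kτ : SmoothGerm.mk _ hK.fst = τ := by
    change _ = SmoothGerm.mk (fun q : IndepSpace => g.T q.1) (c s1)
    rw [mk_eq_mk]
    filter_upwards [hmemn] with q hq using h.t_eq _ _ _ _ hq
  have kχ : SmoothGerm.mk _ hK.snd.fst = χ := by
    change _ = SmoothGerm.mk (fun q : IndepSpace => g.scale q.1 * (p.2.1 + (q.2.1 - p.2.1))
      + g.shear σ q.1 * (p.2.2 + (q.2.2 - p.2.2)) + g.β₀ q.1)
      ((((c s2).mul cx).add ((c s3).mul cy)).add (c s5))
    rw [mk_eq_mk]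
    filter_upwards [hmemn] with q hq
    rw [h.x_eq _ _ _ _ hq, GroupParam.xNew_eq]
    ring
  have kη : SmoothGerm.mk _ hK.snd.snd = η := by
    change _ = SmoothGerm.mk (fun q : IndepSpace => g.Y₁ * (p.2.2 + (q.2.2 - p.2.2)) + g.Y₀ q.1)
      ((contDiffAt_const.mul cy).add (c s4))
    rw [mk_eq_mk]
    filter_upwards [hmemn] with q hq
    rw [h.y_eq _ _ _ _ hq]
    ring
  have kU : SmoothGerm.mk u hu = A * φ V + B := by
    change _ = SmoothGerm.mk (fun q : IndepSpace => g.scale q.1 * v (Φ (q, u q)).1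
      + (g.c / (g.c * q.1 + g.d) * (p.2.1 + (q.2.1 - p.2.1))
        + -(deriv (g.shear σ) q.1 / g.scale q.1) * (p.2.2 + (q.2.2 - p.2.2))
        + (-(σ q.1 * g.shear σ q.1 ^ 2 / g.scale q.1 ^ 2) - deriv g.β₀ q.1 / g.scale q.1)))
      (((c s2).mul (hv.comp p hK)).add ((((c s6).mul cx).add ((c s7).mul cy)).add (c s8)))
    rw [mk_eq_mk]
    filter_upwards [hmemn, hT] with q hq hq'
    rw [← hq']
    have hq0 := h.u_eq _ _ _ _ hq
    rw [hV.uOld_eq hJ (hmem _ hq) (hσs _ hq) (hσ _ hq)] at hq0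
    simp only [Prod.mk.eta] at hq0
    refine hq0.trans ?_
    ring
  have hφD : ∀ w f, D w (φ f)
      = φ (D _root_.eT f) * D w τ + φ (D _root_.eX f) * D w χ + φ (D _root_.eY f) * D w η := by
    intro w f
    rw [← kτ, ← kχ, ← kη]
    exact D_pull_indep w f
  obtain ⟨tT, xT, yT⟩ : D _root_.eT τ = restr P (timeGerm (contDiffAt_deriv s1)) ∧
    D _root_.eX τ = 0 ∧ D _root_.eY τ = 0 := D_restr_timeGerm s1
  obtain ⟨tA, xA, yA⟩ : D _root_.eT A = restr P (timeGerm (contDiffAt_deriv s2)) ∧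
    D _root_.eX A = 0 ∧ D _root_.eY A = 0 := D_restr_timeGerm s2
  obtain ⟨tS, xS, yS⟩ := D_restr_timeGerm s3
  obtain ⟨tY, xY, yY⟩ := D_restr_timeGerm s4
  obtain ⟨tb, xb, yb⟩ := D_restr_timeGerm s5
  obtain ⟨t6, x6, y6⟩ := D_restr_timeGerm s6
  obtain ⟨t7, x7, y7⟩ := D_restr_timeGerm s7
  obtain ⟨t8, x8, y8⟩ := D_restr_timeGerm s8
  have Xt : D _root_.eT X = 0 := by simp [hX, D_cX]
  have Xx : D _root_.eX X = 1 := by simp [hX, D_cX]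
  have Xy : D _root_.eY X = 0 := by simp [hX, D_cX]
  have Yt : D _root_.eT Y = 0 := by simp [hY, D_cY]
  have Yx : D _root_.eX Y = 0 := by simp [hY, D_cY]
  have Yy : D _root_.eY Y = 1 := by simp [hY, D_cY]
  have D1 : ∀ w, D w (1 : SmoothGerm p) = 0 := fun w => by rw [← map_one const, D_const]
  have vA : ev A = g.scale P.1.1 := by rw [hA, ev_restr, ev_timeGerm]
  have vX : ev X = p.2.1 := by simp [hX]
  have vY : ev Y = p.2.2 := by simp [hY]
  have key := gkzkOp_affine hφD ev_pull xT yT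
    (by simp only [hη, map_add, D_mul, D_const, Yx, xY, mul_zero, add_zero]) (σ p.1) A B V
  have hsh : g.scale P.1.1 * deriv g.Y₀ P.1.1 + 2 * σ P.1.1 * g.shear σ P.1.1 * g.Y₁ = 0 := by
    have := hσ P hp
    have := hV.Y₁_ne_zero
    rw [GroupParam.shear]
    field_simp
    ring
  have hco := (hV.coeff_iff ht _ _).1 (h.coeff_eq _ ht)
  have hTp : g.T P.1.1 = (Φ P).1.1 := (h.t_eq _ _ _ _ hp).symm
  rw [hTp] at hco
  have h7 : -(deriv (g.shear σ) P.1.1 / g.scale P.1.1) * g.scale P.1.1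
      = -deriv (g.shear σ) P.1.1 := by
    field_simp
  have h8 : (-(σ P.1.1 * g.shear σ P.1.1 ^ 2 / g.scale P.1.1 ^ 2)
      - deriv g.β₀ P.1.1 / g.scale P.1.1) * g.scale P.1.1 ^ 2
      = -(σ P.1.1 * g.shear σ P.1.1 ^ 2) - deriv g.β₀ P.1.1 * g.scale P.1.1 := by
    field_simp
  have r : ∀ {f : ℝ → ℝ} (hf : ContDiffAt ℝ ∞ f P.1.1),
      ev (x := p) (restr P (timeGerm hf)) = f P.1.1 := fun hf => ev_restr _
  have hmain : gkzk σ u p = g.scale P.1.1 ^ 4 * gkzk σ' v (Φ P).1 := by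
    rw [gkzk_eq_gkzkOp σ hu, gkzk_eq_gkzkOp σ' hv, kU, key]
    simp only [hχ, hη, hB, map_add, D_mul, D_const, map_zero, map_mul, tT, tA, xA, yA, tS,
      xS, yS, tY, yY, tb, xb, yb, t6, x6, y6, x7, y7, x8,
      y8, Xt, Xx, Xy, Yt, Yx, Yy, vA, vX, vY, r, ev_const, mul_zero,
      zero_mul, mul_one, add_zero, zero_add, e1, e2, e6]
    have hp1 : P.1.1 = p.1 := rfl
    simp only [hp1] at hsh hco h7 h8 ⊢
    rw [gkzkOp]
    linear_combination g.scale p.1 * ev (D _root_.eY (D _root_.eX V)) * hsh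
      + g.scale p.1 * ev (D _root_.eY (D _root_.eY V)) * hco
      + ev (D _root_.eX (D _root_.eX V)) * g.scale p.1 ^ 2 * p.2.2 * h7
      + ev (D _root_.eX (D _root_.eX V)) * g.scale p.1 * h8
  rw [hmain, mul_eq_zero, or_iff_right (pow_ne_zero 4 n1)]

end Converse

/-! ### Realization of normalized transformations -/

section Realization

variable {Φ : OpenPartialHomeomorph VarSpace VarSpace} {σ σ' : ℝ → ℝ} {g : GroupParam}

/-- A normalized transformation belongs to the explicit family as soon as its components `t'`,
`x'` and `y'` have the right form. The coefficient `B` of `y` in `x'` and the component `u'`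
need not be known: the determining equations force them. -/
theorem IsNormalized.realizes {hΦ : IsPointTransformation Φ} (hN : IsNormalized hΦ σ σ')
    (hσ : ∀ P ∈ Φ.source, σ P.1.1 ≠ 0) (hσs : ∀ P ∈ Φ.source, ContDiffAt ℝ ∞ σ P.1.1)
    (hV : g.Valid (timeRange Φ.source)) (B : ℝ → ℝ)
    (hT : ∀ P ∈ Φ.source, (Φ P).1.1 = g.T P.1.1)
    (hX : ∀ P ∈ Φ.source, (Φ P).1.2.1
      = g.scale P.1.1 * P.1.2.1 + B P.1.1 * P.1.2.2 + g.β₀ P.1.1)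
    (hY : ∀ P ∈ Φ.source, (Φ P).1.2.2 = g.Y₁ * P.1.2.2 + g.Y₀ P.1.1) :
    g.Realizes σ σ' Φ := by
  have hJ := isOpen_timeRange Φ.open_source
  have hmem : ∀ Q ∈ Φ.source, Q.1.1 ∈ timeRange Φ.source := fun Q hQ => ⟨Q, hQ, rfl⟩
  have germY : ∀ P, ∀ hP : P ∈ Φ.source, hΦ.gY hP = const g.Y₁ * coordY P
      + timeGerm (hV.contDiffAt_Y₀ hJ (hmem P hP)) := fun P hP => by
    change _ = SmoothGerm.mk (fun Q : VarSpace => g.Y₁ * Q.1.2.2 + g.Y₀ Q.1.1)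
      ((contDiffAt_const.mul contDiffAt_fst.snd.snd).add
        (contDiffAt_time (hV.contDiffAt_Y₀ hJ (hmem P hP))))
    exact germ_eq_of_forall Φ.open_source _ _ hP hY
  have vYt : ∀ P, ∀ hP : P ∈ Φ.source, ev (D vT (hΦ.gY hP)) = deriv g.Y₀ P.1.1 := fun P hP => by
    rw [germY P hP, map_add, D_mul, D_const, D_coordY, D_timeGerm_vT]
    simp [ev_timeGerm]
  have vYy : ∀ P, ∀ hP : P ∈ Φ.source, ev (D vY (hΦ.gY hP)) = g.Y₁ := fun P hP => by
    rw [germY P hP, map_add, D_mul, D_const, D_coordY, D_timeGerm_of_eq_zero _ rfl]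
    simp
  -- `B` is not known to be differentiable; derivatives along hyperplanes `t = const` exist anyway
  have line : ∀ P, ∀ hP : P ∈ Φ.source, ∀ w : VarSpace, w.1.1 = 0 → ev (D w (hΦ.gX hP))
      = g.scale P.1.1 * w.1.2.1 + B P.1.1 * w.1.2.2 := fun P hP w hw => by
    rw [IsPointTransformation.gX, ev_D_mk, ← DifferentiableAt.lineDeriv_eq_fderiv
      (((hΦ.contDiffAt hP).fst.snd.fst).differentiableAt (by simp)), lineDeriv]
    have h1 : ∀ᶠ s in 𝓝 (0 : ℝ), P + s • w ∈ Φ.source := by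
      have : Tendsto (fun s : ℝ => P + s • w) (𝓝 0) (𝓝 P) := by
        have : Continuous fun s : ℝ => P + s • w := by fun_prop
        simpa using this.tendsto 0
      exact this.eventually (Φ.open_source.mem_nhds hP)
    have h2 : (fun s : ℝ => (Φ (P + s • w)).1.2.1) =ᶠ[𝓝 0] fun s =>
        (g.scale P.1.1 * w.1.2.1 + B P.1.1 * w.1.2.2) * s
          + (g.scale P.1.1 * P.1.2.1 + B P.1.1 * P.1.2.2 + g.β₀ P.1.1) := by
      filter_upwards [h1] with s hs
      rw [hX _ hs]
      simp only [Prod.fst_add, Prod.smul_fst, Prod.snd_add, Prod.smul_snd, smul_eq_mul, hw,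
        mul_zero, add_zero]
      ring
    rw [h2.deriv_eq]
    exact (((hasDerivAt_id (0 : ℝ)).const_mul _).add_const _).deriv.trans (mul_one _)
  have vXx : ∀ P, ∀ hP : P ∈ Φ.source, ev (D vX (hΦ.gX hP)) = g.scale P.1.1 := fun P hP => by
    rw [line P hP vX rfl]
    simp
  have hB : ∀ P ∈ Φ.source, B P.1.1 = g.shear σ P.1.1 := fun P hP => by
    have h1 := hN.X_y P hP
    rw [vXx, vYt, vYy, line P hP vY rfl] at h1
    have h2 := hσ P hP
    have h3 := hV.Y₁_ne_zero
    rw [GroupParam.shear]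
    field_simp
    simp only [mul_zero, mul_one, zero_add] at h1
    linear_combination h1
  have vXy : ∀ P, ∀ hP : P ∈ Φ.source, ev (D vY (hΦ.gX hP)) = g.shear σ P.1.1 := fun P hP => by
    rw [line P hP vY rfl, hB P hP]
    simp
  have vXt : ∀ P, ∀ hP : P ∈ Φ.source, ev (D vT (hΦ.gX hP))
      = -(g.c / (g.c * P.1.1 + g.d)) * g.scale P.1.1 * P.1.2.1
        + deriv (g.shear σ) P.1.1 * P.1.2.2 + deriv g.β₀ P.1.1 := fun P hP => by
    have ht := hmem P hP
    have e : hΦ.gX hP = timeGerm (hV.contDiffAt_scale ht) * coordX P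
        + timeGerm (hV.contDiffAt_shear hJ ht (hσs P hP) (hσ P hP)) * coordY P
        + timeGerm (hV.contDiffAt_β₀ hJ ht) := by
      change _ = SmoothGerm.mk (fun Q : VarSpace => g.scale Q.1.1 * Q.1.2.1
        + g.shear σ Q.1.1 * Q.1.2.2 + g.β₀ Q.1.1)
        ((((contDiffAt_time (hV.contDiffAt_scale ht)).mul contDiffAt_fst.snd.fst).add
          ((contDiffAt_time (hV.contDiffAt_shear hJ ht (hσs P hP) (hσ P hP))).mul
            contDiffAt_fst.snd.snd)).add (contDiffAt_time (hV.contDiffAt_β₀ hJ ht)))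
      exact germ_eq_of_forall Φ.open_source _ _ hP fun Q hQ => by rw [hX Q hQ, hB Q hQ]
    rw [e]
    simp only [map_add, D_mul, D_timeGerm_vT, D_coordX, D_coordY, map_mul, ev_timeGerm,
      ev_const, ev_coordX, ev_coordY, (hV.hasDerivAt_scale ht).deriv]
    ring
  refine ⟨hV, fun t x y u hP => hT _ hP, fun t x y u hP => ?_, fun t x y u hP => hY _ hP,
    fun t x y u hP => ?_, ?_⟩
  · rw [hX _ hP, hB _ hP, GroupParam.xNew_eq]
  · have ht := hmem _ hP
    have n := hV.scale_ne_zero ht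
    have h1 := hN.U_eq _ hP
    rw [vXx, vXt, vXy] at h1
    rw [hV.uOld_eq hJ ht (hσs _ hP) (hσ _ hP)]
    simp only at h1 n ⊢
    have e : ev (hΦ.gU hP) = (Φ ((t, x, y), u)).2 := rfl
    rw [e] at h1
    refine mul_right_cancel₀ (pow_ne_zero 2 n) ?_
    field_simp
    field_simp at h1
    linear_combination -h1
  · rintro t ⟨P, hP, rfl⟩
    rw [hV.coeff_iff (hmem P hP), ← hT P hP]
    have := hN.coeff P hP
    rwa [vXx, vYy] at this

end Realization

/-! ### Integration of the determining equations -/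

section Integration

variable {S : Set VarSpace} {g g' : ∀ P, P ∈ S → SmoothGerm P}

theorem fderiv_time_eq_sum {f : VarSpace → ℝ} {P w : VarSpace} (hw : w.1.1 = 0) :
    fderiv ℝ f P w = w.1.2.1 * fderiv ℝ f P vX + w.1.2.2 * fderiv ℝ f P vY
      + w.2 * fderiv ℝ f P eU := by
  have : w = w.1.2.1 • vX + w.1.2.2 • vY + w.2 • eU := by
    obtain ⟨⟨a, b, c⟩, d⟩ := w
    simp only at hw
    subst hw
    simp
  conv_lhs => rw [this]
  simp only [map_add, map_smul, smul_eq_mul]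

/-- A function that depends on `t` only, locally, is globally a smooth function of `t` if the
sections `t = const` of its domain are connected. -/
theorem IsFamily.exists_eq_timeGerm (hS : IsOpen S)
    (hsl : ∀ t : ℝ, IsPreconnected (S ∩ {P | P.1.1 = t})) (hg : IsFamily S g)
    (hx : ∀ P hP, SmoothGerm.D vX (g P hP) = 0) (hy : ∀ P hP, SmoothGerm.D vY (g P hP) = 0)
    (hu : ∀ P hP, SmoothGerm.D eU (g P hP) = 0) :
    ∃ φ : ℝ → ℝ, ContDiffOn ℝ ∞ φ (timeRange S) ∧
      ∀ P, ∀ hP : P ∈ S, ∃ h : ContDiffAt ℝ ∞ φ P.1.1, g P hP = timeGerm h := by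
  obtain ⟨f, hf⟩ := hg
  have fs : ∀ P ∈ S, ContDiffAt ℝ ∞ f P := fun P hP => (hf P hP).1
  have f0 : ∀ P ∈ S, ∀ w : VarSpace, w.1.1 = 0 → fderiv ℝ f P w = 0 := fun P hP w hw => by
    obtain ⟨h1, h2⟩ := hf P hP
    rw [fderiv_time_eq_sum hw, ← ev_D_mk vX h1, ← ev_D_mk vY h1, ← ev_D_mk eU h1, ← h2, hx, hy, hu]
    simp
  have hconst : ∀ P ∈ S, ∀ Q ∈ S, P.1.1 = Q.1.1 → f P = f Q := by
    intro P hP Q hQ hPQ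
    let ι : ℝ × ℝ × ℝ → VarSpace := fun z => ((P.1.1, z.1, z.2.1), z.2.2)
    have hι : Continuous ι := by fun_prop
    have hd : ∀ z ∈ ι ⁻¹' S, HasFDerivAt (f ∘ ι) (0 : ℝ × ℝ × ℝ →L[ℝ] ℝ) z := by
      intro z hz
      let L : ℝ × ℝ × ℝ →L[ℝ] VarSpace := ContinuousLinearMap.prod
        (ContinuousLinearMap.prod 0 (ContinuousLinearMap.prod (ContinuousLinearMap.fst ℝ ℝ (ℝ × ℝ))
          ((ContinuousLinearMap.fst ℝ ℝ ℝ).comp (ContinuousLinearMap.snd ℝ ℝ (ℝ × ℝ)))))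
        ((ContinuousLinearMap.snd ℝ ℝ ℝ).comp (ContinuousLinearMap.snd ℝ ℝ (ℝ × ℝ)))
      have h1 : HasFDerivAt ι L z := by
        have : ι = fun z => ((P.1.1, 0, 0), 0) + L z := by
          funext z
          simp [ι, L]
        rw [this]
        exact L.hasFDerivAt.const_add _
      have h2 := ((fs _ hz).differentiableAt (by simp)).hasFDerivAt.comp z h1
      refine h2.congr_fderiv (ContinuousLinearMap.ext fun w => ?_)
      exact f0 _ hz (L w) rfl
    have hpre : IsPreconnected (ι ⁻¹' S) := by
      have e : ι ⁻¹' S = (fun R : VarSpace => (R.1.2.1, R.1.2.2, R.2)) ''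
          (S ∩ {R | R.1.1 = P.1.1}) := by
        ext z
        constructor
        · intro hz
          exact ⟨ι z, ⟨hz, rfl⟩, rfl⟩
        · rintro ⟨⟨⟨a, b, c⟩, d⟩, ⟨hR, hR'⟩, rfl⟩
          simp only [mem_ofPred_eq] at hR'
          subst hR'
          exact hR
      rw [e]
      exact (hsl P.1.1).image _ (by fun_prop)
    have key := (hS.preimage hι).is_const_of_fderiv_eq_zero hpre (f := f ∘ ι)
      (fun z hz => (hd z hz).differentiableAt.differentiableWithinAt)
      (fun z hz => (hd z hz).fderiv) (x := (P.1.2.1, P.1.2.2, P.2)) (y := (Q.1.2.1, Q.1.2.2, Q.2))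
      (show ((P.1.1, P.1.2.1, P.1.2.2), P.2) ∈ S from hP)
      (show ((P.1.1, Q.1.2.1, Q.1.2.2), Q.2) ∈ S by rw [hPQ]; exact hQ)
    change f ((P.1.1, P.1.2.1, P.1.2.2), P.2) = f ((P.1.1, Q.1.2.1, Q.1.2.2), Q.2) at key
    exact key.trans (congrArg f (by rw [hPQ]))
  classical
  -- outside of the range of `t`, the value of `φ` is irrelevant
  let φ : ℝ → ℝ := fun t => if h : t ∈ timeRange S then f h.choose else 0
  have hφ : ∀ P ∈ S, f P = φ P.1.1 := fun P hP => by
    have h : P.1.1 ∈ timeRange S := ⟨P, hP, rfl⟩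
    simp only [φ, dif_pos h]
    exact hconst P hP _ h.choose_spec.1 h.choose_spec.2.symm
  have hs : ∀ P ∈ S, ContDiffAt ℝ ∞ φ P.1.1 := fun P hP => by
    let κ : ℝ → VarSpace := fun t => ((t, P.1.2), P.2)
    have hκ : ContDiffAt ℝ ∞ κ P.1.1 := by fun_prop
    have h1 : ContDiffAt ℝ ∞ (f ∘ κ) P.1.1 := (fs P hP).comp P.1.1 hκ
    refine h1.congr_of_eventuallyEq ?_
    filter_upwards [hκ.continuousAt.eventually (hS.mem_nhds hP)] with t ht
    exact (hφ _ ht).symm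
  refine ⟨φ, ?_, fun P hP => ⟨hs P hP, ?_⟩⟩
  · rintro _ ⟨P, hP, rfl⟩
    exact (hs P hP).contDiffWithinAt
  · obtain ⟨h1, h2⟩ := hf P hP
    rw [h2]
    exact germ_eq_of_forall hS h1 (contDiffAt_time (hs P hP)) hP hφ

theorem IsFamily.sub (hg : IsFamily S g) (hg' : IsFamily S g') :
    IsFamily S (fun P hP => g P hP - g' P hP) := by
  obtain ⟨f, hf⟩ := hg
  obtain ⟨f', hf'⟩ := hg'
  refine ⟨fun Q => f Q - f' Q, fun P hP => ?_⟩
  obtain ⟨h1, h2⟩ := hf P hP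
  obtain ⟨h1', h2'⟩ := hf' P hP
  exact ⟨h1.sub h1', by simp only [h2, h2', mk_sub]⟩

variable {Φ : OpenPartialHomeomorph VarSpace VarSpace} {σ σ' : ℝ → ℝ}

/-- Integration of the determining equations on connected domains with connected sections. -/
theorem IsNormalized.exists_realizes {hΦ : IsPointTransformation Φ} (hN : IsNormalized hΦ σ σ')
    (hσ : ∀ P ∈ Φ.source, σ P.1.1 ≠ 0) (hσs : ∀ P ∈ Φ.source, ContDiffAt ℝ ∞ σ P.1.1)
    (hpre : IsPreconnected Φ.source)
    (hsl : ∀ t : ℝ, IsPreconnected (Φ.source ∩ {P | P.1.1 = t})) :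
    ∃ g : GroupParam, g.Realizes σ σ' Φ := by
  rcases Φ.source.eq_empty_or_nonempty with hem | ⟨P₀, hP₀⟩
  -- on the empty domain, all conditions on the parameters but the algebraic ones are void
  · refine ⟨⟨1, 0, 0, 1, 1, 1, 0, 0⟩, hN.realizes hσ hσs ⟨?_, ?_, ?_, ?_, ?_, ?_⟩ 0 ?_ ?_ ?_⟩ <;>
      simp [hem, timeRange, GroupParam.Δ]
  have hS := Φ.open_source
  set J := timeRange Φ.source with hJdef
  have hJ : IsOpen J := isOpen_timeRange hS
  have hJp : IsPreconnected J := hpre.image _ (by fun_prop)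
  have hmem : ∀ P ∈ Φ.source, P.1.1 ∈ J := fun P hP => ⟨P, hP, rfl⟩
  have fX := isFamily_gX hΦ
  have fY := isFamily_gY hΦ
  have cU : ∀ P, ∀ hP : P ∈ Φ.source, ∀ w, D eU (D w (hΦ.gX hP)) = 0 := fun P hP w => by
    rw [D_comm, hN.X_u, map_zero]
  -- `x'_x`, `t'` and `x'_y` as functions of `t`
  obtain ⟨r, hr, hrX⟩ := (fX.D vX).exists_eq_timeGerm hS hsl hN.X_xx hN.X_xy
    (fun P hP => cU P hP vX)
  obtain ⟨τ, hτ, hτT⟩ := (isFamily_gT hΦ).exists_eq_timeGerm hS hsl hN.T_x hN.T_y hN.T_u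
  obtain ⟨B, hB, hBX⟩ := (fX.D vY).exists_eq_timeGerm hS hsl
    (fun P hP => (D_comm _ _ _).trans (hN.X_xy P hP)) hN.X_yy (fun P hP => cU P hP vY)
  -- `x'_x` is the reciprocal of an affine function of `t`
  have hr0 : ∀ t ∈ J, r t ≠ 0 := by
    rintro _ ⟨P, hP, rfl⟩
    obtain ⟨h, e⟩ := hrX P hP
    have := hN.X_x_ne_zero hP
    rwa [e] at this
  have hrs : ∀ t ∈ J, ContDiffAt ℝ ∞ r t := fun t ht => hr.contDiffAt (hJ.mem_nhds ht)
  have hτs : ∀ t ∈ J, ContDiffAt ℝ ∞ τ t := fun t ht => hτ.contDiffAt (hJ.mem_nhds ht)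
  have hr2 : ∀ t ∈ J, r t * deriv (deriv r) t = 2 * deriv r t ^ 2 := by
    rintro _ ⟨P, hP, rfl⟩
    obtain ⟨h, e⟩ := hrX P hP
    have := hN.X_xtt P hP
    rwa [e, D_timeGerm_vT, D_timeGerm_vT] at this
  have hτ' : ∀ t ∈ J, deriv τ t = r t ^ 2 := by
    rintro _ ⟨P, hP, rfl⟩
    obtain ⟨h, e⟩ := hrX P hP
    obtain ⟨h', e'⟩ := hτT P hP
    have := congrArg ev (hN.T_t P hP)
    rw [e, e', D_timeGerm_vT, map_mul] at this
    rw [pow_two]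
    exact this
  have hd : ∀ t ∈ J, HasDerivAt r (deriv r t) t := fun t ht =>
    ((hrs t ht).differentiableAt (by simp)).hasDerivAt
  have hd' : ∀ t ∈ J, HasDerivAt (deriv r) (deriv (deriv r) t) t := fun t ht =>
    ((contDiffAt_deriv (hrs t ht)).differentiableAt (by simp)).hasDerivAt
  have ht₀ := hmem P₀ hP₀
  set t₀ := P₀.1.1 with ht₀def
  -- `(1 / r)' = -r' / r²` is constant by the equation `r r'' = 2 r'²`
  set c := -deriv r t₀ / r t₀ ^ 2 with hc
  have hc' : ∀ t ∈ J, -deriv r t / r t ^ 2 = c := fun t ht => by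
    have hder : ∀ t ∈ J, HasDerivAt (fun t => -deriv r t / r t ^ 2) 0 t := fun t ht => by
      refine ((hd' t ht).neg.div ((hd t ht).pow 2) (pow_ne_zero 2 (hr0 t ht))).congr_deriv ?_
      have := hr0 t ht
      rw [div_eq_zero_iff]
      left
      push_cast
      simp only [Pi.neg_apply, Pi.pow_apply]
      linear_combination (-r t) * hr2 t ht
    exact hJ.is_const_of_deriv_eq_zero hJp
      (fun s hs => (hder s hs).differentiableAt.differentiableWithinAt)
      (fun s hs => (hder s hs).deriv) ht ht₀
  set d := 1 / r t₀ - c * t₀ with hddef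
  have hcd : ∀ t ∈ J, c * t + d = 1 / r t := fun t ht => by
    have hder : ∀ t ∈ J, HasDerivAt (fun t => 1 / r t - c * t) 0 t := fun t ht => by
      refine (((hasDerivAt_const t (1 : ℝ)).div (hd t ht) (hr0 t ht)).sub
        ((hasDerivAt_id t).const_mul c)).congr_deriv ?_
      rw [← hc' t ht]
      have := hr0 t ht
      field_simp
      ring
    have : 1 / r t - c * t = 1 / r t₀ - c * t₀ := hJ.is_const_of_deriv_eq_zero hJp
      (fun s hs => (hder s hs).differentiableAt.differentiableWithinAt)
      (fun s hs => (hder s hs).deriv) ht ht₀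
    rw [hddef, ← this]
    ring
  have hcd0 : ∀ t ∈ J, c * t + d ≠ 0 := fun t ht => by
    rw [hcd t ht]
    exact one_div_ne_zero (hr0 t ht)
  -- `y'_y` is constant
  obtain ⟨Y₁, hY₁⟩ : ∃ Y₁, ∀ P, ∀ hP : P ∈ Φ.source, D vY (hΦ.gY hP) = const Y₁ := by
    obtain ⟨f, hf⟩ : ∃ f : VarSpace → ℝ, ∀ P, ∀ hP : P ∈ Φ.source,
      ∃ h : ContDiffAt ℝ ∞ f P, D vY (hΦ.gY hP) = SmoothGerm.mk f h := fY.D vY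
    refine ⟨f P₀, fun P hP => ?_⟩
    obtain ⟨h1, h2⟩ := hf P hP
    rw [h2]
    refine germ_eq_of_forall hS h1 contDiffAt_const hP fun Q hQ => ?_
    have hder : ∀ Q ∈ Φ.source, HasFDerivAt f (0 : VarSpace →L[ℝ] ℝ) Q := fun Q hQ => by
      obtain ⟨h1, h2⟩ := hf Q hQ
      refine (h1.differentiableAt (by simp)).hasFDerivAt.congr_fderiv
        (ContinuousLinearMap.ext fun w => ?_)
      have hw : w = w.1.1 • vT + ((0, w.1.2), w.2) := by
        obtain ⟨⟨a, b, c⟩, d⟩ := w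
        simp
      rw [hw, map_add, map_smul, fderiv_time_eq_sum (w := ((0, w.1.2), w.2)) rfl,
        ← ev_D_mk vX h1, ← ev_D_mk vY h1, ← ev_D_mk eU h1, ← ev_D_mk vT h1, ← h2, hN.Y_ty, hN.Y_yy, D_comm, hN.Y_x, D_comm, hN.Y_u]
      simp
    exact hS.is_const_of_fderiv_eq_zero hpre
      (fun s hs => (hder s hs).differentiableAt.differentiableWithinAt)
      (fun s hs => (hder s hs).fderiv) hQ hP₀
  have hY₁0 : Y₁ ≠ 0 := by
    have := (hN.toIsFibered.nondegenerate hP₀).2.1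
    rwa [hY₁, ev_const] at this
  -- `y' - Y₁ y` and `x' - r x - B y` depend on `t` only
  obtain ⟨Y₀, hY₀, hY₀Y⟩ := (fY.sub ((IsFamily.const Y₁).mul isFamily_coordY)).exists_eq_timeGerm
    hS hsl
    (fun P hP => by rw [map_sub, hN.Y_x, D_mul, D_const, D_coordY]; simp)
    (fun P hP => by rw [map_sub, hY₁, D_mul, D_const, D_coordY]; simp)
    (fun P hP => by rw [map_sub, hN.Y_u, D_mul, D_const, D_coordY]; simp)
  have hBs : ∀ t ∈ J, ContDiffAt ℝ ∞ B t := fun t ht => hB.contDiffAt (hJ.mem_nhds ht)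
  have tw : ∀ (P : VarSpace) (f : ℝ → ℝ) (h : ContDiffAt ℝ ∞ f P.1.1),
      D vX (timeGerm h) = 0 ∧ D vY (timeGerm h) = 0 ∧ D eU (timeGerm h) = 0 := fun P f h =>
    ⟨D_timeGerm_of_eq_zero h rfl, D_timeGerm_of_eq_zero h rfl, D_timeGerm_of_eq_zero h rfl⟩
  obtain ⟨β, hβ, hβX⟩ := (fX.sub (((isFamily_timeGerm (fun P hP => hrs _ (hmem P hP))).mul
    isFamily_coordX).add ((isFamily_timeGerm (fun P hP => hBs _ (hmem P hP))).mul
    isFamily_coordY))).exists_eq_timeGerm hS hsl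
    (fun P hP => by
      obtain ⟨h, e⟩ := hrX P hP
      simp only [map_sub, map_add, D_mul, (tw _ _ _).1, D_coordX, D_coordY, e]
      simp)
    (fun P hP => by
      obtain ⟨h, e⟩ := hBX P hP
      simp only [map_sub, map_add, D_mul, (tw _ _ _).2.1, D_coordX, D_coordY, e]
      simp)
    (fun P hP => by
      simp only [map_sub, map_add, D_mul, (tw _ _ _).2.2, D_coordX, D_coordY, hN.X_u]
      simp)
  -- the parameters are normalized by `ε = Δ = 1`; then `T' = 1 / (c t + d)²`, and `a` and `b` are
  -- determined by `T(t₀) = τ(t₀)`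
  let g : GroupParam := ⟨τ t₀ * c + 1 / (c * t₀ + d), τ t₀ * d - t₀ / (c * t₀ + d), c, d, 1, Y₁, Y₀,
    β⟩
  have hΔ : g.Δ = 1 := by
    have := hcd0 t₀ ht₀
    simp only [GroupParam.Δ, g]
    field_simp
    ring
  have hV : g.Valid J := ⟨by rw [hΔ]; exact one_pos, Or.inl rfl, hY₁0, hY₀, hβ, hcd0⟩
  have hscale : ∀ t ∈ J, g.scale t = r t := fun t ht => by
    rw [GroupParam.scale, hΔ]
    simp only [g, Real.sqrt_one, hcd t ht]
    simp
  have hT : ∀ t ∈ J, τ t = g.T t := fun t ht => by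
    have hder : ∀ t ∈ J, HasDerivAt (fun t => τ t - g.T t) 0 t := fun t ht => by
      refine (((hτs t ht).differentiableAt (by simp)).hasDerivAt.sub
        (hV.hasDerivAt_T ht)).congr_deriv ?_
      rw [hτ' t ht, hscale t ht, sub_self]
    have := hJ.is_const_of_deriv_eq_zero hJp
      (fun s hs => (hder s hs).differentiableAt.differentiableWithinAt)
      (fun s hs => (hder s hs).deriv) ht ht₀
    have e : g.T t₀ = τ t₀ := by
      have := hcd0 t₀ ht₀
      simp only [GroupParam.T, g]
      field_simp
      ring
    simp only [e, sub_self] at this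
    exact sub_eq_zero.1 this
  refine ⟨g, hN.realizes hσ hσs hV B (fun P hP => ?_) (fun P hP => ?_) (fun P hP => ?_)⟩
  · obtain ⟨h, e⟩ := hτT P hP
    rw [← hT _ (hmem P hP)]
    exact congrArg ev e
  · obtain ⟨h, e⟩ := hβX P hP
    have := congrArg ev e
    simp only [map_sub, map_add, map_mul, ev_timeGerm, ev_coordX, ev_coordY] at this
    rw [hscale _ (hmem P hP)]
    have e' : ev (hΦ.gX hP) = (Φ P).1.2.1 := rfl
    rw [← e']
    linear_combination this
  · obtain ⟨h, e⟩ := hY₀Y P hP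
    have := congrArg ev e
    simp only [map_sub, map_mul, ev_timeGerm, ev_coordY, ev_const] at this
    have e' : ev (hΦ.gY hP) = (Φ P).1.2.2 := rfl
    rw [← e']
    linear_combination this

end Integration

/-! ### Normalization -/

section Normalization

variable {Φ Ψ : OpenPartialHomeomorph VarSpace VarSpace} {σ σ' σ'' : ℝ → ℝ} {I I' I'' : Set ℝ}

theorem IsCoefficient.contDiffAt (hσ : IsCoefficient σ I) {t : ℝ} (ht : t ∈ I) :
    ContDiffAt ℝ ∞ σ t := hσ.smooth.contDiffAt (hσ.isOpen.mem_nhds ht)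

theorem Admissible.isNormalized (h : Admissible σ I σ' I' Φ) (hσ : IsCoefficient σ I) :
    IsNormalized h.isPointTransformation σ σ' :=
  h.mapsEquation.isNormalized _ (fun _ hP => hσ.ne_zero _ (h.source_subset hP))
    (fun _ hP => hσ.contDiffAt (h.source_subset hP))

theorem InGE.admissible (h : InGE σ I σ' I' Φ) (hσ : IsCoefficient σ I) :
    Admissible σ I σ' I' Φ := by
  obtain ⟨g, hg⟩ := h.exists_param
  exact ⟨h.isPointTransformation, h.source_subset, h.target_subset,
    hg.mapsEquation h.isPointTransformation (fun _ hP => hσ.ne_zero _ (h.source_subset hP))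
    (fun _ hP => hσ.contDiffAt (h.source_subset hP))⟩

theorem Admissible.inGE (h : Admissible σ I σ' I' Φ) (hσ : IsCoefficient σ I)
    (hpre : IsPreconnected Φ.source)
    (hsl : ∀ t : ℝ, IsPreconnected (Φ.source ∩ {P | P.1.1 = t})) : InGE σ I σ' I' Φ :=
  ⟨h.isPointTransformation, h.source_subset, h.target_subset,
    (h.isNormalized hσ).exists_realizes (fun _ hP => hσ.ne_zero _ (h.source_subset hP))
      (fun _ hP => hσ.contDiffAt (h.source_subset hP)) hpre hsl⟩

theorem Admissible.restr (h : Admissible σ I σ' I' Φ) (U : Set VarSpace) :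
    Admissible σ I σ' I' (Φ.restr U) := by
  have hs : (Φ.restr U).source ⊆ Φ.source := by
    rw [Φ.restr_source]
    exact inter_subset_left
  have ht : (Φ.restr U).target ⊆ Φ.target := fun Q hQ => by
    have := (Φ.restr U).map_target hQ
    have h2 := Φ.map_source (hs this)
    have h3 := (Φ.restr U).right_inv hQ
    change Φ ((Φ.restr U).symm Q) = Q at h3
    rwa [h3] at h2
  exact ⟨⟨h.isPointTransformation.1.mono hs, h.isPointTransformation.2.mono ht⟩,
    hs.trans h.source_subset, ht.trans h.target_subset,
    fun u v p hp hu hv hT => h.mapsEquation u v p (hs hp) hu hv hT⟩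

/-- Every point has a ball around it on which the domain has the required connectedness. -/
theorem Admissible.exists_inGE_restr (h : Admissible σ I σ' I' Φ) (hσ : IsCoefficient σ I)
    {P : VarSpace} (hP : P ∈ Φ.source) :
    ∃ U : Set VarSpace, IsOpen U ∧ P ∈ U ∧ InGE σ I σ' I' (Φ.restr U) := by
  obtain ⟨ε, hε, hball⟩ := Metric.isOpen_iff.1 Φ.open_source P hP
  refine ⟨Metric.ball P ε, Metric.isOpen_ball, Metric.mem_ball_self hε, ?_⟩
  have hs : (Φ.restr (Metric.ball P ε)).source = Metric.ball P ε := by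
    rw [Φ.restr_source, Metric.isOpen_ball.interior_eq, inter_eq_right]
    exact hball
  have hc := convex_ball P ε
  refine (h.restr _).inGE hσ (by rw [hs]; exact hc.isPreconnected) fun t => ?_
  rw [hs]
  refine (hc.inter ?_).isPreconnected
  exact (convex_singleton t).linear_preimage
    ((LinearMap.fst ℝ ℝ (ℝ × ℝ)).comp (LinearMap.fst ℝ IndepSpace ℝ))

theorem IsPointTransformation.trans (hΦ : IsPointTransformation Φ)
    (hΨ : IsPointTransformation Ψ) : IsPointTransformation (Φ.trans Ψ) := by
  constructor
  · rw [Φ.trans_source]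
    exact hΨ.1.comp (hΦ.1.mono inter_subset_left) (fun P hP => hP.2)
  · rw [Φ.trans_target]
    exact hΦ.2.comp (hΨ.2.mono inter_subset_left) (fun P hP => hP.2)

/-- The direction of the dependent variable is preserved because the inverse transformation is
normalized. -/
theorem Admissible.trans (h : Admissible σ I σ' I' Φ) (h' : Admissible σ' I' σ'' I'' Ψ)
    (hσ' : IsCoefficient σ' I') : Admissible σ I σ'' I'' (Φ.trans Ψ) := by
  refine ⟨h.isPointTransformation.trans h'.isPointTransformation, ?_, ?_,
    h.mapsEquation.trans h'.mapsEquation h.isPointTransformation ?_⟩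
  · rw [Φ.trans_source]
    exact inter_subset_left.trans h.source_subset
  · rw [Φ.trans_target]
    exact inter_subset_left.trans h'.target_subset
  · intro P hP
    have hQ : Φ P ∈ Φ.symm.source := Φ.map_source hP
    have hN := h.symm.isNormalized hσ'
    have hd := h.symm.isPointTransformation
    have h1 := congrArg ev (hN.T_u _ hQ)
    have h2 := congrArg ev (hN.X_u _ hQ)
    have h3 := congrArg ev (hN.Y_u _ hQ)
    rw [hd.ev_D_gT, map_zero] at h1
    rw [hd.ev_D_gX, map_zero] at h2
    rw [hd.ev_D_gY, map_zero] at h3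
    exact Prod.ext h1 (Prod.ext h2 h3)

namespace GroupParam

variable {g g' : GroupParam} {J : Set ℝ} {t : ℝ}

theorem Realizes.apply_t (h : g.Realizes σ σ' Φ) {P : VarSpace} (hP : P ∈ Φ.source) :
    (Φ P).1.1 = g.T P.1.1 := h.t_eq _ _ _ _ hP

theorem Realizes.apply_x (h : g.Realizes σ σ' Φ) {P : VarSpace} (hP : P ∈ Φ.source) :
    (Φ P).1.2.1 = g.scale P.1.1 * P.1.2.1 + g.shear σ P.1.1 * P.1.2.2 + g.β₀ P.1.1 := by
  rw [← xNew_eq]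
  exact h.x_eq _ _ _ _ hP

theorem Realizes.apply_y (h : g.Realizes σ σ' Φ) {P : VarSpace} (hP : P ∈ Φ.source) :
    (Φ P).1.2.2 = g.Y₁ * P.1.2.2 + g.Y₀ P.1.1 := h.y_eq _ _ _ _ hP

/-- The inverse of the Möbius transformation `T`. -/
def invT (g : GroupParam) (t : ℝ) : ℝ := (g.d * t + -g.b) / (-g.c * t + g.a)

theorem Valid.invT_denom (h : g.Valid J) (ht : t ∈ J) :
    -g.c * g.T t + g.a = g.Δ / (g.c * t + g.d) := by
  have := h.denom_ne_zero t ht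
  rw [T, Δ]
  field_simp
  ring

theorem Valid.invT_denom_ne_zero (h : g.Valid J) (ht : t ∈ J) : -g.c * g.T t + g.a ≠ 0 := by
  rw [h.invT_denom ht]
  exact div_ne_zero h.Δ_pos.ne' (h.denom_ne_zero t ht)

theorem Valid.invT_T (h : g.Valid J) (ht : t ∈ J) : g.invT (g.T t) = t := by
  have h1 := h.denom_ne_zero t ht
  have h2 := h.Δ_pos.ne'
  rw [invT, h.invT_denom ht, div_eq_iff (div_ne_zero h2 h1), T, Δ]
  obtain ⟨q, hq⟩ : ∃ q, q = g.c * t + g.d := ⟨_, rfl⟩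
  rw [← hq] at h1 ⊢
  field_simp
  rw [hq]
  ring

theorem Valid.contDiffAt_invT (h : g.Valid J) (ht : t ∈ J) : ContDiffAt ℝ ∞ g.invT (g.T t) :=
  ((contDiffAt_const.mul contDiffAt_id).add contDiffAt_const).div
    ((contDiffAt_const.mul contDiffAt_id).add contDiffAt_const) (h.invT_denom_ne_zero ht)

theorem Valid.contDiffAt_comp_invT (h : g.Valid J) (ht : t ∈ J) {f : ℝ → ℝ}
    (hf : ContDiffAt ℝ ∞ f t) : ContDiffAt ℝ ∞ (fun t' => f (g.invT t')) (g.T t) := by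
  refine ContDiffAt.comp (g := f) (g.T t) ?_ (h.contDiffAt_invT ht)
  rwa [h.invT_T ht]

/-- The parameters of the inverse transformation. -/
def inverse (g : GroupParam) (σ : ℝ → ℝ) : GroupParam where
  a := g.d
  b := -g.b
  c := -g.c
  d := g.a
  ε := g.ε
  Y₁ := 1 / g.Y₁
  Y₀ t := -g.Y₀ (g.invT t) / g.Y₁
  β₀ t := (g.shear σ (g.invT t) * g.Y₀ (g.invT t) / g.Y₁ - g.β₀ (g.invT t)) / g.scale (g.invT t)

theorem Δ_inverse (σ : ℝ → ℝ) : (g.inverse σ).Δ = g.Δ := by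
  simp only [Δ, inverse]
  ring

theorem Valid.scale_inverse (h : g.Valid J) (ht : t ∈ J) :
    (g.inverse σ).scale (g.T t) = 1 / g.scale t := by
  have h1 := h.denom_ne_zero t ht
  have h2 := h.sqrt_ne_zero
  have h3 := h.ε_ne_zero
  rw [scale, scale, Δ_inverse]
  simp only [inverse]
  rw [h.invT_denom ht]
  have h4 : g.Δ = √g.Δ ^ 2 := (Real.sq_sqrt h.Δ_pos.le).symm
  rw [one_div_div, div_div_eq_mul_div, div_eq_div_iff h.Δ_pos.ne' (mul_ne_zero h3 h2)]
  linear_combination (g.c * t + g.d) * √g.Δ ^ 2 * h.sq_ε - (g.c * t + g.d) * h4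

/-- The parameters of the composition of two transformations. -/
def comp (g' g : GroupParam) (σ' : ℝ → ℝ) : GroupParam where
  a := g'.a * g.a + g'.b * g.c
  b := g'.a * g.b + g'.b * g.d
  c := g'.c * g.a + g'.d * g.c
  d := g'.c * g.b + g'.d * g.d
  ε := g'.ε * g.ε
  Y₁ := g'.Y₁ * g.Y₁
  Y₀ t := g'.Y₁ * g.Y₀ t + g'.Y₀ (g.T t)
  β₀ t := g'.scale (g.T t) * g.β₀ t + g'.shear σ' (g.T t) * g.Y₀ t + g'.β₀ (g.T t)

theorem Δ_comp (σ' : ℝ → ℝ) : (g'.comp g σ').Δ = g'.Δ * g.Δ := by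
  simp only [Δ, comp]
  ring

theorem Valid.comp_denom (h : g.Valid J) (ht : t ∈ J) :
    (g'.comp g σ').c * t + (g'.comp g σ').d
      = (g'.c * g.T t + g'.d) * (g.c * t + g.d) := by
  have := h.denom_ne_zero t ht
  simp only [comp, T]
  field_simp
  ring

theorem Valid.scale_comp (h : g.Valid J) (hΔ : 0 ≤ g'.Δ) (ht : t ∈ J) :
    (g'.comp g σ').scale t = g'.scale (g.T t) * g.scale t := by
  rw [scale, h.comp_denom ht, Δ_comp, Real.sqrt_mul hΔ, scale, scale]
  simp only [comp]
  rw [div_mul_div_comm]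
  ring

end GroupParam

/-- The inverse is a point transformation between equations of the class, hence normalized; thus
only its components `t`, `x`, `y` have to be computed. -/
theorem InGE.symm (h : InGE σ I σ' I' Φ) (hσ : IsCoefficient σ I) (hσ' : IsCoefficient σ' I') :
    InGE σ' I' σ I Φ.symm := by
  have hA := (h.admissible hσ).symm
  obtain ⟨g, hg⟩ := h.exists_param
  refine ⟨hA.isPointTransformation, hA.source_subset, hA.target_subset, ?_⟩
  have hV := hg.valid
  have hJ := isOpen_timeRange Φ.open_source
  -- every point of the target is an image
  have key : ∀ Q ∈ Φ.symm.source, (Φ.symm Q).1.1 ∈ timeRange Φ.source ∧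
      (Φ.symm Q).1.1 ∈ I ∧ Q.1.1 = g.T (Φ.symm Q).1.1 ∧
      Q.1.2.1 = g.scale (Φ.symm Q).1.1 * (Φ.symm Q).1.2.1
        + g.shear σ (Φ.symm Q).1.1 * (Φ.symm Q).1.2.2 + g.β₀ (Φ.symm Q).1.1 ∧
      Q.1.2.2 = g.Y₁ * (Φ.symm Q).1.2.2 + g.Y₀ (Φ.symm Q).1.1 := by
    intro Q hQ
    have hP : Φ.symm Q ∈ Φ.source := Φ.map_target hQ
    have hr : Φ (Φ.symm Q) = Q := Φ.right_inv hQ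
    have h1 := hg.apply_t (P := Φ.symm Q) hP
    have h2 := hg.apply_x (P := Φ.symm Q) hP
    have h3 := hg.apply_y (P := Φ.symm Q) hP
    rw [hr] at h1 h2 h3
    exact ⟨⟨_, hP, rfl⟩, h.source_subset hP, h1, h2, h3⟩
  have valid : (g.inverse σ).Valid (timeRange Φ.symm.source) := by
    have e : ∀ t ∈ timeRange Φ.symm.source, ∃ s ∈ timeRange Φ.source, s ∈ I ∧ t = g.T s := by
      rintro _ ⟨Q, hQ, rfl⟩
      obtain ⟨k1, k2, k3, -⟩ := key Q hQ
      exact ⟨_, k1, k2, k3⟩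
    refine ⟨by rw [GroupParam.Δ_inverse]; exact hV.Δ_pos, hV.sign,
      one_div_ne_zero hV.Y₁_ne_zero, fun t ht => ?_, fun t ht => ?_, fun t ht => ?_⟩
    · obtain ⟨s, hs, hsI, rfl⟩ := e t ht
      exact ((hV.contDiffAt_comp_invT hs (hV.contDiffAt_Y₀ hJ hs)).neg.div
        contDiffAt_const hV.Y₁_ne_zero).contDiffWithinAt
    · obtain ⟨s, hs, hsI, rfl⟩ := e t ht
      have c0 := hV.contDiffAt_Y₀ hJ hs
      have c1 := hV.contDiffAt_shear hJ hs (hσ.contDiffAt hsI) (hσ.ne_zero s hsI)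
      exact (hV.contDiffAt_comp_invT hs (f := fun t => (g.shear σ t * g.Y₀ t / g.Y₁ - g.β₀ t)
        / g.scale t) ((((c1.mul c0).div contDiffAt_const hV.Y₁_ne_zero).sub
          (hV.contDiffAt_β₀ hJ hs)).div (hV.contDiffAt_scale hs)
          (hV.scale_ne_zero hs))).contDiffWithinAt
    · obtain ⟨s, hs, hsI, rfl⟩ := e t ht
      exact hV.invT_denom_ne_zero hs
  refine ⟨g.inverse σ, (hA.isNormalized hσ').realizes
    (fun _ hP => hσ'.ne_zero _ (hA.source_subset hP))
    (fun _ hP => hσ'.contDiffAt (hA.source_subset hP)) valid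
    (fun t => -(g.shear σ (g.invT t) / g.Y₁ / g.scale (g.invT t))) ?_ ?_ ?_⟩
  · intro Q hQ
    obtain ⟨k1, -, k3, -⟩ := key Q hQ
    rw [k3]
    exact (hV.invT_T k1).symm
  · intro Q hQ
    obtain ⟨k1, -, k3, k4, k5⟩ := key Q hQ
    have n := hV.scale_ne_zero k1
    have n' := hV.Y₁_ne_zero
    rw [k3, hV.scale_inverse k1, k4, k5]
    simp only [GroupParam.inverse, hV.invT_T k1]
    field_simp
    ring
  · intro Q hQ
    obtain ⟨k1, -, k3, k4, k5⟩ := key Q hQ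
    have n' := hV.Y₁_ne_zero
    rw [k3, k5]
    simp only [GroupParam.inverse, hV.invT_T k1]
    field_simp
    ring

/-- The composition is normalized as well; only its components `t`, `x`, `y` have to be computed. -/
theorem InGE.trans (h : InGE σ I σ' I' Φ) (h' : InGE σ' I' σ'' I'' Ψ) (hσ : IsCoefficient σ I)
    (hσ' : IsCoefficient σ' I') : InGE σ I σ'' I'' (Φ.trans Ψ) := by
  have hA := (h.admissible hσ).trans (h'.admissible hσ') hσ'
  obtain ⟨g, hg⟩ := h.exists_param
  obtain ⟨g', hg'⟩ := h'.exists_param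
  refine ⟨hA.isPointTransformation, hA.source_subset, hA.target_subset, ?_⟩
  have hV := hg.valid
  have hV' := hg'.valid
  have hJ := isOpen_timeRange Φ.open_source
  have hJ' := isOpen_timeRange Ψ.open_source
  have key : ∀ P ∈ (Φ.trans Ψ).source, P.1.1 ∈ timeRange Φ.source ∧
      g.T P.1.1 ∈ timeRange Ψ.source ∧ g.T P.1.1 ∈ I' ∧
      (Φ.trans Ψ P).1.1 = g'.T (g.T P.1.1) ∧
      (Φ.trans Ψ P).1.2.1 = g'.scale (g.T P.1.1) * (g.scale P.1.1 * P.1.2.1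
          + g.shear σ P.1.1 * P.1.2.2 + g.β₀ P.1.1)
        + g'.shear σ' (g.T P.1.1) * (g.Y₁ * P.1.2.2 + g.Y₀ P.1.1) + g'.β₀ (g.T P.1.1) ∧
      (Φ.trans Ψ P).1.2.2 = g'.Y₁ * (g.Y₁ * P.1.2.2 + g.Y₀ P.1.1) + g'.Y₀ (g.T P.1.1) := by
    intro P hP
    rw [Φ.trans_source] at hP
    obtain ⟨hP, hQ⟩ := hP
    change Φ P ∈ Ψ.source at hQ
    have h1 := hg.apply_t hP
    have h2 := hg.apply_x hP
    have h3 := hg.apply_y hP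
    have h1' := hg'.apply_t (P := Φ P) hQ
    have h2' := hg'.apply_x (P := Φ P) hQ
    have h3' := hg'.apply_y (P := Φ P) hQ
    rw [h1] at h1'
    rw [h1, h2, h3] at h2'
    rw [h1, h3] at h3'
    refine ⟨⟨P, hP, rfl⟩, ⟨_, hQ, h1⟩, ?_, h1', h2', h3'⟩
    have := h'.source_subset hQ
    change (Φ P).1.1 ∈ I' at this
    rwa [h1] at this
  have valid : (g'.comp g σ').Valid (timeRange (Φ.trans Ψ).source) := by
    have e : ∀ t ∈ timeRange (Φ.trans Ψ).source, t ∈ timeRange Φ.source ∧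
        g.T t ∈ timeRange Ψ.source ∧ g.T t ∈ I' := by
      rintro _ ⟨P, hP, rfl⟩
      obtain ⟨k1, k2, k3, -⟩ := key P hP
      exact ⟨k1, k2, k3⟩
    refine ⟨?_, ?_, mul_ne_zero hV'.Y₁_ne_zero hV.Y₁_ne_zero, fun t ht => ?_, fun t ht => ?_,
      fun t ht => ?_⟩
    · rw [GroupParam.Δ_comp]
      exact mul_pos hV'.Δ_pos hV.Δ_pos
    · change g'.ε * g.ε = 1 ∨ g'.ε * g.ε = -1
      rcases hV.sign with h | h <;> rcases hV'.sign with h' | h' <;> simp [h, h']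
    · obtain ⟨k1, k2, k3⟩ := e t ht
      have cT := hV.contDiffAt_T k1
      exact ((contDiffAt_const.mul (hV.contDiffAt_Y₀ hJ k1)).add
        ((hV'.contDiffAt_Y₀ hJ' k2).comp t cT)).contDiffWithinAt
    · obtain ⟨k1, k2, k3⟩ := e t ht
      have cT := hV.contDiffAt_T k1
      have c1 := hV'.contDiffAt_shear hJ' k2 (hσ'.contDiffAt k3) (hσ'.ne_zero _ k3)
      exact (((((hV'.contDiffAt_scale k2).comp t cT).mul (hV.contDiffAt_β₀ hJ k1)).add
        ((c1.comp t cT).mul (hV.contDiffAt_Y₀ hJ k1))).add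
        ((hV'.contDiffAt_β₀ hJ' k2).comp t cT)).contDiffWithinAt
    · obtain ⟨k1, k2, k3⟩ := e t ht
      rw [hV.comp_denom k1]
      exact mul_ne_zero (hV'.denom_ne_zero _ k2) (hV.denom_ne_zero _ k1)
  refine ⟨g'.comp g σ', (hA.isNormalized hσ).realizes
    (fun _ hP => hσ.ne_zero _ (hA.source_subset hP))
    (fun _ hP => hσ.contDiffAt (hA.source_subset hP)) valid
    (fun t => g'.scale (g.T t) * g.shear σ t + g'.shear σ' (g.T t) * g.Y₁) ?_ ?_ ?_⟩
  · intro P hP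
    obtain ⟨k1, k2, k3, k4, -⟩ := key P hP
    have n1 := hV.denom_ne_zero _ k1
    have n2 := hV'.denom_ne_zero _ k2
    rw [k4]
    change (g'.a * g.T P.1.1 + g'.b) / (g'.c * g.T P.1.1 + g'.d)
      = ((g'.comp g σ').a * P.1.1 + (g'.comp g σ').b)
        / ((g'.comp g σ').c * P.1.1 + (g'.comp g σ').d)
    rw [hV.comp_denom k1, div_eq_div_iff n2 (mul_ne_zero n2 n1)]
    simp only [GroupParam.comp]
    obtain ⟨q, hq⟩ : ∃ q, q = g.c * P.1.1 + g.d := ⟨_, rfl⟩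
    rw [GroupParam.T]
    rw [← hq] at n1 ⊢
    field_simp
    rw [hq]
    ring
  · intro P hP
    obtain ⟨k1, k2, k3, k4, k5, k6⟩ := key P hP
    rw [k5, hV.scale_comp hV'.Δ_pos.le k1]
    simp only [GroupParam.comp]
    ring
  · intro P hP
    obtain ⟨k1, k2, k3, k4, k5, k6⟩ := key P hP
    rw [k6]
    simp only [GroupParam.comp]
    ring

end Normalization

/-! ### The action on coefficients -/

section Action

variable {σ σ' : ℝ → ℝ} {I : Set ℝ}

theorem isOpen_slab {J : Set ℝ} (hJ : IsOpen J) : IsOpen (slab J) :=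
  hJ.preimage (continuous_fst.comp continuous_fst)

theorem timeRange_slab {J : Set ℝ} : timeRange (slab J) = J := by
  ext t
  constructor
  · rintro ⟨P, hP, rfl⟩
    exact hP
  · intro ht
    exact ⟨((t, 0, 0), 0), ht, rfl⟩

namespace GroupParam

variable {g : GroupParam} {J : Set ℝ} {t : ℝ}

theorem Valid.contDiffOn_T (h : g.Valid J) : ContDiffOn ℝ ∞ g.T J :=
  fun _ ht => (h.contDiffAt_T ht).contDiffWithinAt

theorem Valid.image_T_eq (h : g.Valid J) :
    g.T '' J = {t | -g.c * t + g.a ≠ 0} ∩ g.invT ⁻¹' J := by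
  ext t'
  constructor
  · rintro ⟨t, ht, rfl⟩
    refine ⟨h.invT_denom_ne_zero ht, ?_⟩
    rw [mem_preimage, h.invT_T ht]
    exact ht
  · rintro ⟨h1, h2⟩
    refine ⟨_, h2, ?_⟩
    have h3 := h.denom_ne_zero _ h2
    simp only [mem_ofPred_eq] at h1
    rw [T, div_eq_iff h3]
    obtain ⟨q, hq⟩ : ∃ q, q = -g.c * t' + g.a := ⟨_, rfl⟩
    rw [invT]
    rw [← hq] at h1 ⊢
    field_simp
    rw [hq]
    ring

theorem Valid.isOpen_image_T (h : g.Valid J) (hJ : IsOpen J) : IsOpen (g.T '' J) := by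
  rw [h.image_T_eq]
  have hU : IsOpen {t : ℝ | -g.c * t + g.a ≠ 0} := isOpen_ne_fun (by fun_prop) (by fun_prop)
  refine ContinuousOn.isOpen_inter_preimage ?_ hU hJ
  exact ContinuousOn.div (by fun_prop) (by fun_prop) fun t ht => ht

theorem Valid.ordConnected_image_T (h : g.Valid J) (hJ : J.OrdConnected) :
    (g.T '' J).OrdConnected :=
  isPreconnected_iff_ordConnected.1
    ((isPreconnected_iff_ordConnected.2 hJ).image _ h.contDiffOn_T.continuousOn)

/-- The transformation with parameters `g` at the coefficient `σ`, as a map: the relation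
`u = scale · u' + …` is solved for `u'`. -/
def toFun (g : GroupParam) (σ : ℝ → ℝ) (P : VarSpace) : VarSpace :=
  ((g.T P.1.1, g.xNew σ P.1.1 P.1.2.1 P.1.2.2, g.Y₁ * P.1.2.2 + g.Y₀ P.1.1),
    (P.2 - g.uOld σ P.1.1 P.1.2.1 P.1.2.2 0) / g.scale P.1.1)

/-- The inverse of the transformation with parameters `g` at the coefficient `σ`, as a function
of the old time and the other new variables. -/
def invFun (g : GroupParam) (σ : ℝ → ℝ) (t : ℝ) (Q : VarSpace) : VarSpace :=
  let y := (Q.1.2.2 - g.Y₀ t) / g.Y₁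
  let x := (Q.1.2.1 - g.shear σ t * y - g.β₀ t) / g.scale t
  ((t, x, y), g.uOld σ t x y Q.2)

theorem uOld_eq_add (g : GroupParam) (σ : ℝ → ℝ) (t x y u : ℝ) :
    g.uOld σ t x y u = g.scale t * u + g.uOld σ t x y 0 := by
  simp only [uOld, scale]
  ring

theorem Valid.contDiffAt_uOld (h : g.Valid J) (hJ : IsOpen J) (hσ : ∀ t ∈ J, ContDiffAt ℝ ∞ σ t)
    (h0 : ∀ t ∈ J, σ t ≠ 0) {E : Type*} [NormedAddCommGroup E] [NormedSpace ℝ E] {z : E}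
    {t x y u : E → ℝ} (hz : t z ∈ J) (ht : ContDiffAt ℝ ∞ t z) (hx : ContDiffAt ℝ ∞ x z)
    (hy : ContDiffAt ℝ ∞ y z) (hu : ContDiffAt ℝ ∞ u z) :
    ContDiffAt ℝ ∞ (fun z => g.uOld σ (t z) (x z) (y z) (u z)) z := by
  have c : ∀ {f : ℝ → ℝ}, ContDiffAt ℝ ∞ f (t z) → ContDiffAt ℝ ∞ (fun z => f (t z)) z :=
    fun {f} hf => ContDiffAt.comp (g := f) z hf ht
  have c1 := h.contDiffAt_scale hz
  have c2 := h.contDiffAt_shear hJ hz (hσ _ hz) (h0 _ hz)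
  have c3 := h.contDiffAt_β₀ hJ hz
  have n := h.scale_ne_zero hz
  have n' := h.denom_ne_zero _ hz
  have c4 : ContDiffAt ℝ ∞ (fun t => g.c / (g.c * t + g.d)) (t z) :=
    contDiffAt_const.div ((contDiffAt_const.mul contDiffAt_id).add contDiffAt_const) n'
  have key := ((c c1).mul hu).add (((((c c4).mul hx).sub
    (((c (contDiffAt_deriv c2)).div (c c1) n).mul hy)).sub
    (((c (hσ _ hz)).mul ((c c2).pow 2)).div ((c c1).pow 2) (pow_ne_zero 2 n))).sub
    ((c (contDiffAt_deriv c3)).div (c c1) n))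
  refine key.congr_of_eventuallyEq ?_
  filter_upwards [ht.continuousAt.eventually (hJ.mem_nhds hz)] with w hw
  exact h.uOld_eq hJ hw (hσ _ hw) (h0 _ hw) _ _ _

theorem contDiffOn_toFun (h : g.Valid I) (hσ : IsCoefficient σ I) :
    ContDiffOn ℝ ∞ (g.toFun σ) (slab I) := by
  intro P hP
  have hJ := hσ.isOpen
  have c1 := contDiffAt_time (h.contDiffAt_scale hP)
  have c2 := contDiffAt_time (h.contDiffAt_shear hJ hP (hσ.contDiffAt hP) (hσ.ne_zero _ hP))
  have ct : ContDiffAt ℝ ∞ (fun P : VarSpace => P.1.1) P := contDiffAt_fst.fst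
  have cx : ContDiffAt ℝ ∞ (fun P : VarSpace => P.1.2.1) P := contDiffAt_fst.snd.fst
  have cy : ContDiffAt ℝ ∞ (fun P : VarSpace => P.1.2.2) P := contDiffAt_fst.snd.snd
  have hx : ContDiffAt ℝ ∞ (fun P : VarSpace => g.xNew σ P.1.1 P.1.2.1 P.1.2.2) P := by
    simp only [xNew_eq]
    exact ((c1.mul cx).add (c2.mul cy)).add (contDiffAt_time (h.contDiffAt_β₀ hJ hP))
  have hu := h.contDiffAt_uOld hJ (fun t ht => hσ.contDiffAt ht) hσ.ne_zero
    (t := fun P : VarSpace => P.1.1) (z := P) hP ct cx cy (contDiffAt_const (c := (0 : ℝ)))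
  exact (((contDiffAt_time (h.contDiffAt_T hP)).prodMk (hx.prodMk ((contDiffAt_const.mul cy).add
    (contDiffAt_time (h.contDiffAt_Y₀ hJ hP))))).prodMk
      ((contDiffAt_snd.sub hu).div c1 (h.scale_ne_zero hP))).contDiffWithinAt

theorem contDiffOn_invFun (h : g.Valid I) (hσ : IsCoefficient σ I) :
    ContDiffOn ℝ ∞ (fun Q => g.invFun σ (g.invT Q.1.1) Q) (slab (g.T '' I)) := by
  intro Q hQ
  obtain ⟨t, ht, htQ⟩ := hQ
  have e : g.invT Q.1.1 = t := by rw [← htQ, h.invT_T ht]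
  have hJ := hσ.isOpen
  have ct : ContDiffAt ℝ ∞ (fun Q : VarSpace => g.invT Q.1.1) Q :=
    contDiffAt_time (by rw [← htQ]; exact h.contDiffAt_invT ht)
  have c : ∀ {f : ℝ → ℝ}, ContDiffAt ℝ ∞ f t →
      ContDiffAt ℝ ∞ (fun Q : VarSpace => f (g.invT Q.1.1)) Q := fun {f} hf =>
    ContDiffAt.comp (g := f) Q (by rwa [e]) ct
  have c1 := c (h.contDiffAt_scale ht)
  have c2 := c (h.contDiffAt_shear hJ ht (hσ.contDiffAt ht) (hσ.ne_zero _ ht))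
  have cx : ContDiffAt ℝ ∞ (fun P : VarSpace => P.1.2.1) Q := contDiffAt_fst.snd.fst
  have cy : ContDiffAt ℝ ∞ (fun P : VarSpace => P.1.2.2) Q := contDiffAt_fst.snd.snd
  have hy : ContDiffAt ℝ ∞ (fun Q : VarSpace => (Q.1.2.2 - g.Y₀ (g.invT Q.1.1)) / g.Y₁) Q :=
    (cy.sub (c (h.contDiffAt_Y₀ hJ ht))).div contDiffAt_const h.Y₁_ne_zero
  have hx : ContDiffAt ℝ ∞ (fun Q : VarSpace => (Q.1.2.1 - g.shear σ (g.invT Q.1.1)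
      * ((Q.1.2.2 - g.Y₀ (g.invT Q.1.1)) / g.Y₁) - g.β₀ (g.invT Q.1.1))
        / g.scale (g.invT Q.1.1)) Q :=
    ((cx.sub (c2.mul hy)).sub (c (h.contDiffAt_β₀ hJ ht))).div c1
      (by rw [e]; exact h.scale_ne_zero ht)
  have hu := h.contDiffAt_uOld hJ (fun t ht => hσ.contDiffAt ht) hσ.ne_zero
    (t := fun Q : VarSpace => g.invT Q.1.1) (z := Q) (by rw [e]; exact ht) ct hx hy
    (contDiffAt_snd (𝕜 := ℝ) (E := IndepSpace) (F := ℝ))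
  exact ((ct.prodMk (hx.prodMk hy)).prodMk hu).contDiffWithinAt

/-- The transformation with parameters `g` at the coefficient `σ`, with the largest domain. -/
def toHomeomorph (g : GroupParam) (σ : ℝ → ℝ) (h : g.Valid I) (hσ : IsCoefficient σ I) :
    OpenPartialHomeomorph VarSpace VarSpace where
  toFun := g.toFun σ
  invFun Q := g.invFun σ (g.invT Q.1.1) Q
  source := slab I
  target := slab (g.T '' I)
  map_source' P hP := ⟨_, hP, rfl⟩
  map_target' := by
    rintro Q ⟨t, ht, hQ⟩
    change g.invT Q.1.1 ∈ I
    rw [← hQ, h.invT_T ht]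
    exact ht
  left_inv' P hP := by
    have n := h.scale_ne_zero hP
    have n' := h.Y₁_ne_zero
    have hy : (g.Y₁ * P.1.2.2 + g.Y₀ P.1.1 - g.Y₀ P.1.1) / g.Y₁ = P.1.2.2 := by
      field_simp
      ring
    have hx : (g.xNew σ P.1.1 P.1.2.1 P.1.2.2 - g.shear σ P.1.1 * P.1.2.2 - g.β₀ P.1.1)
        / g.scale P.1.1 = P.1.2.1 := by
      rw [xNew_eq]
      field_simp
      ring
    simp only [toFun, invFun]
    rw [h.invT_T hP, hy, hx, uOld_eq_add, mul_div_cancel₀ _ n, sub_add_cancel]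
  right_inv' := by
    rintro Q ⟨t, ht, hQ⟩
    have n := h.scale_ne_zero ht
    have n' := h.Y₁_ne_zero
    have e : g.invT Q.1.1 = t := by rw [← hQ, h.invT_T ht]
    simp only [toFun, invFun]
    rw [e]
    refine Prod.ext (Prod.ext hQ (Prod.ext ?_ ?_)) ?_
    · simp only [xNew_eq]
      field_simp
      ring
    · simp only
      field_simp
      ring
    · simp only
      rw [uOld_eq_add, add_sub_cancel_right, mul_div_cancel_left₀ _ n]
  open_source := isOpen_slab hσ.isOpen
  open_target := isOpen_slab (h.isOpen_image_T hσ.isOpen)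
  continuousOn_toFun := (contDiffOn_toFun h hσ).continuousOn
  continuousOn_invFun := (contDiffOn_invFun h hσ).continuousOn

theorem isPointTransformation_toHomeomorph (h : g.Valid I) (hσ : IsCoefficient σ I) :
    IsPointTransformation (g.toHomeomorph σ h hσ) :=
  ⟨contDiffOn_toFun h hσ, contDiffOn_invFun h hσ⟩

theorem realizes_toHomeomorph (h : g.Valid I) (hσ : IsCoefficient σ I)
    (hco : ∀ t ∈ I, σ t * g.Y₁ ^ 2 = σ' (g.T t) * g.scale t ^ 3) :
    g.Realizes σ σ' (g.toHomeomorph σ h hσ) := by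
  have ht : timeRange (g.toHomeomorph σ h hσ).source = I := timeRange_slab
  refine ⟨by rw [ht]; exact h, fun _ _ _ _ _ => rfl, fun _ _ _ _ _ => rfl, fun _ _ _ _ _ => rfl,
    fun t x y u hP => ?_, fun t htt => ?_⟩
  · have n : g.scale t ≠ 0 := h.scale_ne_zero hP
    change u = g.uOld σ t x y ((u - g.uOld σ t x y 0) / g.scale t)
    rw [uOld_eq_add, mul_div_cancel₀ _ n, sub_add_cancel]
  · rw [ht] at htt
    rw [h.coeff_iff htt]
    exact hco t htt

theorem inGE_toHomeomorph (h : g.Valid I) (hσ : IsCoefficient σ I)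
    (hco : ∀ t ∈ I, σ t * g.Y₁ ^ 2 = σ' (g.T t) * g.scale t ^ 3) :
    InGE σ I σ' (g.T '' I) (g.toHomeomorph σ h hσ) :=
  ⟨isPointTransformation_toHomeomorph h hσ, subset_rfl, subset_rfl, g,
    realizes_toHomeomorph h hσ hco⟩

/-- The coefficient of the transformed equation. -/
def newCoeff (g : GroupParam) (σ : ℝ → ℝ) (t : ℝ) : ℝ :=
  σ (g.invT t) * g.Y₁ ^ 2 / g.scale (g.invT t) ^ 3

theorem newCoeff_T (h : g.Valid I) {t : ℝ} (ht : t ∈ I) :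
    σ t * g.Y₁ ^ 2 = g.newCoeff σ (g.T t) * g.scale t ^ 3 := by
  have := h.scale_ne_zero ht
  rw [newCoeff, h.invT_T ht]
  field_simp

theorem isCoefficient_newCoeff (h : g.Valid I) (hσ : IsCoefficient σ I) :
    IsCoefficient (g.newCoeff σ) (g.T '' I) where
  isOpen := h.isOpen_image_T hσ.isOpen
  ordConnected := h.ordConnected_image_T hσ.ordConnected
  nonempty := hσ.nonempty.image _
  smooth := by
    rintro _ ⟨t, ht, rfl⟩
    refine (h.contDiffAt_comp_invT ht (f := fun t => σ t * g.Y₁ ^ 2 / g.scale t ^ 3)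
      ?_).contDiffWithinAt
    exact ((hσ.contDiffAt ht).mul contDiffAt_const).div ((h.contDiffAt_scale ht).pow 3)
      (pow_ne_zero 3 (h.scale_ne_zero ht))
  ne_zero := by
    rintro _ ⟨t, ht, rfl⟩
    rw [newCoeff, h.invT_T ht]
    exact div_ne_zero (mul_ne_zero (hσ.ne_zero t ht) (pow_ne_zero 2 h.Y₁_ne_zero))
      (pow_ne_zero 3 (h.scale_ne_zero ht))

end GroupParam
end Action

/-! ### Symmetries and reducibility to constant coefficients -/

section Symmetries

open Polynomial

variable {σ : ℝ → ℝ} {I : Set ℝ}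

namespace GroupParam

/-- The parameters of the transformation `x' = x + β(t)`, `u' = u + β'(t)`. -/
def ofBoost (β : ℝ → ℝ) : GroupParam := ⟨1, 0, 0, 1, 1, 1, 0, β⟩

variable {β : ℝ → ℝ}

theorem T_ofBoost (t : ℝ) : (ofBoost β).T t = t := by simp [T, ofBoost]

theorem Δ_ofBoost : (ofBoost β).Δ = 1 := by simp [Δ, ofBoost]

theorem scale_ofBoost (t : ℝ) : (ofBoost β).scale t = 1 := by
  rw [scale, Δ_ofBoost]
  simp [ofBoost]

theorem valid_ofBoost (hβ : ContDiffOn ℝ ∞ β I) : (ofBoost β).Valid I :=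
  ⟨by rw [Δ_ofBoost]; exact one_pos, Or.inl rfl, one_ne_zero, contDiffOn_const, hβ,
    fun t _ => by simp [ofBoost]⟩

theorem image_T_ofBoost : (ofBoost β).T '' I = I := by
  simp only [T_ofBoost, image_id']

theorem toFun_ofBoost (P : VarSpace) : (ofBoost β).toFun σ P
    = ((P.1.1, P.1.2.1 + β P.1.1, P.1.2.2), P.2 + deriv β P.1.1) := by
  have h0 : deriv (0 : ℝ → ℝ) = 0 := by
    funext t
    exact deriv_const t (0 : ℝ)
  rw [toFun, T_ofBoost, scale_ofBoost, xNew_eq, scale_ofBoost, uOld, Δ_ofBoost, shear]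
  simp [ofBoost, h0]

theorem inGE_ofBoost (hσ : IsCoefficient σ I) (hβ : ContDiffOn ℝ ∞ β I) :
    InGE σ I σ I ((ofBoost β).toHomeomorph σ (valid_ofBoost hβ) hσ) := by
  have := inGE_toHomeomorph (σ' := σ) (valid_ofBoost hβ) hσ fun t _ => by
    rw [T_ofBoost, scale_ofBoost]
    simp [ofBoost]
  rwa [image_T_ofBoost] at this

end GroupParam

/-- The vector fields `p(t) ∂_x + p'(t) ∂_u`, for polynomials `p`. -/
def boostField (I : Set ℝ) : ℝ[X] →ₗ[ℝ] (slab I → VarSpace) where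
  toFun p P := ((0, p.eval P.1.1.1, 0), p.derivative.eval P.1.1.1)
  map_add' p q := by
    funext P
    simp
  map_smul' r p := by
    funext P
    simp

theorem contDiff_eval (p : ℝ[X]) : ContDiff ℝ ∞ fun t => p.eval t := by
  simpa using p.contDiff_aeval (𝕜 := ℝ) ∞

/-- A polynomial that vanishes on a nonempty open set is zero. -/
theorem boostField_injective (hI : IsOpen I) (hne : I.Nonempty) :
    Function.Injective (boostField I) := by
  rw [injective_iff_map_eq_zero]
  intro p hp
  obtain ⟨t, ht⟩ := hne
  have hinf : I.Infinite := infinite_of_mem_nhds t (hI.mem_nhds ht)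
  refine p.eq_zero_of_infinite_isRoot (hinf.mono fun s hs => ?_)
  have := congrFun hp ⟨((s, 0, 0), 0), hs⟩
  exact congrArg (fun Q : VarSpace => Q.1.2.1) this

theorem isGenerator_boostField (hσ : IsCoefficient σ I) (p : ℝ[X]) :
    IsGenerator σ I (boostField I p) := by
  have hβ : ∀ s : ℝ, ContDiffOn ℝ ∞ (fun t => s * p.eval t) I := fun s =>
    (contDiff_const.mul (contDiff_eval p)).contDiffOn
  have hd : ∀ s t : ℝ, deriv (fun t => s * p.eval t) t = s * p.derivative.eval t := fun s t =>
    ((p.hasDerivAt t).const_mul s).deriv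
  let Φ : ℝ → OpenPartialHomeomorph VarSpace VarSpace := fun s =>
    (GroupParam.ofBoost fun t => s * p.eval t).toHomeomorph σ (GroupParam.valid_ofBoost (hβ s)) hσ
  have hΦ : ∀ s P, Φ s P = ((P.1.1, P.1.2.1 + s * p.eval P.1.1, P.1.2.2),
      P.2 + s * p.derivative.eval P.1.1) := fun s P => by
    rw [← hd]
    exact GroupParam.toFun_ofBoost P
  refine ⟨Φ, fun s => ⟨rfl, GroupParam.inGE_ofBoost hσ (hβ s)⟩, ?_, fun P _ => ?_,
    fun r s P _ => ?_, fun P => ?_⟩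
  · simp only [hΦ]
    have c1 : ContDiff ℝ ∞ fun q : ℝ × VarSpace => p.eval q.2.1.1 :=
      (contDiff_eval p).comp contDiff_snd.fst.fst
    have c2 : ContDiff ℝ ∞ fun q : ℝ × VarSpace => p.derivative.eval q.2.1.1 :=
      (contDiff_eval p.derivative).comp contDiff_snd.fst.fst
    exact ((contDiff_snd.fst.fst.prodMk ((contDiff_snd.fst.snd.fst.add
      (contDiff_fst.mul c1)).prodMk contDiff_snd.fst.snd.snd)).prodMk
      (contDiff_snd.snd.add (contDiff_fst.mul c2))).contDiffOn
  · rw [hΦ]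
    simp
  · rw [hΦ, hΦ, hΦ]
    simp only [Prod.mk.injEq, true_and, and_true]
    constructor <;> ring
  · simp only [hΦ]
    have key : ∀ a b : ℝ, HasDerivAt (fun s : ℝ => a + s * b) b 0 := fun a b => by
      simpa using ((hasDerivAt_id (0 : ℝ)).mul_const b).const_add a
    exact ((hasDerivAt_const (0 : ℝ) _).prodMk ((key _ _).prodMk
      (hasDerivAt_const (0 : ℝ) _))).prodMk (key _ _)

theorem exists_infinite_dimensional_generators (hσ : IsCoefficient σ I) :
    ∃ W : Submodule ℝ (slab I → VarSpace),
      ¬ FiniteDimensional ℝ W ∧ ∀ V ∈ W, IsGenerator σ I V := by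
  refine ⟨LinearMap.range (boostField I), fun hfin => ?_, ?_⟩
  · have e := LinearEquiv.ofInjective _ (boostField_injective hσ.isOpen hσ.nonempty)
    have : Module.Finite ℝ ℝ[X] := Module.Finite.equiv e.symm
    exact Polynomial.not_finite this
  · rintro _ ⟨p, rfl⟩
    exact isGenerator_boostField hσ p

end Symmetries

section ConstantCoefficient

variable {σ : ℝ → ℝ} {I : Set ℝ}

theorem isCoefficient_const {k : ℝ} (hk : k ≠ 0) {J : Set ℝ} (h1 : IsOpen J)
    (h2 : J.OrdConnected) (h3 : J.Nonempty) : IsCoefficient (fun _ => k) J :=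
  ⟨h1, h2, h3, contDiffOn_const, fun _ _ => hk⟩

theorem exists_admissible_const (hσ : IsCoefficient σ I) {g : GroupParam} (h : g.Valid I) {k : ℝ}
    (hk : k ≠ 0) (hco : ∀ t ∈ I, σ t * g.Y₁ ^ 2 = k * g.scale t ^ 3) :
    ∃ (k : ℝ) (I' : Set ℝ) (Φ : OpenPartialHomeomorph VarSpace VarSpace),
      IsCoefficient (fun _ => k) I' ∧ Φ.source = slab I ∧ Admissible σ I (fun _ => k) I' Φ :=
  ⟨k, g.T '' I, g.toHomeomorph σ h hσ, isCoefficient_const hk (h.isOpen_image_T hσ.isOpen)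
    (h.ordConnected_image_T hσ.ordConnected) (hσ.nonempty.image _), rfl,
    (GroupParam.inGE_toHomeomorph h hσ hco).admissible hσ⟩

/-- A coefficient that can be made constant is, locally, the product of a constant and the inverse
third power of an affine function. -/
theorem Admissible.exists_eventually_eq {k : ℝ} {I' : Set ℝ}
    {Φ : OpenPartialHomeomorph VarSpace VarSpace} (h : Admissible σ I (fun _ => k) I' Φ)
    (hσ : IsCoefficient σ I) {t : ℝ} (ht : t ∈ timeRange Φ.source) :
    ∃ K c d : ℝ, c * t + d ≠ 0 ∧ ∀ᶠ s in 𝓝 t, σ s * (c * s + d) ^ 3 = K := by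
  obtain ⟨P, hP, rfl⟩ := ht
  obtain ⟨U, hU, hPU, hG⟩ := h.exists_inGE_restr hσ hP
  obtain ⟨g, hg⟩ := hG.exists_param
  have hPs : P ∈ (Φ.restr U).source := by
    rw [Φ.restr_source, hU.interior_eq]
    exact ⟨hP, hPU⟩
  have hV := hg.valid
  refine ⟨k * (g.ε * √g.Δ) ^ 3 / g.Y₁ ^ 2, g.c, g.d, hV.denom_ne_zero _ ⟨P, hPs, rfl⟩, ?_⟩
  filter_upwards [(isOpen_timeRange (Φ.restr U).open_source).mem_nhds ⟨P, hPs, rfl⟩] with s hs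
  have h1 := (hV.coeff_iff hs _ _).1 (hg.coeff_eq s hs)
  have h2 := hV.denom_ne_zero s hs
  have h3 := hV.Y₁_ne_zero
  rw [GroupParam.scale] at h1
  rw [eq_div_iff (pow_ne_zero 2 h3)]
  field_simp at h1
  linear_combination h1

/-- By analytic continuation, a coefficient that is locally the product of a constant and the
inverse third power of an affine function is so globally. -/
theorem exists_const_mul_cube_eq (hσ : IsCoefficient σ I)
    (h : ∀ t ∈ I, ∃ K c d : ℝ, c * t + d ≠ 0 ∧ ∀ᶠ s in 𝓝 t, σ s * (c * s + d) ^ 3 = K) :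
    ∃ K c d : ℝ, K ≠ 0 ∧ ∀ t ∈ I, σ t * (c * t + d) ^ 3 = K := by
  have han : AnalyticOnNhd ℝ σ I := fun t ht => by
    obtain ⟨K, c, d, h0, h1⟩ := h t ht
    have hc : ContinuousAt (fun s : ℝ => c * s + d) t := by fun_prop
    have ha : AnalyticAt ℝ (fun s : ℝ => K / (c * s + d) ^ 3) t :=
      analyticAt_const.fun_div (((analyticAt_const.fun_mul analyticAt_id).fun_add
        analyticAt_const).fun_pow 3) (pow_ne_zero 3 h0)
    refine ha.congr ?_
    filter_upwards [h1, hc.eventually_ne h0] with s hs hs0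
    rw [div_eq_iff (pow_ne_zero 3 hs0), hs]
  obtain ⟨t₀, ht₀⟩ := hσ.nonempty
  obtain ⟨K, c, d, h0, h1⟩ := h t₀ ht₀
  refine ⟨K, c, d, ?_, ?_⟩
  · rw [← h1.self_of_nhds]
    exact mul_ne_zero (hσ.ne_zero _ ht₀) (pow_ne_zero 3 h0)
  · have ha : AnalyticOnNhd ℝ (fun s : ℝ => σ s * (c * s + d) ^ 3) I := fun t ht =>
      (han t ht).fun_mul (((analyticAt_const.fun_mul analyticAt_id).fun_add
        analyticAt_const).fun_pow 3)
    exact ha.eqOn_of_preconnected_of_eventuallyEq (fun t _ => analyticAt_const (v := K))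
      (isPreconnected_iff_ordConnected.2 hσ.ordConnected) ht₀ h1

theorem tfae_constant_coefficient (hσ : IsCoefficient σ I) :
    List.TFAE [
      ∃ (k : ℝ) (I' : Set ℝ) (Φ : OpenPartialHomeomorph VarSpace VarSpace),
        IsCoefficient (fun _ => k) I' ∧ Φ.source = slab I ∧
        Admissible σ I (fun _ => k) I' Φ,
      ∀ t ∈ I, ∃ (k : ℝ) (I' : Set ℝ) (Φ : OpenPartialHomeomorph VarSpace VarSpace),
        IsCoefficient (fun _ => k) I' ∧ t ∈ timeRange Φ.source ∧
        Admissible σ I (fun _ => k) I' Φ,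
      ∃ σ₀ : ℝ, σ₀ ≠ 0 ∧ ((∀ t ∈ I, σ t = σ₀) ∨
        ∃ κ : ℝ, ∀ t ∈ I, σ t = σ₀ * (t + κ) ^ (-3 : ℤ))] := by
  tfae_have 1 → 2 := by
    rintro ⟨k, I', Φ, h1, h2, h3⟩ t ht
    exact ⟨k, I', Φ, h1, by rwa [h2, timeRange_slab], h3⟩
  tfae_have 2 → 3 := by
    intro h
    obtain ⟨K, c, d, hK, hσK⟩ := exists_const_mul_cube_eq hσ fun t ht => by
      obtain ⟨k, I', Φ, -, h2, h3⟩ := h t ht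
      exact h3.exists_eventually_eq hσ h2
    have hne : ∀ t ∈ I, c * t + d ≠ 0 := fun t ht h0 => by
      have := hσK t ht
      rw [h0] at this
      exact hK (by rw [← this]; ring)
    by_cases hc : c = 0
    · subst hc
      obtain ⟨t₀, ht₀⟩ := hσ.nonempty
      have hd : d ≠ 0 := by simpa using hne t₀ ht₀
      refine ⟨K / d ^ 3, div_ne_zero hK (pow_ne_zero 3 hd), Or.inl fun t ht => ?_⟩
      rw [eq_div_iff (pow_ne_zero 3 hd), ← hσK t ht]
      ring
    · refine ⟨K / c ^ 3, div_ne_zero hK (pow_ne_zero 3 hc), Or.inr ⟨d / c, fun t ht => ?_⟩⟩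
      have h1 := hne t ht
      have e : t + d / c = (c * t + d) / c := by
        field_simp
      rw [e, ← hσK t ht, zpow_neg, show (3 : ℤ) = ((3 : ℕ) : ℤ) from rfl, zpow_natCast, div_pow]
      field_simp
  tfae_have 3 → 1 := by
    rintro ⟨k, hk, h | ⟨κ, h⟩⟩
    · refine exists_admissible_const hσ (g := GroupParam.ofBoost 0)
        (GroupParam.valid_ofBoost contDiffOn_const) hk fun t ht => ?_
      rw [GroupParam.scale_ofBoost, h t ht]
      simp [GroupParam.ofBoost]
    · have hne : ∀ t ∈ I, t + κ ≠ 0 := fun t ht h0 => by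
        have := hσ.ne_zero t ht
        rw [h t ht, h0] at this
        norm_num at this
      -- `t' = -1 / (t + κ)` makes the coefficient constant
      let g : GroupParam := ⟨0, -1, 1, κ, 1, 1, 0, 0⟩
      have hΔ : g.Δ = 1 := by simp [GroupParam.Δ, g]
      have hV : g.Valid I := ⟨by rw [hΔ]; exact one_pos, Or.inl rfl, one_ne_zero, contDiffOn_const,
        contDiffOn_const, fun t ht => by simpa [g] using hne t ht⟩
      refine exists_admissible_const hσ hV hk fun t ht => ?_
      rw [GroupParam.scale, hΔ, h t ht, zpow_neg, show (3 : ℤ) = ((3 : ℕ) : ℤ) from rfl,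
        zpow_natCast]
      simp [g]
  tfae_finish

end ConstantCoefficient

section Identity

theorem inGE_refl {σ : ℝ → ℝ} {I : Set ℝ} (hσ : IsCoefficient σ I) :
    InGE σ I σ I ((OpenPartialHomeomorph.refl VarSpace).restr (slab I)) := by
  have hs : ((OpenPartialHomeomorph.refl VarSpace).restr (slab I)).source = slab I := by
    rw [OpenPartialHomeomorph.restr_source, (isOpen_slab hσ.isOpen).interior_eq]
    exact univ_inter _
  have ht : ((OpenPartialHomeomorph.refl VarSpace).restr (slab I)).target = slab I := by
    rw [← OpenPartialHomeomorph.image_source_eq_target, hs]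
    exact image_id _
  have hβ : ContDiffOn ℝ ∞ (0 : ℝ → ℝ) I := contDiffOn_const
  have hr := GroupParam.realizes_toHomeomorph (σ' := σ) (GroupParam.valid_ofBoost hβ) hσ
    fun t _ => by
      rw [GroupParam.T_ofBoost, GroupParam.scale_ofBoost]
      simp [GroupParam.ofBoost]
  have hid : ∀ P, (GroupParam.ofBoost 0).toHomeomorph σ (GroupParam.valid_ofBoost hβ) hσ P = P :=
    fun P => by
      refine (GroupParam.toFun_ofBoost P).trans ?_
      have h0 : deriv (0 : ℝ → ℝ) = 0 := by
        funext t
        exact deriv_const t (0 : ℝ)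
      simp [h0]
  refine ⟨⟨contDiffOn_id, contDiffOn_id⟩, hs.subset, ht.subset, GroupParam.ofBoost 0, ?_⟩
  have e : ∀ P, (OpenPartialHomeomorph.refl VarSpace).restr (slab I) P
    = (GroupParam.ofBoost 0).toHomeomorph σ (GroupParam.valid_ofBoost hβ) hσ P := fun P =>
      (hid P).symm
  refine ⟨by rw [hs]; exact hr.valid, fun t x y u hP => ?_, fun t x y u hP => ?_,
    fun t x y u hP => ?_, fun t x y u hP => ?_, by rw [hs]; exact hr.coeff_eq⟩ <;> rw [hs] at hP <;> rw [e]
  · exact hr.t_eq _ _ _ _ hP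
  · exact hr.x_eq _ _ _ _ hP
  · exact hr.y_eq _ _ _ _ hP
  · exact hr.u_eq _ _ _ _ hP

end Identity

end

theorem mainTheorem1 :
    -- every choice of parameters acts on every equation of the class, mapping it into the class
    (∀ (σ : ℝ → ℝ) (I : Set ℝ), IsCoefficient σ I → ∀ g : GroupParam, g.Valid I →
      ∃ (σ' : ℝ → ℝ) (Φ : OpenPartialHomeomorph VarSpace VarSpace),
        IsCoefficient σ' (g.T '' I) ∧ Φ.source = slab I ∧ Φ.target = slab (g.T '' I) ∧
        g.Realizes σ σ' Φ ∧ Admissible σ I σ' (g.T '' I) Φ) ∧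
    -- the point transformations between equations of the class are exactly those of the family
    (∀ (σ : ℝ → ℝ) (I : Set ℝ) (σ' : ℝ → ℝ) (I' : Set ℝ),
      IsCoefficient σ I → IsCoefficient σ' I' →
      ∀ Φ : OpenPartialHomeomorph VarSpace VarSpace,
        IsPreconnected Φ.source →
        (∀ t : ℝ, IsPreconnected (Φ.source ∩ {P | P.1.1 = t})) →
        (Admissible σ I σ' I' Φ ↔ InGE σ I σ' I' Φ)) ∧
    -- on arbitrary domains, this is so near every point
    (∀ (σ : ℝ → ℝ) (I : Set ℝ) (σ' : ℝ → ℝ) (I' : Set ℝ),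
      IsCoefficient σ I → IsCoefficient σ' I' →
      ∀ Φ : OpenPartialHomeomorph VarSpace VarSpace, Admissible σ I σ' I' Φ →
        ∀ P ∈ Φ.source, ∃ U : Set VarSpace, IsOpen U ∧ P ∈ U ∧
          InGE σ I σ' I' (Φ.restr U)) ∧
    -- the transformations of the family form a (pseudo)group
    (∀ (σ : ℝ → ℝ) (I : Set ℝ), IsCoefficient σ I →
      InGE σ I σ I ((OpenPartialHomeomorph.refl VarSpace).restr (slab I))) ∧
    (∀ (σ : ℝ → ℝ) (I : Set ℝ) (σ' : ℝ → ℝ) (I' : Set ℝ)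
      (Φ : OpenPartialHomeomorph VarSpace VarSpace),
      IsCoefficient σ I → IsCoefficient σ' I' →
      InGE σ I σ' I' Φ → InGE σ' I' σ I Φ.symm) ∧
    (∀ (σ : ℝ → ℝ) (I : Set ℝ) (σ' : ℝ → ℝ) (I' : Set ℝ) (σ'' : ℝ → ℝ) (I'' : Set ℝ)
      (Φ Ψ : OpenPartialHomeomorph VarSpace VarSpace),
      IsCoefficient σ I → IsCoefficient σ' I' → IsCoefficient σ'' I'' →
      InGE σ I σ' I' Φ → InGE σ' I' σ'' I'' Ψ → InGE σ I σ'' I'' (Φ.trans Ψ)) ∧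
    -- it is infinite-dimensional
    (∀ (σ : ℝ → ℝ) (I : Set ℝ), IsCoefficient σ I →
      ∃ W : Submodule ℝ (slab I → VarSpace),
        ¬ FiniteDimensional ℝ W ∧ ∀ V ∈ W, IsGenerator σ I V) ∧
    -- the equations that are reducible to constant coefficients, globally or locally in time
    (∀ (σ : ℝ → ℝ) (I : Set ℝ), IsCoefficient σ I →
      List.TFAE [
        ∃ (k : ℝ) (I' : Set ℝ) (Φ : OpenPartialHomeomorph VarSpace VarSpace),
          IsCoefficient (fun _ => k) I' ∧ Φ.source = slab I ∧
          Admissible σ I (fun _ => k) I' Φ,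
        ∀ t ∈ I, ∃ (k : ℝ) (I' : Set ℝ) (Φ : OpenPartialHomeomorph VarSpace VarSpace),
          IsCoefficient (fun _ => k) I' ∧ t ∈ timeRange Φ.source ∧
          Admissible σ I (fun _ => k) I' Φ,
        ∃ σ₀ : ℝ, σ₀ ≠ 0 ∧ ((∀ t ∈ I, σ t = σ₀) ∨
          ∃ κ : ℝ, ∀ t ∈ I, σ t = σ₀ * (t + κ) ^ (-3 : ℤ))]) := by
  refine ⟨fun σ I hσ g hg => ⟨g.newCoeff σ, g.toHomeomorph σ hg hσ,
    GroupParam.isCoefficient_newCoeff hg hσ, rfl, rfl,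
    GroupParam.realizes_toHomeomorph hg hσ fun t ht => GroupParam.newCoeff_T hg ht,
    (GroupParam.inGE_toHomeomorph hg hσ fun t ht => GroupParam.newCoeff_T hg ht).admissible hσ⟩,
    fun σ I σ' I' hσ _ Φ hpre hsl => ⟨fun h => h.inGE hσ hpre hsl, fun h => h.admissible hσ⟩,
    fun σ I σ' I' hσ _ Φ h P hP => h.exists_inGE_restr hσ hP,
    fun σ I hσ => inGE_refl hσ,
    fun σ I σ' I' Φ hσ hσ' h => h.symm hσ hσ',
    fun σ I σ' I' σ'' I'' Φ Ψ hσ hσ' _ h h' => h.trans h' hσ hσ',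
    fun σ I hσ => exists_infinite_dimensional_generators hσ,
    fun σ I hσ => tfae_constant_coefficient hσ⟩
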